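/- Let $\mathcal P_n\subset U(2^n)$ be the Pauli group, generated by the single-qubit Pauli matrices $X_j,Y_j,Z_j$ ($1\le j\le n$), let $\mathcal N(\mathcal P_n)$ be its normalizer in $U(2^n)$, and let $\mathcal C_n=\mathcal N(\mathcal P_n)/U(1)$ be the Clifford group, where $U(1)$ is the group of scalar unitaries. Write $\bar{\mathcal P}_n$ for the image of $\mathcal P_n$ in $\mathcal C_n$. Let $\mathrm{Sp}(2n)=\mathrm{Sp}(2n,\mathbb F_2)$, acting on $\mathbb F_2^{2n}$ with coordinates ordered $x_1,z_1,\dots,x_n,z_n$, symplectic form $\langle v,w\rangle=\sum_j (v_{x_j}w_{z_j}+v_{z_j}w_{x_j})$ and transvections $Z_hv=v+\langle v,h\rangle h$. For $v=(a_1,b_1,\dots,a_n,b_n)\in\mathbb F_2^{2n}$ put $W(v)=\prod_{i=1}^n i^{a_ib_i}X_i^{a_i}Z_i^{b_i}$ (the base of the first power being the imaginary unit). Say that $U\in\mathcal N(\mathcal P_n)$ has parameters $(r,s,S)$, with $r,s\in\mathbb F_2^n$ and $S\in \mathrm{Sp}(2n)$, if $UX_jU^\dagger=(-1)^{r_j}W(S_{2j-1})$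 and $UZ_jU^\dagger=(-1)^{s_j}W(S_{2j})$ for all $j$, where $S_k$ is the $k$-th column of $S$. (1) For every $n$, there is a bijection $\Phi:\mathcal C_n\to(\mathbb F_2^n\times\mathbb F_2^n)\times \mathrm{Sp}(2n)$ such that $U$ has parameters $(r,s,S)$ if and only if $\Phi([U])=((r,s),S)$. The map that sends the coset of $[U]$ to the component $S$ of $\Phi([U])$ is a group isomorphism $\mathcal C_n/\bar{\mathcal P}_n\cong \mathrm{Sp}(2n)$. The bits $(r,s)$ of $\Phi$ map $\bar{\mathcal P}_n$ bijectively onto $\mathbb F_2^n\times\mathbb F_2^n$, and if $\Phi(c)=((r,s),S)$ and $p\in\bar{\mathcal P}_n$ has bits $(r',s')$, then $\Phi(cp)=((r+r',s+s'),S)$. So specifying an element of $\mathcal C_n$ is equivalent to specifying an element of the Pauli group up to phase (bit strings $r,s$) together with an element of $\mathrm{Sp}(2n)$. (2) $|\mathcal C_n|=2^{n^2+2n}\prod_{j=1}^n(4^j-1)$ for every $n$. (3) There are bijections $i\mapsto\sigma_n(i)$ from $\{0\le i<2^{n^2}\prod_{j=1}^n(4^j-1)\}$ onto $\mathrm{Sp}(2n)$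 and $i\mapsto g_n(i)$ from $\{0\le i<|\mathcal C_n|\}$ onto $\mathcal C_n$, for all $n$, with the following properties. (a) The $\sigma_n$ follow the chain $\mathrm{Sp}(2(n-1))\subset\mathrm{Sp}(2n)$, $S\mapsto 1_2\oplus S$: with $N(n)=2^{2n-1}(4^n-1)$, for every $n\ge1$ there are $\rho_n(c)\in\mathrm{Sp}(2n)$, $0\le c<N(n)$, such that $\sigma_n(c+N(n)q)=\rho_n(c)\,(1_2\oplus\sigma_{n-1}(q))$ for $0\le q<|\mathrm{Sp}(2(n-1))|$, and the first column of $\rho_n(c)$ is the binary expansion, least significant bit first, of $(c \bmod (4^n-1))+1$. (b) For $n\ge1$, $g_n(i)$ is the element of $\mathcal C_n$ whose parameters are: $r$ = the $n$ lowest binary digits of $i$, $s$ = the next $n$ digits, $S=\sigma_n(\lfloor i/4^n\rfloor)$. (c) There is one program (for all $n\ge 1$) that computes from $n$ and the binary digits of $i$ the parameters $(r,s,S)$ of $g_n(i)$, together with a factorization of $S$ into at most $4n$ transvections (given by vectors $h$), in $O(n^3)$ steps; and one program that computes from $n$ and the parameters $(r,s,S)$ of $g_n(i)$ the binary digits of $i$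 in $O(n^3)$ steps. Here a program works on finitely many registers holding natural numbers and finitely many two-dimensional bit arrays addressed by registers; a step sets a register to zero or to the value of another one, increments or decrements a register, starts a loop or a round of a loop bounded by a register, does nothing, or is one operation on bits (reading or writing a cell, a constant, comparing two registers, a Boolean operation, a branch). -/

import Mathlib

open scoped Matrix

noncomputable section

namespace Clif

/-! ### Pauli and Clifford groups -/

/-- The Pauli matrix `X`. -/
def sigmaX : Matrix (Fin 2) (Fin 2) ℂ := !![0, 1; 1, 0]

/-- The Pauli matrix `Y`. -/
def sigmaY : Matrix (Fin 2) (Fin 2) ℂ := !![0, -Complex.I; Complex.I, 0]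

/-- The Pauli matrix `Z`. -/
def sigmaZ : Matrix (Fin 2) (Fin 2) ℂ := !![1, 0; 0, -1]

/-- The tensor product `A₁ ⊗ ⋯ ⊗ Aₙ` as a `2ⁿ × 2ⁿ` matrix; basis states of `n` qubits are
bit strings `Fin n → Fin 2`. -/
def tensor {n : ℕ} (A : Fin n → Matrix (Fin 2) (Fin 2) ℂ) :
    Matrix (Fin n → Fin 2) (Fin n → Fin 2) ℂ :=
  Matrix.of fun x y => ∏ k, A k (x k) (y k)

/-- The one-qubit matrix `A` acting on qubit `j`, the identity on every other qubit. -/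
def onQubit {n : ℕ} (j : Fin n) (A : Matrix (Fin 2) (Fin 2) ℂ) :
    Matrix (Fin n → Fin 2) (Fin n → Fin 2) ℂ :=
  tensor (Pi.mulSingle j A)

/-- The unitary group `U(2ⁿ)`. -/
abbrev QubitUnitary (n : ℕ) := Matrix.unitaryGroup (Fin n → Fin 2) ℂ

/-- The Pauli group `Pₙ`, the subgroup of `U(2ⁿ)` generated by the `Xⱼ`, `Yⱼ`, `Zⱼ`. -/
def pauliGroup (n : ℕ) : Subgroup (QubitUnitary n) :=
  Subgroup.closure {U | ∃ j : Fin n,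
    U.1 = onQubit j sigmaX ∨ U.1 = onQubit j sigmaY ∨ U.1 = onQubit j sigmaZ}

/-- The normalizer `N(Pₙ)` of the Pauli group in `U(2ⁿ)`. -/
abbrev pauliNormalizer (n : ℕ) : Subgroup (QubitUnitary n) :=
  Subgroup.normalizer (pauliGroup n : Set (QubitUnitary n))

/-- The subgroup `U(1)` of global phases: the unitary scalar matrices. -/
def phases (n : ℕ) : Subgroup (QubitUnitary n) where
  carrier := {U | ∃ z : ℂ, U.1 = z • (1 : Matrix (Fin n → Fin 2) (Fin n → Fin 2) ℂ)}
  one_mem' := ⟨1, by simp⟩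
  mul_mem' := by
    rintro U V ⟨z, hz⟩ ⟨w, hw⟩
    exact ⟨z * w, by simp [hz, hw, smul_smul, mul_comm]⟩
  inv_mem' := by
    rintro U ⟨z, hz⟩
    exact ⟨star z, by
      rw [Matrix.UnitaryGroup.inv_val, hz, star_smul, star_one]⟩

instance phases_normal (n : ℕ) : (phases n).Normal where
  conj_mem := by
    rintro U ⟨z, hz⟩ V
    refine ⟨z, ?_⟩
    have h : V.1 * (V⁻¹).1 = 1 := by
      rw [← Matrix.UnitaryGroup.mul_val, mul_inv_cancel, Matrix.UnitaryGroup.one_val]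
    rw [Matrix.UnitaryGroup.mul_val, Matrix.UnitaryGroup.mul_val, hz, Matrix.mul_smul,
      Matrix.mul_one, Matrix.smul_mul, h]

/-- The Clifford group `Cₙ = N(Pₙ) / U(1)`. -/
abbrev CliffordGroup (n : ℕ) :=
  pauliNormalizer n ⧸ (phases n).subgroupOf (pauliNormalizer n)

/-- The class in `Cₙ` of a unitary in the normalizer of the Pauli group. -/
abbrev toClifford {n : ℕ} (U : pauliNormalizer n) : CliffordGroup n := QuotientGroup.mk U

/-- The image of the Pauli group in `Cₙ`, that is, the Pauli group up to global phase. -/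
def pauliClasses (n : ℕ) : Subgroup (CliffordGroup n) :=
  ((pauliGroup n).subgroupOf (pauliNormalizer n)).map
    (QuotientGroup.mk' ((phases n).subgroupOf (pauliNormalizer n)))

instance pauliClasses_normal (n : ℕ) : (pauliClasses n).Normal :=
  Subgroup.Normal.map inferInstance _ (QuotientGroup.mk'_surjective _)

/-! ### The symplectic description of a Clifford element -/

/-- The space `𝔽₂²ⁿ`; the coordinates `inl j` and `inr j` are the exponents of `Xⱼ` and `Zⱼ`. -/
abbrev Vec (n : ℕ) := Fin n ⊕ Fin n → ZMod 2

/-- `Sp(2n, 𝔽₂)`: the matrices `S` with `S J Sᵀ = J`. -/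
abbrev Sp (n : ℕ) := Matrix.symplecticGroup (Fin n) (ZMod 2)

/-- The Hermitian Pauli operator `∏ᵢ i^(aᵢ bᵢ) Xᵢ^aᵢ Zᵢ^bᵢ` with `a = v ∘ inl`, `b = v ∘ inr`. -/
def pauliOp {n : ℕ} (v : Vec n) : Matrix (Fin n → Fin 2) (Fin n → Fin 2) ℂ :=
  tensor fun k => Complex.I ^ ((v (Sum.inl k)).val * (v (Sum.inr k)).val) •
    (sigmaX ^ (v (Sum.inl k)).val * sigmaZ ^ (v (Sum.inr k)).val)

/-- Conjugation by `U` sends `Xⱼ` to `(-1)^(r j)` times the Pauli operator given by the column of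
`S` that belongs to `Xⱼ`, and `Zⱼ` to `(-1)^(s j)` times the one that belongs to `Zⱼ`. -/
def ActsAs {n : ℕ} (U : QubitUnitary n) (r s : Fin n → ZMod 2) (S : Sp n) : Prop :=
  ∀ j : Fin n,
    U.1 * onQubit j sigmaX * U.1ᴴ = (-1 : ℂ) ^ (r j).val • pauliOp (fun p => S.1 p (Sum.inl j)) ∧
    U.1 * onQubit j sigmaZ * U.1ᴴ = (-1 : ℂ) ^ (s j).val • pauliOp (fun p => S.1 p (Sum.inr j))

/-- The matrix of the symplectic transvection `v ↦ v + ⟨v, h⟩ h`, where `⟨v, h⟩ = vᵀ J h`. -/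
def transvection {n : ℕ} (h : Vec n) : Matrix (Fin n ⊕ Fin n) (Fin n ⊕ Fin n) (ZMod 2) :=
  1 + Matrix.vecMulVec h (Matrix.J (Fin n) (ZMod 2) *ᵥ h)

/-- Put a row and a column in front of `A`, with corner entry `a` and zeros elsewhere. -/
def border {n : ℕ} (a : ZMod 2) (A : Matrix (Fin n) (Fin n) (ZMod 2)) :
    Matrix (Fin (n + 1)) (Fin (n + 1)) (ZMod 2) :=
  Matrix.of (Fin.cons (Fin.cons a 0) fun i => Fin.cons 0 (A i))

/-- The embedding `S ↦ 1₂ ⊕ S` of `Sp(2n)` into `Sp(2(n+1))`, acting trivially on the first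
pair of coordinates. -/
def oneTwoSum {n : ℕ} (S : Matrix (Fin n ⊕ Fin n) (Fin n ⊕ Fin n) (ZMod 2)) :
    Matrix (Fin (n + 1) ⊕ Fin (n + 1)) (Fin (n + 1) ⊕ Fin (n + 1)) (ZMod 2) :=
  Matrix.fromBlocks (border 1 S.toBlocks₁₁) (border 0 S.toBlocks₁₂)
    (border 0 S.toBlocks₂₁) (border 1 S.toBlocks₂₂)

/-- `|Sp(2n, 𝔽₂)|`. -/
def spOrder (n : ℕ) : ℕ := 2 ^ n ^ 2 * ∏ j ∈ Finset.Icc 1 n, (4 ^ j - 1)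

/-- `|Cₙ|`. -/
def cliffordOrder (n : ℕ) : ℕ := 2 ^ (n ^ 2 + 2 * n) * ∏ j ∈ Finset.Icc 1 n, (4 ^ j - 1)

/-- The position of a coordinate of `𝔽₂²ⁿ` in the ordering `X₁, Z₁, X₂, Z₂, …`, from `0`. -/
def pos {n : ℕ} : Fin n ⊕ Fin n → ℕ
  | Sum.inl j => 2 * j.val
  | Sum.inr j => 2 * j.val + 1

/-- A Boolean as an element of `𝔽₂`. -/
def toF2 (b : Bool) : ZMod 2 := if b then 1 else 0

/-! ### Programs that operate on bits, with their step count

A machine has registers that hold natural numbers and two-dimensional arrays of bits, whose cells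
are addressed through registers. A program names finitely many of them. In one step a register can
change by at most one, become zero, or take the value of another one, so within `t` steps no register exceeds its
largest initial value by more than `t`; there is no arithmetic on long integers at unit cost. -/

/-- The content of the registers (`reg x`) and of the cells (`bit a i j`) of the bit arrays. -/
structure Store where
  reg : ℕ → ℕ
  bit : ℕ → ℕ → ℕ → Bool

/-- Bit-valued expressions. In `cell a x y` and `lt x y` the `x` and `y` name registers. -/
inductive BitExp where
  | const (b : Bool)
  | cell (a x y : ℕ)
  | lt (x y : ℕ)
  | not (e : BitExp)
  | and (e f : BitExp)
  | xor (e f : BitExp)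

/-- The value of an expression. -/
def BitExp.eval (σ : Store) : BitExp → Bool
  | const b => b
  | cell a x y => σ.bit a (σ.reg x) (σ.reg y)
  | lt x y => decide (σ.reg x < σ.reg y)
  | not e => Bool.not (e.eval σ)
  | and e f => Bool.and (e.eval σ) (f.eval σ)
  | xor e f => Bool.xor (e.eval σ) (f.eval σ)

/-- The number of operations that evaluate an expression. -/
def BitExp.size : BitExp → ℕ
  | const _ => 1
  | cell _ _ _ => 1
  | lt _ _ => 1
  | not e => e.size + 1
  | and e f => e.size + f.size + 1
  | xor e f => e.size + f.size + 1

/-- Programs: `x := 0`, `x := y`, `x := x + 1`, `x := x - 1` on registers, `a[x, y] := e` on bits,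
sequences, case distinctions, and loops `for x = 0, …, y - 1 do c` (with the value that the
register `y` has on entry). -/
inductive Prog where
  | skip
  | zero (x : ℕ)
  | copy (x y : ℕ)
  | succ (x : ℕ)
  | pred (x : ℕ)
  | store (a x y : ℕ) (e : BitExp)
  | seq (c d : Prog)
  | ite (e : BitExp) (c d : Prog)
  | loop (x y : ℕ) (c : Prog)

/-- Change one register. -/
def Store.setReg (σ : Store) (x v : ℕ) : Store where
  reg := Function.update σ.reg x v
  bit := σ.bit

/-- Change one bit. -/
def Store.setBit (σ : Store) (a i j : ℕ) (b : Bool) : Store where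
  reg := σ.reg
  bit := fun a' i' j' => if a' = a ∧ i' = i ∧ j' = j then b else σ.bit a' i' j'

/-- `k` rounds of a loop with counter `x` and body `f`. -/
def rounds (f : Store → Store) (x : ℕ) (σ : Store) : ℕ → Store
  | 0 => σ
  | k + 1 => f ((rounds f x σ k).setReg x k)

/-- The store after a run of the program. -/
def Prog.run : Prog → Store → Store
  | skip, σ => σ
  | zero x, σ => σ.setReg x 0
  | copy x y, σ => σ.setReg x (σ.reg y)
  | succ x, σ => σ.setReg x (σ.reg x + 1)
  | pred x, σ => σ.setReg x (σ.reg x - 1)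
  | store a x y e, σ => σ.setBit a (σ.reg x) (σ.reg y) (e.eval σ)
  | seq c d, σ => d.run (c.run σ)
  | ite e c d, σ => if e.eval σ then c.run σ else d.run σ
  | loop x y c, σ => rounds c.run x σ (σ.reg y)

/-- The number of steps of a run of the program. -/
def Prog.time : Prog → Store → ℕ
  | skip, _ => 1
  | zero _, _ => 1
  | copy _ _, _ => 1
  | succ _, _ => 1
  | pred _, _ => 1
  | store _ _ _ e, _ => e.size + 1
  | seq c d, σ => c.time σ + d.time (c.run σ)
  | ite e c d, σ => e.size + 1 + (if e.eval σ then c.time σ else d.time σ)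
  | loop x y c, σ =>
      1 + ∑ k ∈ Finset.range (σ.reg y), (1 + c.time ((rounds c.run x σ k).setReg x k))

/-- The initial store for input `n, i`: register `0` holds `n`, row `0` of array `0` holds the
binary digits of `i` (least significant first), everything else is zero. -/
def indexInput (n i : ℕ) : Store where
  reg := fun x => if x = 0 then n else 0
  bit := fun a x y => decide (a = 0 ∧ x = 0) && i.testBit y

/-- Row `0` of array `0` holds exactly the binary digits of `i`. -/
def HoldsIndex (σ : Store) (i : ℕ) : Prop := ∀ y, σ.bit 0 0 y = i.testBit y

open scoped Classical in
/-- The initial store for input `n, r, s, S`: register `0` holds `n`, rows `0` and `1` of array `1`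
hold `r` and `s`, array `2` holds `S`, everything else is zero. -/
def paramInput {n : ℕ} (r s : Fin n → ZMod 2) (S : Sp n) : Store where
  reg := fun x => if x = 0 then n else 0
  bit := fun a x y => decide (
    (a = 1 ∧ x = 0 ∧ ∃ j : Fin n, j.val = y ∧ r j = 1) ∨
    (a = 1 ∧ x = 1 ∧ ∃ j : Fin n, j.val = y ∧ s j = 1) ∨
    (a = 2 ∧ ∃ p q, pos p = x ∧ pos q = y ∧ S.1 p q = 1))

/-- Rows `0` and `1` of array `1` hold `r` and `s`, and array `2` holds `S`. -/
def HoldsParams {n : ℕ} (σ : Store) (r s : Fin n → ZMod 2) (S : Sp n) : Prop :=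
  (∀ j : Fin n, toF2 (σ.bit 1 0 j) = r j ∧ toF2 (σ.bit 1 1 j) = s j) ∧
  ∀ p q, toF2 (σ.bit 2 (pos p) (pos q)) = S.1 p q

/-- Register `1` holds the length of the list `hs`, and the rows of array `3` hold its entries. -/
def HoldsVectors {n : ℕ} (σ : Store) (hs : List (Vec n)) : Prop :=
  σ.reg 1 = hs.length ∧
  ∀ (k : Fin hs.length) (p : Fin n ⊕ Fin n), toF2 (σ.bit 3 k (pos p)) = hs.get k p

end Clif

end

open Clif

open scoped Matrix

noncomputable section

namespace Clif

/-! ### Tensor products of one-qubit matrices -/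

/-! Structure of the Clifford group. The Hermitian operators `W(v)` (`pauliOp`) multiply like the
vectors `v`, up to a power of `i`, and two of them commute up to the sign `(-1)^⟨v,w⟩`
(`pauliOp_mul`, `pauliOp_comm`). A unitary that normalizes the Pauli group therefore induces a
linear map preserving the symplectic form, and Hermiticity reduces the remaining phases to signs;
this gives the parameters `(r, s, S)` (`exists_actsAs`). They determine the unitary up to phase,
because a matrix commuting with all `Xⱼ` and `Zⱼ` is scalar (`exists_scalar_of_commute`). Every
triple occurs: `(1 ± iW(h))/√2` realizes the transvection along `h` (`transvectionU_conjActs`),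
transvections generate the symplectic group (`exists_transvection_prod`), and a Pauli factor changes
the signs at will without touching `S`. Projecting to `S` is a homomorphism whose kernel is the
Pauli group.

Enumeration of the symplectic group. Let `e, e'` be the first hyperbolic pair in dimension `2m`. A
symplectic matrix is determined by the images of `e` and `e'` together with an element of the next
smaller group. The image `f` of `e` is any of the `4^m - 1` nonzero vectors, and the image of `e'`
is any of the `2^(2m-1)` vectors pairing to `1` with `f`. Four transvections realize the choice: two
carry `e` to `f` through an auxiliary vector `g` (`level_upper_unitX`), and the two applied before
them fix `e` and send `e'` to `e' + (1+t)e + b` with `t` and `b` free (`level_lower_unitX`,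
`level_lower_unitZ`). Induction on `n` shows that the resulting products list the group exactly once
(`spElem_bijOn`), which also gives its order and its generation by transvections.

Arithmetic on indices. Write an index as `x = (4^m - 1) y + r` and recode it as `z = 4^m y + r + 1`
(`levelNum`). The low `2m` bits of `z` are the first column, the next `2m - 1` bits encode the
second one, and the bits after these are already `x / levelSize m`, the index for the next level.
Moreover `z = x + y + 1`, where `y` is `z` shifted by `2m` (`levelNum_eq`, `levelNum_div`). Hence
`x` follows from `z` by one pass with a carry bit, and so does `z` from `x` once `r + 1` is known.
The latter is found by adding the bits of `x` cyclically in `2m` cells, since `2^(2m) ≡ 1` modulo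
`4^m - 1`. No long multiplication or division occurs, and a level costs `O(n²)` steps.

Programs. Multiplying a stored matrix by a transvection is a rank-one update, hence `O(n²)` steps,
and there are `4n` of them. In the reverse direction the transvections, being involutions, are
peeled off from the left: the first column reveals the first two vectors of a level, and after their
removal the second column reveals the other two. The index is then rebuilt from the last level to
the first. Both programs stay within `O(n³)`. -/

theorem tensor_mul {n : ℕ} (A B : Fin n → Matrix (Fin 2) (Fin 2) ℂ) :
    tensor A * tensor B = tensor (fun k => A k * B k) := by
  ext x y
  simp only [tensor, Matrix.mul_apply, Matrix.of_apply]
  rw [Finset.prod_univ_sum, Fintype.piFinset_univ]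
  exact Finset.sum_congr rfl fun z _ => Finset.prod_mul_distrib.symm

theorem tensor_smul {n : ℕ} (c : Fin n → ℂ) (A : Fin n → Matrix (Fin 2) (Fin 2) ℂ) :
    tensor (fun k => c k • A k) = (∏ k, c k) • tensor A := by
  ext x y
  simp [tensor, Finset.prod_mul_distrib]

theorem tensor_one {n : ℕ} : tensor (fun _ : Fin n => 1) = 1 := by
  ext x y
  simp only [tensor, Matrix.of_apply, Matrix.one_apply]
  rw [Finset.prod_ite_zero]
  simp [funext_iff]

theorem tensor_conjTranspose {n : ℕ} (A : Fin n → Matrix (Fin 2) (Fin 2) ℂ) :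
    (tensor A)ᴴ = tensor (fun k => (A k)ᴴ) := by
  ext x y
  simp [tensor, Matrix.conjTranspose_apply]

/-! ### One-qubit Pauli operators -/

/-- The one-qubit Hermitian Pauli operator `i^(ab) X^a Z^b`. -/
def pauliOne (a b : ZMod 2) : Matrix (Fin 2) (Fin 2) ℂ :=
  Complex.I ^ (a.val * b.val) • (sigmaX ^ a.val * sigmaZ ^ b.val)

/-- The character `a ↦ (-1)^a` of `𝔽₂`. -/
def sgn (a : ZMod 2) : ℂ := (-1) ^ a.val

theorem zmod_two_cases (a : ZMod 2) : a = 0 ∨ a = 1 := by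
  revert a; decide

@[simp] theorem sgn_zero : sgn 0 = 1 := by simp [sgn]

@[simp] theorem sgn_one : sgn 1 = -1 := by simp [sgn, ZMod.val_one]

theorem sgn_add (a b : ZMod 2) : sgn (a + b) = sgn a * sgn b := by
  rcases zmod_two_cases a with rfl | rfl <;> rcases zmod_two_cases b with rfl | rfl <;>
    simp [show (1 + 1 : ZMod 2) = 0 from rfl]

theorem sgn_injective : Function.Injective sgn := by
  intro a b h
  rcases zmod_two_cases a with rfl | rfl <;> rcases zmod_two_cases b with rfl | rfl <;>
    first | rfl | norm_num at h

theorem sgn_sum {ι : Type*} (s : Finset ι) (f : ι → ZMod 2) :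
    sgn (∑ i ∈ s, f i) = ∏ i ∈ s, sgn (f i) := by
  classical
  induction s using Finset.induction_on with
  | empty => simp
  | insert a s ha ih => rw [Finset.sum_insert ha, Finset.prod_insert ha, sgn_add, ih]

theorem sgn_eq_I_pow (a : ZMod 2) : sgn a = Complex.I ^ (2 * a.val) := by
  rw [pow_mul, Complex.I_sq, sgn]

theorem sgn_mul_self (a : ZMod 2) : sgn a * sgn a = 1 := by
  rw [← sgn_add, CharTwo.add_self_eq_zero, sgn_zero]

theorem sgn_ne_zero (a : ZMod 2) : sgn a ≠ 0 := fun h => by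
  simpa [h] using sgn_mul_self a

@[simp] theorem pauliOne_zero_zero : pauliOne 0 0 = 1 := by simp [pauliOne]

theorem pauliOne_one_zero : pauliOne 1 0 = sigmaX := by simp [pauliOne, ZMod.val_one]

theorem pauliOne_zero_one : pauliOne 0 1 = sigmaZ := by simp [pauliOne, ZMod.val_one]

theorem pauliOne_one_one : pauliOne 1 1 = sigmaY := by
  ext i j
  fin_cases i <;> fin_cases j <;>
    simp [pauliOne, sigmaX, sigmaY, sigmaZ, ZMod.val_one]

theorem pauliOne_conjTranspose (a b : ZMod 2) : (pauliOne a b)ᴴ = pauliOne a b := by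
  rcases zmod_two_cases a with rfl | rfl <;> rcases zmod_two_cases b with rfl | rfl <;>
    simp only [pauliOne_zero_zero, pauliOne_one_zero, pauliOne_zero_one, pauliOne_one_one,
      Matrix.conjTranspose_one] <;>
    ext i j <;> fin_cases i <;> fin_cases j <;>
    simp [sigmaX, sigmaY, sigmaZ, Matrix.conjTranspose_apply]

theorem pauliOne_mul_self (a b : ZMod 2) : pauliOne a b * pauliOne a b = 1 := by
  rcases zmod_two_cases a with rfl | rfl <;> rcases zmod_two_cases b with rfl | rfl <;>
    simp only [pauliOne_zero_zero, pauliOne_one_zero, pauliOne_zero_one, pauliOne_one_one,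
      Matrix.mul_one] <;>
    ext i j <;> fin_cases i <;> fin_cases j <;>
    simp [sigmaX, sigmaY, sigmaZ, Matrix.mul_apply, Fin.sum_univ_two]

theorem pauliOne_mul (a b c d : ZMod 2) :
    ∃ k : ℕ, pauliOne a b * pauliOne c d = Complex.I ^ k • pauliOne (a + c) (b + d) := by
  have hX : sigmaX * sigmaX = 1 := by
    simpa [pauliOne_one_zero] using pauliOne_mul_self 1 0
  have hZ : sigmaZ * sigmaZ = 1 := by
    simpa [pauliOne_zero_one] using pauliOne_mul_self 0 1
  have hY : sigmaY * sigmaY = 1 := by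
    simpa [pauliOne_one_one] using pauliOne_mul_self 1 1
  have h2 : (1 + 1 : ZMod 2) = 0 := rfl
  rcases zmod_two_cases a with rfl | rfl <;> rcases zmod_two_cases b with rfl | rfl <;>
    rcases zmod_two_cases c with rfl | rfl <;> rcases zmod_two_cases d with rfl | rfl <;>
    simp only [pauliOne_zero_zero, pauliOne_one_zero, pauliOne_zero_one, pauliOne_one_one,
      Matrix.mul_one, Matrix.one_mul, add_zero, zero_add, h2, hX, hY, hZ] <;>
    -- The product of two distinct nontrivial Hermitian Pauli matrices is `±i` times the third one,
    -- so the exponents `0`, `1` and `3` suffice.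
    first
    | (refine ⟨0, ?_⟩; rw [pow_zero, one_smul]; done)
    | (refine ⟨1, ?_⟩
       ext i j
       fin_cases i <;> fin_cases j <;>
         simp [sigmaX, sigmaY, sigmaZ, Matrix.mul_apply, Fin.sum_univ_two]; done)
    | (refine ⟨3, ?_⟩
       ext i j
       fin_cases i <;> fin_cases j <;>
         simp [sigmaX, sigmaY, sigmaZ, Matrix.mul_apply, Fin.sum_univ_two, Complex.I_pow_three])

theorem pauliOne_comm (a b c d : ZMod 2) :
    pauliOne a b * pauliOne c d = sgn (a * d + b * c) • (pauliOne c d * pauliOne a b) := by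
  have h2 : (1 + 1 : ZMod 2) = 0 := rfl
  rcases zmod_two_cases a with rfl | rfl <;> rcases zmod_two_cases b with rfl | rfl <;>
    rcases zmod_two_cases c with rfl | rfl <;> rcases zmod_two_cases d with rfl | rfl <;>
    simp only [pauliOne_zero_zero, pauliOne_one_zero, pauliOne_zero_one, pauliOne_one_one,
      Matrix.one_mul, add_zero, zero_add, h2, mul_zero, mul_one,
      sgn_zero, sgn_one, one_smul] <;>
    ext i j <;> fin_cases i <;> fin_cases j <;>
    simp [sigmaX, sigmaY, sigmaZ, Matrix.mul_apply, Fin.sum_univ_two]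

/-! ### Pauli operators on `n` qubits -/

/-- The symplectic form `⟨v, w⟩ = vᵀ J w`. -/
def symp {n : ℕ} (v w : Vec n) : ZMod 2 := v ⬝ᵥ Matrix.J (Fin n) (ZMod 2) *ᵥ w

/-- The sign in `J` disappears in characteristic two; `J` merely exchanges the two coordinates of
each pair. -/
theorem J_mulVec_inl {n : ℕ} (w : Vec n) (k : Fin n) :
    (Matrix.J (Fin n) (ZMod 2) *ᵥ w) (Sum.inl k) = w (Sum.inr k) := by
  simp [Matrix.J, Matrix.fromBlocks_mulVec, Matrix.neg_mulVec]

theorem J_mulVec_inr {n : ℕ} (w : Vec n) (k : Fin n) :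
    (Matrix.J (Fin n) (ZMod 2) *ᵥ w) (Sum.inr k) = w (Sum.inl k) := by
  simp [Matrix.J, Matrix.fromBlocks_mulVec]

theorem symp_eq {n : ℕ} (v w : Vec n) :
    symp v w = ∑ k, (v (Sum.inl k) * w (Sum.inr k) + v (Sum.inr k) * w (Sum.inl k)) := by
  simp only [symp, dotProduct, Fintype.sum_sum_type, J_mulVec_inl, J_mulVec_inr,
    Finset.sum_add_distrib]

theorem symp_comm {n : ℕ} (v w : Vec n) : symp v w = symp w v := by
  rw [symp_eq, symp_eq]
  exact Finset.sum_congr rfl fun k _ => by ring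

@[simp] theorem symp_self {n : ℕ} (v : Vec n) : symp v v = 0 := by
  rw [symp_eq]
  refine Finset.sum_eq_zero fun k _ => ?_
  rw [mul_comm, CharTwo.add_self_eq_zero]

theorem symp_add_left {n : ℕ} (u v w : Vec n) : symp (u + v) w = symp u w + symp v w := by
  simp [symp, add_dotProduct]

theorem symp_add_right {n : ℕ} (u v w : Vec n) : symp u (v + w) = symp u v + symp u w := by
  rw [symp_comm, symp_add_left, symp_comm v, symp_comm w]

theorem symp_smul_left {n : ℕ} (a : ZMod 2) (v w : Vec n) : symp (a • v) w = a * symp v w := by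
  simp [symp, smul_dotProduct]

theorem symp_smul_right {n : ℕ} (a : ZMod 2) (v w : Vec n) : symp v (a • w) = a * symp v w := by
  rw [symp_comm, symp_smul_left, symp_comm]

theorem symp_single_inl {n : ℕ} (v : Vec n) (j : Fin n) :
    symp v (Pi.single (Sum.inl j) 1) = v (Sum.inr j) := by
  rw [symp_eq, Finset.sum_eq_single j]
  · simp
  · intro k _ hk
    simp [hk]
  · simp

theorem symp_single_inr {n : ℕ} (v : Vec n) (j : Fin n) :
    symp v (Pi.single (Sum.inr j) 1) = v (Sum.inl j) := by
  rw [symp_eq, Finset.sum_eq_single j]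
  · simp
  · intro k _ hk
    simp [hk]
  · simp

theorem pauliOp_eq {n : ℕ} (v : Vec n) :
    pauliOp v = tensor fun k => pauliOne (v (Sum.inl k)) (v (Sum.inr k)) := rfl

@[simp] theorem pauliOp_zero {n : ℕ} : pauliOp (0 : Vec n) = 1 := by
  simp [pauliOp_eq, tensor_one]

theorem pauliOp_conjTranspose {n : ℕ} (v : Vec n) : (pauliOp v)ᴴ = pauliOp v := by
  simp [pauliOp_eq, tensor_conjTranspose, pauliOne_conjTranspose]

theorem pauliOp_mul_self {n : ℕ} (v : Vec n) : pauliOp v * pauliOp v = 1 := by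
  simp [pauliOp_eq, tensor_mul, pauliOne_mul_self, tensor_one]

theorem pauliOp_mul {n : ℕ} (v w : Vec n) :
    ∃ k : ℕ, pauliOp v * pauliOp w = Complex.I ^ k • pauliOp (v + w) := by
  choose e he using fun k : Fin n =>
    pauliOne_mul (v (Sum.inl k)) (v (Sum.inr k)) (w (Sum.inl k)) (w (Sum.inr k))
  refine ⟨∑ k, e k, ?_⟩
  rw [pauliOp_eq, pauliOp_eq, tensor_mul, funext he, tensor_smul, Finset.prod_pow_eq_pow_sum]
  rfl

/-- The signs of the individual qubits multiply, and `sgn` turns the sum defining the form into that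
product. Commutation relations thus carry the whole symplectic geometry. -/
theorem pauliOp_comm {n : ℕ} (v w : Vec n) :
    pauliOp v * pauliOp w = sgn (symp v w) • (pauliOp w * pauliOp v) := by
  simp only [pauliOp_eq, tensor_mul]
  rw [funext fun k => pauliOne_comm (v (Sum.inl k)) (v (Sum.inr k)) (w (Sum.inl k))
    (w (Sum.inr k)), tensor_smul, ← sgn_sum, ← symp_eq]

theorem onQubit_sigmaX {n : ℕ} (j : Fin n) :
    onQubit j sigmaX = pauliOp (Pi.single (Sum.inl j) 1) := by
  rw [pauliOp_eq, onQubit]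
  congr 1
  funext k
  by_cases h : k = j
  · subst h; simp [pauliOne_one_zero]
  · simp [h]

theorem onQubit_sigmaZ {n : ℕ} (j : Fin n) :
    onQubit j sigmaZ = pauliOp (Pi.single (Sum.inr j) 1) := by
  rw [pauliOp_eq, onQubit]
  congr 1
  funext k
  by_cases h : k = j
  · subst h; simp [pauliOne_zero_one]
  · simp [h]

theorem onQubit_sigmaY {n : ℕ} (j : Fin n) :
    onQubit j sigmaY = pauliOp (Pi.single (Sum.inl j) 1 + Pi.single (Sum.inr j) 1) := by
  rw [pauliOp_eq, onQubit]
  congr 1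
  funext k
  by_cases h : k = j
  · subst h; simp [pauliOne_one_one]
  · simp [h]

/-! ### Elements of the Pauli group -/

theorem pauliOp_ne_zero {n : ℕ} (v : Vec n) : pauliOp v ≠ 0 := fun h => by
  have := pauliOp_mul_self v
  rw [h, Matrix.mul_zero] at this
  exact zero_ne_one this

theorem star_I_pow (k : ℕ) : star (Complex.I ^ k) = Complex.I ^ (3 * k) := by
  rw [star_pow, pow_mul, Complex.I_pow_three]
  simp

/-- The Pauli operator `pauliOp v` as a unitary. -/
def pauliU {n : ℕ} (v : Vec n) : QubitUnitary n :=
  ⟨pauliOp v, by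
    rw [Matrix.mem_unitaryGroup_iff, Matrix.star_eq_conjTranspose, pauliOp_conjTranspose,
      pauliOp_mul_self]⟩

theorem exists_of_mem_pauliGroup {n : ℕ} {U : QubitUnitary n} (hU : U ∈ pauliGroup n) :
    ∃ (k : ℕ) (v : Vec n), U.1 = Complex.I ^ k • pauliOp v := by
  refine Subgroup.closure_induction (p := fun U _ => ∃ (k : ℕ) (v : Vec n),
    U.1 = Complex.I ^ k • pauliOp v) ?_ ?_ ?_ ?_ hU
  · rintro U ⟨j, h | h | h⟩
    · exact ⟨0, _, by rw [h, onQubit_sigmaX, pow_zero, one_smul]⟩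
    · exact ⟨0, _, by rw [h, onQubit_sigmaY, pow_zero, one_smul]⟩
    · exact ⟨0, _, by rw [h, onQubit_sigmaZ, pow_zero, one_smul]⟩
  · exact ⟨0, 0, by simp⟩
  · rintro U V - - ⟨k, v, hv⟩ ⟨l, w, hw⟩
    obtain ⟨e, he⟩ := pauliOp_mul v w
    refine ⟨k + l + e, v + w, ?_⟩
    rw [Matrix.UnitaryGroup.mul_val, hv, hw, Matrix.smul_mul, Matrix.mul_smul, he, smul_smul,
      smul_smul, pow_add, pow_add, mul_assoc]
  · rintro U - ⟨k, v, hv⟩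
    refine ⟨3 * k, v, ?_⟩
    rw [Matrix.UnitaryGroup.inv_val, Matrix.star_eq_conjTranspose, hv,
      Matrix.conjTranspose_smul, pauliOp_conjTranspose, star_I_pow]

/-- The scalar `iᵏ` as a unitary. -/
def phaseU {n : ℕ} (k : ℕ) : QubitUnitary n :=
  ⟨Complex.I ^ k • 1, by
    rw [Matrix.mem_unitaryGroup_iff, Matrix.star_eq_conjTranspose, Matrix.conjTranspose_smul,
      star_I_pow, Matrix.conjTranspose_one, Matrix.smul_mul, Matrix.one_mul, smul_smul,
      ← pow_add, show k + 3 * k = 4 * k by ring, pow_mul, Complex.I_pow_four, one_pow, one_smul]⟩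

theorem pauliU_single_mem {n : ℕ} (p : Fin n ⊕ Fin n) :
    pauliU (Pi.single p 1) ∈ pauliGroup n := by
  rcases p with j | j
  · exact Subgroup.subset_closure ⟨j, Or.inl (onQubit_sigmaX j).symm⟩
  · exact Subgroup.subset_closure ⟨j, Or.inr (Or.inr (onQubit_sigmaZ j).symm)⟩

/-- On one qubit `X Y Z = i`. A qubit `j` has to exist: for `n = 0` the Pauli group is trivial and
does not contain `i`. -/
theorem phaseU_one_mem {n : ℕ} (j : Fin n) : phaseU 1 ∈ pauliGroup n := by
  have hX : pauliU (Pi.single (Sum.inl j) 1) ∈ pauliGroup n := pauliU_single_mem _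
  have hZ : pauliU (Pi.single (Sum.inr j) 1) ∈ pauliGroup n := pauliU_single_mem _
  have hY : pauliU (Pi.single (Sum.inl j) 1 + Pi.single (Sum.inr j) 1) ∈ pauliGroup n :=
    Subgroup.subset_closure ⟨j, Or.inr (Or.inl (onQubit_sigmaY j).symm)⟩
  convert mul_mem (mul_mem hX hY) hZ using 1
  have h1 : (sigmaX * sigmaY * sigmaZ) = Complex.I • (1 : Matrix (Fin 2) (Fin 2) ℂ) := by
    ext i k
    fin_cases i <;> fin_cases k <;>
      simp [sigmaX, sigmaY, sigmaZ, Matrix.mul_apply, Fin.sum_univ_two]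
  apply Subtype.ext
  simp only [phaseU, pauliU, pow_one, Matrix.UnitaryGroup.mul_val]
  rw [← onQubit_sigmaX, ← onQubit_sigmaY, ← onQubit_sigmaZ, onQubit, onQubit, onQubit,
    tensor_mul, tensor_mul]
  have h2 : (fun k => (Pi.mulSingle j sigmaX : Fin n → Matrix (Fin 2) (Fin 2) ℂ) k *
      (Pi.mulSingle j sigmaY : Fin n → Matrix (Fin 2) (Fin 2) ℂ) k *
      (Pi.mulSingle j sigmaZ : Fin n → Matrix (Fin 2) (Fin 2) ℂ) k) =
      fun k => (Pi.mulSingle j Complex.I : Fin n → ℂ) k • (1 : Matrix (Fin 2) (Fin 2) ℂ) := by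
    funext k
    by_cases h : k = j
    · subst h; simp [h1]
    · simp [h]
  rw [h2, tensor_smul, Finset.prod_pi_mulSingle', tensor_one]
  simp

theorem phaseU_mem {n : ℕ} (j : Fin n) (k : ℕ) : phaseU k ∈ pauliGroup n := by
  convert pow_mem (phaseU_one_mem j) k using 1
  apply Subtype.ext
  rw [SubmonoidClass.coe_pow]
  simp [phaseU, smul_pow]

/-- The operator is built from the generators one coordinate at a time, and the phases collected on
the way are left unspecified. In this form the result also holds for `n = 0`. -/
theorem exists_phaseU_mul_pauliU_mem {n : ℕ} (v : Vec n) :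
    ∃ k : ℕ, phaseU k * pauliU v ∈ pauliGroup n := by
  classical
  have key : ∀ s : Finset (Fin n ⊕ Fin n), ∃ k : ℕ,
      phaseU k * pauliU (∑ p ∈ s, Pi.single p (v p)) ∈ pauliGroup n := by
    intro s
    induction s using Finset.induction_on with
    | empty =>
      refine ⟨0, ?_⟩
      convert one_mem (pauliGroup n)
      apply Subtype.ext
      simp [phaseU, pauliU]
    | insert p s hp ih =>
      obtain ⟨k, hk⟩ := ih
      rw [Finset.sum_insert hp]
      rcases zmod_two_cases (v p) with h | h
      · exact ⟨k, by rwa [h, Pi.single_zero, zero_add]⟩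
      · rw [h]
        obtain ⟨e, he⟩ := pauliOp_mul (Pi.single p 1) (∑ p ∈ s, Pi.single p (v p))
        refine ⟨k + e, ?_⟩
        convert mul_mem (pauliU_single_mem p) hk using 1
        apply Subtype.ext
        simp only [phaseU, pauliU, Matrix.UnitaryGroup.mul_val, Matrix.smul_mul, Matrix.one_mul,
          Matrix.mul_smul, he, smul_smul, pow_add]
  obtain ⟨k, hk⟩ := key Finset.univ
  rw [Finset.univ_sum_single v] at hk
  exact ⟨k, hk⟩

/-- With at least one qubit all powers of `i` are available. The factor `i^(k + 3e)` corrects the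
accidental phase `i^e`, because `i^(4e) = 1`. -/
theorem mem_pauliGroup_of_eq {n : ℕ} (j : Fin n) {U : QubitUnitary n} {k : ℕ} {v : Vec n}
    (h : U.1 = Complex.I ^ k • pauliOp v) : U ∈ pauliGroup n := by
  obtain ⟨e, he⟩ := exists_phaseU_mul_pauliU_mem v
  convert mul_mem (phaseU_mem j (k + 3 * e)) he using 1
  apply Subtype.ext
  simp only [phaseU, pauliU, Matrix.UnitaryGroup.mul_val, Matrix.smul_mul, Matrix.one_mul,
    smul_smul, h, ← pow_add]
  rw [show k + 3 * e + e = k + 4 * e by ring, pow_add, pow_mul, Complex.I_pow_four, one_pow,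
    mul_one]

/-! ### Conjugation of Pauli operators by Clifford unitaries -/

theorem mul_conjTranspose {n : ℕ} (U : QubitUnitary n) : U.1 * U.1ᴴ = 1 :=
  Matrix.mem_unitaryGroup_iff.1 U.2

theorem conjTranspose_mul {n : ℕ} (U : QubitUnitary n) : U.1ᴴ * U.1 = 1 :=
  Matrix.mem_unitaryGroup_iff'.1 U.2

theorem conj_mul {n : ℕ} (U : QubitUnitary n) (A B : Matrix (Fin n → Fin 2) (Fin n → Fin 2) ℂ) :
    U.1 * (A * B) * U.1ᴴ = (U.1 * A * U.1ᴴ) * (U.1 * B * U.1ᴴ) := by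
  have h : U.1 * A * U.1ᴴ * (U.1 * B * U.1ᴴ) = U.1 * A * (U.1ᴴ * U.1) * B * U.1ᴴ := by
    simp only [Matrix.mul_assoc]
  rw [h, conjTranspose_mul, Matrix.mul_one]
  simp only [Matrix.mul_assoc]

/-- Conjugation by `U` acts on Pauli operators, up to phases, through the matrix `M`. -/
def ConjActs {n : ℕ} (U : QubitUnitary n) (M : Matrix (Fin n ⊕ Fin n) (Fin n ⊕ Fin n) (ZMod 2)) :
    Prop :=
  ∀ v : Vec n, ∃ k : ℕ, U.1 * pauliOp v * U.1ᴴ = Complex.I ^ k • pauliOp (M *ᵥ v)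

theorem ConjActs.one {n : ℕ} : ConjActs (1 : QubitUnitary n) 1 := fun v => ⟨0, by simp⟩

theorem ConjActs.mul {n : ℕ} {U V : QubitUnitary n}
    {M N : Matrix (Fin n ⊕ Fin n) (Fin n ⊕ Fin n) (ZMod 2)} (hU : ConjActs U M)
    (hV : ConjActs V N) : ConjActs (U * V) (M * N) := by
  intro v
  obtain ⟨k, hk⟩ := hV v
  obtain ⟨l, hl⟩ := hU (N *ᵥ v)
  refine ⟨k + l, ?_⟩
  have h : (U * V).1 * pauliOp v * (U * V).1ᴴ = U.1 * (V.1 * pauliOp v * V.1ᴴ) * U.1ᴴ := by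
    rw [Matrix.UnitaryGroup.mul_val, Matrix.conjTranspose_mul]
    simp only [Matrix.mul_assoc]
  rw [h, hk, Matrix.mul_smul, Matrix.smul_mul, hl, smul_smul, Matrix.mulVec_mulVec, pow_add]

/-- Conjugation is multiplicative and `W` turns sums into products up to powers of `i`, so the
action on the coordinate vectors propagates to all vectors. -/
theorem ConjActs.of_generators {n : ℕ} {U : QubitUnitary n}
    {M : Matrix (Fin n ⊕ Fin n) (Fin n ⊕ Fin n) (ZMod 2)}
    (h : ∀ p, ∃ k : ℕ,
      U.1 * pauliOp (Pi.single p 1) * U.1ᴴ = Complex.I ^ k • pauliOp (fun q => M q p)) :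
    ConjActs U M := by
  classical
  intro v
  have key : ∀ s : Finset (Fin n ⊕ Fin n), ∃ k : ℕ,
      U.1 * pauliOp (∑ p ∈ s, Pi.single p (v p)) * U.1ᴴ =
        Complex.I ^ k • pauliOp (M *ᵥ ∑ p ∈ s, Pi.single p (v p)) := by
    intro s
    induction s using Finset.induction_on with
    | empty => exact ⟨0, by simp [mul_conjTranspose]⟩
    | insert p s hp ih =>
      obtain ⟨k, hk⟩ := ih
      rw [Finset.sum_insert hp]
      rcases zmod_two_cases (v p) with hv | hv
      · exact ⟨k, by rwa [hv, Pi.single_zero, zero_add]⟩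
      · rw [hv]
        obtain ⟨a, ha⟩ := pauliOp_mul (Pi.single p 1) (∑ p ∈ s, Pi.single p (v p))
        obtain ⟨l, hl⟩ := h p
        obtain ⟨b, hb⟩ := pauliOp_mul (M *ᵥ Pi.single p 1) (M *ᵥ ∑ p ∈ s, Pi.single p (v p))
        -- The exponent `3 * a` inverts the phase `i^a` that arises when the new generator is split
        -- off.
        refine ⟨3 * a + l + k + b, ?_⟩
        have h4 : Complex.I ^ (3 * a) * Complex.I ^ a = 1 := by
          rw [← pow_add, show 3 * a + a = 4 * a by ring, pow_mul, Complex.I_pow_four, one_pow]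
        have ha' : pauliOp (Pi.single p 1 + ∑ p ∈ s, Pi.single p (v p)) =
            Complex.I ^ (3 * a) •
              (pauliOp (Pi.single p 1) * pauliOp (∑ p ∈ s, Pi.single p (v p))) := by
          rw [ha, smul_smul, h4, one_smul]
        have hc : (fun q => M q p) = M *ᵥ Pi.single p 1 := by
          ext q; simp
        rw [ha', Matrix.mul_smul, Matrix.smul_mul, conj_mul, hl, hk, hc, Matrix.smul_mul,
          Matrix.mul_smul, hb, ← Matrix.mulVec_add]
        simp only [smul_smul, pow_add, mul_assoc]
  obtain ⟨k, hk⟩ := key Finset.univ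
  rw [Finset.univ_sum_single v] at hk
  exact ⟨k, hk⟩

theorem actsAs_iff {n : ℕ} {U : QubitUnitary n} {r s : Fin n → ZMod 2} {S : Sp n} :
    ActsAs U r s S ↔ ∀ p, U.1 * pauliOp (Pi.single p 1) * U.1ᴴ =
      sgn (Sum.elim r s p) • pauliOp (fun q => S.1 q p) := by
  simp only [ActsAs, onQubit_sigmaX, onQubit_sigmaZ, Sum.forall, Sum.elim_inl, Sum.elim_inr, sgn,
    forall_and]

theorem ActsAs.conjActs {n : ℕ} {U : QubitUnitary n} {r s : Fin n → ZMod 2} {S : Sp n}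
    (h : ActsAs U r s S) : ConjActs U S.1 :=
  ConjActs.of_generators fun p => ⟨_, by rw [actsAs_iff.1 h p, sgn_eq_I_pow]⟩

/-- The commutation signs of `W(v)` with all `W(u)` determine `⟨v, u⟩` for every `u`, and hence `v`,
since pairing with coordinate vectors reads off the coordinates. The scalars are compared
afterwards. -/
theorem smul_pauliOp_injective {n : ℕ} {a b : ℂ} {v w : Vec n} (ha : a ≠ 0)
    (h : a • pauliOp v = b • pauliOp w) : a = b ∧ v = w := by
  have hv : v = w := by
    have key : ∀ u : Vec n, symp v u = symp w u := by
      intro u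
      apply sgn_injective
      have h1 : a • pauliOp v * pauliOp u = b • pauliOp w * pauliOp u := by rw [h]
      rw [Matrix.smul_mul, Matrix.smul_mul, pauliOp_comm v, pauliOp_comm w, smul_comm a,
        smul_comm b, ← Matrix.mul_smul (pauliOp u) a, ← Matrix.mul_smul (pauliOp u) b, ← h,
        ← sub_eq_zero, ← sub_smul, smul_eq_zero] at h1
      rcases h1 with h1 | h1
      · exact sub_eq_zero.1 h1
      · exfalso
        have h2 := congrArg (pauliOp u * ·) h1
        simp only [← Matrix.mul_assoc, pauliOp_mul_self, Matrix.one_mul, Matrix.mul_zero] at h2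
        rcases smul_eq_zero.1 h2 with h3 | h3
        · exact ha h3
        · exact pauliOp_ne_zero v h3
    ext p
    rcases p with j | j
    · simpa [symp_single_inr] using key (Pi.single (Sum.inr j) 1)
    · simpa [symp_single_inl] using key (Pi.single (Sum.inl j) 1)
  subst hv
  exact ⟨smul_left_injective ℂ (pauliOp_ne_zero v) h, rfl⟩

theorem ActsAs.unique {n : ℕ} {U : QubitUnitary n} {r s r' s' : Fin n → ZMod 2} {S S' : Sp n}
    (h : ActsAs U r s S) (h' : ActsAs U r' s' S') : r = r' ∧ s = s' ∧ S = S' := by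
  have key := fun p => smul_pauliOp_injective (sgn_ne_zero _)
    ((actsAs_iff.1 h p).symm.trans (actsAs_iff.1 h' p))
  refine ⟨funext fun j => sgn_injective (key (Sum.inl j)).1,
    funext fun j => sgn_injective (key (Sum.inr j)).1, Subtype.ext ?_⟩
  ext q p
  exact congrFun (key p).2 q

theorem isHermitian_pauli {n : ℕ} (U : QubitUnitary n) (v : Vec n) :
    (U.1 * pauliOp v * U.1ᴴ)ᴴ = U.1 * pauliOp v * U.1ᴴ := by
  rw [Matrix.conjTranspose_mul, Matrix.conjTranspose_mul, Matrix.conjTranspose_conjTranspose,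
    pauliOp_conjTranspose, Matrix.mul_assoc]

/-- The phase of a Hermitian multiple `iᵏ W(v)` is a sign. -/
theorem exists_sgn_of_conj {n : ℕ} {U : QubitUnitary n} {v w : Vec n} {k : ℕ}
    (h : U.1 * pauliOp v * U.1ᴴ = Complex.I ^ k • pauliOp w) :
    ∃ a : ZMod 2, U.1 * pauliOp v * U.1ᴴ = sgn a • pauliOp w := by
  have h1 := isHermitian_pauli U v
  rw [h, Matrix.conjTranspose_smul, pauliOp_conjTranspose] at h1
  have h2 := smul_left_injective ℂ (pauliOp_ne_zero w) h1
  have h3 : Complex.I ^ k * Complex.I ^ k = 1 := by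
    nth_rewrite 1 [← h2]
    rw [star_I_pow, ← pow_add, show 3 * k + k = 4 * k by ring, pow_mul, Complex.I_pow_four,
      one_pow]
  rcases mul_self_eq_one_iff.1 h3 with h4 | h4
  · exact ⟨0, by rw [h, h4, sgn_zero]⟩
  · exact ⟨1, by rw [h, h4, sgn_one]⟩

theorem ConjActs.exists_actsAs {n : ℕ} {U : QubitUnitary n} {S : Sp n} (h : ConjActs U S.1) :
    ∃ r s, ActsAs U r s S := by
  have key : ∀ p, ∃ a : ZMod 2, U.1 * pauliOp (Pi.single p 1) * U.1ᴴ =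
      sgn a • pauliOp (fun q => S.1 q p) := by
    intro p
    obtain ⟨k, hk⟩ := h (Pi.single p 1)
    have hc : (fun q => S.1 q p) = S.1 *ᵥ Pi.single p 1 := by
      ext q; simp
    rw [hc]
    exact exists_sgn_of_conj hk
  choose a ha using key
  refine ⟨a ∘ Sum.inl, a ∘ Sum.inr, actsAs_iff.2 fun p => ?_⟩
  rw [ha, Sum.elim_comp_inl_inr]

theorem symp_single_eq_J {n : ℕ} (p q : Fin n ⊕ Fin n) :
    symp (Pi.single p 1) (Pi.single q 1) = Matrix.J (Fin n) (ZMod 2) p q := by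
  simp [symp]

theorem mem_symplectic_of_symp {n : ℕ} {M : Matrix (Fin n ⊕ Fin n) (Fin n ⊕ Fin n) (ZMod 2)}
    (h : ∀ p q, symp (M.col p) (M.col q) = Matrix.J (Fin n) (ZMod 2) p q) :
    M ∈ Matrix.symplecticGroup (Fin n) (ZMod 2) := by
  rw [← SymplecticGroup.transpose_mem_iff, SymplecticGroup.mem_iff, Matrix.transpose_transpose]
  ext p q
  rw [← h p q, symp, Matrix.mul_assoc]
  simp [Matrix.mul_apply, dotProduct, Matrix.mulVec]

/-- The normalizer sends each generator to a phase times some `W(v p)`. Conjugation preserves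
commutation signs, so the vectors `v p` pair like the coordinate vectors and form a symplectic
matrix. -/
theorem exists_actsAs {n : ℕ} (U : pauliNormalizer n) : ∃ r s S, ActsAs U.1 r s S := by
  have key : ∀ p, ∃ (k : ℕ) (v : Vec n), U.1.1 * pauliOp (Pi.single p 1) * U.1.1ᴴ =
      Complex.I ^ k • pauliOp v := by
    intro p
    have h := (Subgroup.mem_normalizer_iff.1 U.2 (pauliU (Pi.single p 1))).1 (pauliU_single_mem p)
    obtain ⟨k, v, hv⟩ := exists_of_mem_pauliGroup h
    exact ⟨k, v, hv⟩
  choose k v hv using key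
  let M : Matrix (Fin n ⊕ Fin n) (Fin n ⊕ Fin n) (ZMod 2) := Matrix.of fun q p => v p q
  have hM : M ∈ Matrix.symplecticGroup (Fin n) (ZMod 2) := by
    refine mem_symplectic_of_symp fun p q => ?_
    have hI : ∀ k : ℕ, Complex.I ^ k ≠ 0 := fun k => pow_ne_zero k Complex.I_ne_zero
    rw [← symp_single_eq_J]
    apply sgn_injective
    -- Conjugating the commutation relation of two generators yields the relation of their images
    -- with the same sign.
    have h1 := congrArg (fun A => U.1.1 * A * U.1.1ᴴ)
      (pauliOp_comm (Pi.single p 1 : Vec n) (Pi.single q 1))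
    simp only [Matrix.mul_smul, Matrix.smul_mul, conj_mul, hv] at h1
    rw [pauliOp_comm (v p), smul_smul, smul_smul, smul_smul, smul_smul] at h1
    obtain ⟨e, he⟩ := pauliOp_mul (v q) (v p)
    rw [he, smul_smul, smul_smul] at h1
    have h2 := smul_left_injective ℂ (pauliOp_ne_zero _) h1
    have h3 : Complex.I ^ k q * Complex.I ^ k p * Complex.I ^ e ≠ 0 :=
      mul_ne_zero (mul_ne_zero (hI _) (hI _)) (hI _)
    refine mul_right_cancel₀ h3 ?_
    change sgn (symp (v p) (v q)) * _ = _
    linear_combination h2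
  obtain ⟨r, s, h⟩ := ConjActs.exists_actsAs (U := U.1) (S := ⟨M, hM⟩)
    (ConjActs.of_generators fun p => ⟨k p, hv p⟩)
  exact ⟨r, s, _, h⟩

/-! ### Existence of Clifford unitaries -/

/-- Normalizing demands equality of the conjugated group, not just inclusion, which is why the
action of the inverse is also required. -/
theorem mem_pauliNormalizer_of_conjActs {n : ℕ} {U : QubitUnitary n}
    {M N : Matrix (Fin n ⊕ Fin n) (Fin n ⊕ Fin n) (ZMod 2)} (h : ConjActs U M)
    (h' : ConjActs U⁻¹ N) : U ∈ pauliNormalizer n := by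
  have key : ∀ (V : QubitUnitary n) (M : Matrix (Fin n ⊕ Fin n) (Fin n ⊕ Fin n) (ZMod 2)),
      ConjActs V M → ∀ P ∈ pauliGroup n, V * P * V⁻¹ ∈ pauliGroup n := by
    intro V M hV P hP
    -- Without qubits the powers of `i` need not belong to the Pauli group, but the group is trivial
    -- and nothing has to be shown about phases.
    rcases Nat.eq_zero_or_pos n with rfl | hn
    · have h0 : pauliGroup 0 = ⊥ := by
        rw [pauliGroup, Subgroup.closure_eq_bot_iff]
        rintro _ ⟨j, -⟩
        exact j.elim0
      rw [h0, Subgroup.mem_bot] at hP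
      rw [hP, mul_one, mul_inv_cancel]
      exact one_mem _
    · obtain ⟨k, v, hv⟩ := exists_of_mem_pauliGroup hP
      obtain ⟨l, hl⟩ := hV v
      refine mem_pauliGroup_of_eq ⟨0, hn⟩ (k := k + l) (v := M *ᵥ v) ?_
      change V.1 * P.1 * V.1ᴴ = _
      rw [hv, Matrix.mul_smul, Matrix.smul_mul, hl, smul_smul, pow_add]
  rw [Subgroup.mem_normalizer_iff]
  refine fun P => ⟨key U M h P, fun hP => ?_⟩
  have h1 := key _ _ h' _ hP
  rwa [show U⁻¹ * (U * P * U⁻¹) * U⁻¹⁻¹ = P by group] at h1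

theorem transvection_mulVec {n : ℕ} (h v : Vec n) :
    transvection h *ᵥ v = v + symp v h • h := by
  rw [transvection, Matrix.add_mulVec, Matrix.one_mulVec, Matrix.vecMulVec_mulVec,
    dotProduct_comm, op_smul_eq_smul]
  rfl

theorem inv_sqrt_two_mul_self : (Real.sqrt 2 : ℂ)⁻¹ * (Real.sqrt 2 : ℂ)⁻¹ = 2⁻¹ := by
  rw [← mul_inv, ← Complex.ofReal_mul, Real.mul_self_sqrt (by norm_num)]
  norm_num

theorem star_inv_sqrt_two : star ((Real.sqrt 2 : ℂ)⁻¹) = (Real.sqrt 2 : ℂ)⁻¹ := by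
  rw [star_inv₀]
  simp

/-- The anti-Hermitian operator `± i W(h)`. -/
def skewPauli {n : ℕ} (a : ZMod 2) (h : Vec n) : Matrix (Fin n → Fin 2) (Fin n → Fin 2) ℂ :=
  (sgn a * Complex.I) • pauliOp h

theorem skewPauli_mul_self {n : ℕ} (a : ZMod 2) (h : Vec n) :
    skewPauli a h * skewPauli a h = -1 := by
  have h5 : (sgn a * Complex.I) * (sgn a * Complex.I) = -1 := by
    linear_combination (sgn a * sgn a) * Complex.I_mul_I - sgn_mul_self a
  rw [skewPauli, Matrix.smul_mul, Matrix.mul_smul, pauliOp_mul_self, smul_smul, h5, neg_one_smul]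

theorem skewPauli_add_one {n : ℕ} (a : ZMod 2) (h : Vec n) :
    skewPauli (a + 1) h = -skewPauli a h := by
  rw [skewPauli, skewPauli, sgn_add, sgn_one, ← neg_smul]
  congr 1
  ring

theorem conjTranspose_skewPauli {n : ℕ} (a : ZMod 2) (h : Vec n) :
    (skewPauli a h)ᴴ = -skewPauli a h := by
  have h3 : star (sgn a * Complex.I) = -(sgn a * Complex.I) := by
    rcases zmod_two_cases a with rfl | rfl <;> simp
  rw [skewPauli, Matrix.conjTranspose_smul, pauliOp_conjTranspose, h3, neg_smul]

/-- The Clifford unitary `(1 ± i W(h)) / √2` of a transvection. -/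
def transvectionU {n : ℕ} (a : ZMod 2) (h : Vec n) : QubitUnitary n :=
  ⟨((Real.sqrt 2 : ℂ)⁻¹) • (1 + skewPauli a h), by
    have h1 : (1 + skewPauli a h) * (1 + -skewPauli a h) = (2 : ℂ) • 1 := by
      rw [add_mul, mul_add, mul_add, mul_neg, mul_neg, skewPauli_mul_self, two_smul, one_mul,
        one_mul, mul_one]
      abel
    rw [Matrix.mem_unitaryGroup_iff, Matrix.star_eq_conjTranspose, Matrix.conjTranspose_smul,
      star_inv_sqrt_two, Matrix.conjTranspose_add, Matrix.conjTranspose_one,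
      conjTranspose_skewPauli, Matrix.smul_mul, Matrix.mul_smul, h1, smul_smul, smul_smul,
      inv_sqrt_two_mul_self, inv_mul_cancel₀ two_ne_zero, one_smul]⟩

theorem conjTranspose_transvectionU {n : ℕ} (a : ZMod 2) (h : Vec n) :
    (transvectionU a h).1ᴴ = (transvectionU (a + 1) h).1 := by
  simp only [transvectionU, Matrix.conjTranspose_smul, Matrix.conjTranspose_add,
    Matrix.conjTranspose_one, conjTranspose_skewPauli, star_inv_sqrt_two, skewPauli_add_one]

theorem transvectionU_mul_self {n : ℕ} (a : ZMod 2) (h : Vec n) :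
    (transvectionU a h).1 * (transvectionU a h).1 = skewPauli a h := by
  have h1 : (1 + skewPauli a h) * (1 + skewPauli a h) = (2 : ℂ) • skewPauli a h := by
    rw [add_mul, mul_add, mul_add, skewPauli_mul_self, two_smul, one_mul, one_mul, mul_one]
    abel
  rw [transvectionU, Matrix.smul_mul, Matrix.mul_smul, h1, smul_smul, smul_smul,
    inv_sqrt_two_mul_self, inv_mul_cancel₀ two_ne_zero, one_smul]

/-- If `W(v)` commutes with `W(h)`, it commutes with `U = (1 ± iW(h))/√2`. If it anticommutes, then
`U W(v) = W(v) U†`, so `U W(v) U† = W(v) U† U† = U² W(v)`, and `U² = ± i W(h)` adds `h` to `v`. -/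
theorem transvectionU_conjActs {n : ℕ} (a : ZMod 2) (h : Vec n) :
    ConjActs (transvectionU a h) (transvection h) := by
  intro v
  rw [transvection_mulVec]
  have hc := pauliOp_comm v h
  rcases zmod_two_cases (symp v h) with h0 | h0
  · refine ⟨0, ?_⟩
    rw [h0, sgn_zero, one_smul] at hc
    have h1 : (transvectionU a h).1 * pauliOp v = pauliOp v * (transvectionU a h).1 := by
      simp only [transvectionU, skewPauli, Matrix.smul_mul, Matrix.mul_smul, Matrix.add_mul,
        Matrix.mul_add, Matrix.one_mul, Matrix.mul_one, hc]
    rw [h1, Matrix.mul_assoc, mul_conjTranspose, h0, Matrix.mul_one, zero_smul, add_zero, pow_zero,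
      one_smul]
  · rw [h0, sgn_one, neg_one_smul] at hc
    obtain ⟨k, hk⟩ := pauliOp_mul h v
    have h1 : (transvectionU a h).1 * pauliOp v = pauliOp v * (transvectionU a h).1ᴴ := by
      rw [conjTranspose_transvectionU]
      simp only [transvectionU, skewPauli_add_one]
      simp only [skewPauli, Matrix.smul_mul, Matrix.mul_smul, Matrix.add_mul, Matrix.mul_add,
        Matrix.one_mul, Matrix.mul_one, Matrix.mul_neg, hc, smul_neg, neg_neg]
    have h3 : pauliOp v * (transvectionU a h).1ᴴ * (transvectionU a h).1ᴴ =
        (transvectionU a h).1 * (transvectionU a h).1 * pauliOp v := by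
      rw [Matrix.mul_assoc (transvectionU a h).1, h1, ← Matrix.mul_assoc, h1]
    rw [h1, h3, transvectionU_mul_self, skewPauli, Matrix.smul_mul, hk, smul_smul, h0, one_smul,
      add_comm h v, sgn_eq_I_pow]
    exact ⟨2 * a.val + 1 + k, by rw [pow_add, pow_add, pow_one]⟩

/-- The inverse of the unitary is the one with the opposite sign, and it acts through the same
transvection. -/
theorem transvectionU_mem {n : ℕ} (h : Vec n) : transvectionU 0 h ∈ pauliNormalizer n := by
  refine mem_pauliNormalizer_of_conjActs (transvectionU_conjActs 0 h) (N := transvection h) ?_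
  convert transvectionU_conjActs (0 + 1) h
  exact Subtype.ext (conjTranspose_transvectionU 0 h)

theorem exists_conjActs_prod {n : ℕ} (hs : List (Vec n)) :
    ∃ U ∈ pauliNormalizer n, ConjActs U (hs.map transvection).prod := by
  induction hs with
  | nil => exact ⟨1, one_mem _, ConjActs.one⟩
  | cons h hs ih =>
    obtain ⟨U, hU, hc⟩ := ih
    refine ⟨transvectionU 0 h * U, mul_mem (transvectionU_mem h) hU, ?_⟩
    rw [List.map_cons, List.prod_cons]
    exact (transvectionU_conjActs 0 h).mul hc

theorem pauliU_conj {n : ℕ} (u v : Vec n) :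
    (pauliU u).1 * pauliOp v * (pauliU u).1ᴴ = sgn (symp u v) • pauliOp v := by
  change pauliOp u * pauliOp v * (pauliOp u)ᴴ = _
  rw [pauliOp_comm, pauliOp_conjTranspose, Matrix.smul_mul, Matrix.mul_assoc, pauliOp_mul_self,
    Matrix.mul_one]

/-- The two halves of `u` appear exchanged because `Xⱼ` anticommutes with the `Z` part at `j`, and
`Zⱼ` with the `X` part. -/
theorem actsAs_pauli {n : ℕ} {P : QubitUnitary n} {k : ℕ} {u : Vec n}
    (h : P.1 = Complex.I ^ k • pauliOp u) :
    ActsAs P (u ∘ Sum.inr) (u ∘ Sum.inl) 1 := by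
  rw [actsAs_iff]
  intro p
  have h1 : (fun q => (1 : Sp n).1 q p) = Pi.single p 1 := by
    ext q
    change (1 : Matrix (Fin n ⊕ Fin n) (Fin n ⊕ Fin n) (ZMod 2)) q p = _
    rw [Matrix.one_apply, Pi.single_apply]
  have h2 : symp u (Pi.single p 1) = Sum.elim (u ∘ Sum.inr) (u ∘ Sum.inl) p := by
    rcases p with j | j
    · rw [symp_single_inl]; rfl
    · rw [symp_single_inr]; rfl
  have h3 : Complex.I ^ k * Complex.I ^ (3 * k) = 1 := by
    rw [← pow_add, show k + 3 * k = 4 * k by ring, pow_mul, Complex.I_pow_four, one_pow]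
  rw [h, Matrix.conjTranspose_smul, star_I_pow, Matrix.smul_mul, Matrix.smul_mul, Matrix.mul_smul,
    smul_smul, h3, one_smul, h1, ← h2]
  exact pauliU_conj u _

/-- Multiplying by a Pauli operator on the right changes the signs and nothing else. -/
theorem ActsAs.mul_pauli {n : ℕ} {U P : QubitUnitary n} {r s r' s' : Fin n → ZMod 2} {S : Sp n}
    (hU : ActsAs U r s S) (hP : ActsAs P r' s' 1) : ActsAs (U * P) (r + r') (s + s') S := by
  rw [actsAs_iff] at *
  intro p
  have h1 : (fun q => (1 : Sp n).1 q p) = Pi.single p 1 := by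
    ext q
    change (1 : Matrix (Fin n ⊕ Fin n) (Fin n ⊕ Fin n) (ZMod 2)) q p = _
    rw [Matrix.one_apply, Pi.single_apply]
  have h : (U * P).1 * pauliOp (Pi.single p 1) * (U * P).1ᴴ =
      U.1 * (P.1 * pauliOp (Pi.single p 1) * P.1ᴴ) * U.1ᴴ := by
    rw [Matrix.UnitaryGroup.mul_val, Matrix.conjTranspose_mul]
    simp only [Matrix.mul_assoc]
  rw [h, hP, Matrix.mul_smul, Matrix.smul_mul, h1, hU, smul_smul, ← sgn_add]
  congr 2
  rcases p with j | j <;> simp [add_comm]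

/-! ### The commutant of the Pauli operators -/

theorem tensor_single_apply {n : ℕ} (j : Fin n) (x y : Fin n → Fin 2) :
    onQubit j sigmaX x y = if Function.update y j (1 - y j) = x then 1 else 0 := by
  have h1 : ∀ k, (Pi.mulSingle j sigmaX : Fin n → Matrix (Fin 2) (Fin 2) ℂ) k (x k) (y k) =
      if Function.update y j (1 - y j) k = x k then 1 else 0 := by
    intro k
    by_cases h : k = j
    · subst h
      simp only [Pi.mulSingle_eq_same, Function.update_self, sigmaX]
      generalize x k = a
      generalize y k = b
      fin_cases a <;> fin_cases b <;> simp
    · simp [h, Matrix.one_apply, eq_comm]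
  rw [onQubit, tensor, Matrix.of_apply, Finset.prod_congr rfl fun k _ => h1 k,
    Finset.prod_ite_zero]
  simp [funext_iff]

theorem onQubit_sigmaZ_apply {n : ℕ} (j : Fin n) (x y : Fin n → Fin 2) :
    onQubit j sigmaZ x y = if x = y then (-1) ^ (x j).val else 0 := by
  have h1 : ∀ k, (Pi.mulSingle j sigmaZ : Fin n → Matrix (Fin 2) (Fin 2) ℂ) k (x k) (y k) =
      if x k = y k then (Pi.mulSingle j ((-1) ^ (x j).val) : Fin n → ℂ) k else 0 := by
    intro k
    by_cases h : k = j
    · subst h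
      simp only [Pi.mulSingle_eq_same, sigmaZ]
      generalize x k = a
      generalize y k = b
      fin_cases a <;> fin_cases b <;> simp
    · simp [h, Matrix.one_apply]
  rw [onQubit, tensor, Matrix.of_apply, Finset.prod_congr rfl fun k _ => h1 k,
    Finset.prod_ite_zero]
  simp [funext_iff, Finset.prod_pi_mulSingle']

/-- Commuting with `Zⱼ` kills every entry whose row and column labels differ at `j`, so `A` is
diagonal. Commuting with `Xⱼ` makes the diagonal invariant under flipping bit `j`, and flips connect
all bit strings. -/
theorem exists_scalar_of_commute {n : ℕ} {A : Matrix (Fin n → Fin 2) (Fin n → Fin 2) ℂ}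
    (hX : ∀ j, A * onQubit j sigmaX = onQubit j sigmaX * A)
    (hZ : ∀ j, A * onQubit j sigmaZ = onQubit j sigmaZ * A) : ∃ c : ℂ, A = c • 1 := by
  have hd : ∀ x y, x ≠ y → A x y = 0 := by
    intro x y hxy
    obtain ⟨j, hj⟩ := Function.ne_iff.1 hxy
    have h := congrFun (congrFun (hZ j) x) y
    simp only [Matrix.mul_apply, onQubit_sigmaZ_apply, mul_ite, mul_zero, ite_mul, zero_mul,
      Finset.sum_ite_eq, Finset.sum_ite_eq', Finset.mem_univ, if_true] at h
    have h2 : ((x j).val = 0 ∧ (y j).val = 1) ∨ ((x j).val = 1 ∧ (y j).val = 0) := by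
      have := Fin.val_ne_of_ne hj
      have := (x j).isLt
      have := (y j).isLt
      omega
    rcases h2 with ⟨ha, hb⟩ | ⟨ha, hb⟩ <;> rw [ha, hb, pow_zero, pow_one] at h
    · linear_combination (-1 / 2) * h
    · linear_combination (1 / 2) * h
  have hflip : ∀ (j : Fin n) (y : Fin n → Fin 2),
      A (Function.update y j (1 - y j)) (Function.update y j (1 - y j)) = A y y := by
    intro j y
    have h := congrFun (congrFun (hX j) (Function.update y j (1 - y j))) y
    simp only [Matrix.mul_apply, tensor_single_apply, mul_ite, mul_one, mul_zero, ite_mul,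
      one_mul, zero_mul, Finset.sum_ite_eq, Finset.mem_univ, if_true] at h
    rw [h, Finset.sum_eq_single y]
    · simp
    · intro z _ hz
      rw [hd z y hz, ite_self]
    · simp
  -- The ones of `x` are switched on one position at a time, starting from the zero string.
  have hc : ∀ (x : Fin n → Fin 2) (s : Finset (Fin n)),
      A (fun k => if k ∈ s then x k else 0) (fun k => if k ∈ s then x k else 0) = A 0 0 := by
    intro x s
    induction s using Finset.induction_on with
    | empty => simp; rfl
    | insert j s hj ih =>
      by_cases h : x j = 0
      · rw [← ih]
        have : (fun k => if k ∈ insert j s then x k else 0) =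
            fun k => if k ∈ s then x k else 0 := by
          funext k
          by_cases hk : k = j
          · subst hk; simp [h]
          · simp [hk]
        rw [this]
      · rw [← ih, ← hflip j (fun k => if k ∈ s then x k else 0)]
        have : (fun k => if k ∈ insert j s then x k else 0) =
            Function.update (fun k => if k ∈ s then x k else 0) j
              (1 - if j ∈ s then x j else 0) := by
          funext k
          by_cases hk : k = j
          · subst hk
            simp only [Finset.mem_insert_self, if_true, Function.update_self, hj, if_false]
            generalize x k = a at h
            fin_cases a
            · exact absurd rfl h
            · rfl
          · simp [hk]
        rw [this]
  refine ⟨A 0 0, ?_⟩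
  ext x y
  by_cases hxy : x = y
  · subst hxy
    simpa using hc x Finset.univ
  · simp [hd x y hxy, hxy]

/-! ### The parameters of a Clifford element -/

theorem ActsAs.mul_phase {n : ℕ} {U V : QubitUnitary n} {r s : Fin n → ZMod 2} {S : Sp n}
    (h : ActsAs U r s S) (hV : V ∈ phases n) : ActsAs (U * V) r s S := by
  obtain ⟨z, hz⟩ := hV
  have h1 : z * star z = 1 := by
    have h2 := mul_conjTranspose V
    rw [hz, Matrix.conjTranspose_smul, Matrix.conjTranspose_one, Matrix.smul_mul, Matrix.one_mul,
      smul_smul] at h2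
    simpa using congrFun (congrFun h2 0) 0
  rw [actsAs_iff] at *
  intro p
  rw [← h p, Matrix.UnitaryGroup.mul_val, hz, Matrix.mul_smul, Matrix.mul_one,
    Matrix.conjTranspose_smul, Matrix.smul_mul, Matrix.smul_mul, Matrix.mul_smul, smul_smul, h1,
    one_smul]

theorem inv_mul_mem_phases {n : ℕ} {U V : QubitUnitary n} {r s : Fin n → ZMod 2} {S : Sp n}
    (hU : ActsAs U r s S) (hV : ActsAs V r s S) : U⁻¹ * V ∈ phases n := by
  have key : ∀ p, (U⁻¹ * V).1 * pauliOp (Pi.single p 1) =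
      pauliOp (Pi.single p 1) * (U⁻¹ * V).1 := by
    intro p
    have h1 := (actsAs_iff.1 hU p).trans (actsAs_iff.1 hV p).symm
    have h2 : U.1ᴴ * (V.1 * pauliOp (Pi.single p 1) * V.1ᴴ) * V.1 =
        U.1ᴴ * (U.1 * pauliOp (Pi.single p 1) * U.1ᴴ) * V.1 := by rw [h1]
    have h3 : U.1ᴴ * (V.1 * pauliOp (Pi.single p 1) * V.1ᴴ) * V.1 =
        U.1ᴴ * V.1 * pauliOp (Pi.single p 1) * (V.1ᴴ * V.1) := by
      simp only [Matrix.mul_assoc]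
    have h4 : U.1ᴴ * (U.1 * pauliOp (Pi.single p 1) * U.1ᴴ) * V.1 =
        (U.1ᴴ * U.1) * pauliOp (Pi.single p 1) * (U.1ᴴ * V.1) := by
      simp only [Matrix.mul_assoc]
    rw [h3, h4, conjTranspose_mul, conjTranspose_mul, Matrix.mul_one, Matrix.one_mul] at h2
    exact h2
  refine exists_scalar_of_commute (fun j => ?_) fun j => ?_
  · rw [onQubit_sigmaX]; exact key _
  · rw [onQubit_sigmaZ]; exact key _

theorem toClifford_eq_iff {n : ℕ} {U V : pauliNormalizer n} {r s : Fin n → ZMod 2} {S : Sp n}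
    (hU : ActsAs U.1 r s S) : toClifford U = toClifford V ↔ ActsAs V.1 r s S := by
  rw [toClifford, toClifford, QuotientGroup.eq, Subgroup.mem_subgroupOf]
  constructor
  · intro h
    have h1 := hU.mul_phase h
    rwa [show U.1 * (U⁻¹ * V : pauliNormalizer n).1 = V.1 from mul_inv_cancel_left U.1 V.1] at h1
  · exact fun hV => inv_mul_mem_phases hU hV

/-- The parameters `((r, s), S)` of a Clifford element. -/
def cliffordParams {n : ℕ} (c : CliffordGroup n) :
    ((Fin n → ZMod 2) × (Fin n → ZMod 2)) × Sp n :=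
  ((Classical.choose (exists_actsAs c.out),
    Classical.choose (Classical.choose_spec (exists_actsAs c.out))),
    Classical.choose (Classical.choose_spec (Classical.choose_spec (exists_actsAs c.out))))

theorem actsAs_iff_cliffordParams {n : ℕ} (U : pauliNormalizer n) (r s : Fin n → ZMod 2)
    (S : Sp n) : ActsAs U.1 r s S ↔ cliffordParams (toClifford U) = ((r, s), S) := by
  have h1 := Classical.choose_spec
    (Classical.choose_spec (Classical.choose_spec (exists_actsAs (toClifford U).out)))
  have h2 : ActsAs U.1 (cliffordParams (toClifford U)).1.1 (cliffordParams (toClifford U)).1.2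
      (cliffordParams (toClifford U)).2 :=
    (toClifford_eq_iff h1).1 (QuotientGroup.out_eq' (toClifford U))
  constructor
  · intro h
    obtain ⟨hr, hs, hS⟩ := h2.unique h
    exact Prod.ext (Prod.ext hr hs) hS
  · intro h
    rwa [h] at h2

theorem cliffordParams_injective {n : ℕ} :
    Function.Injective (cliffordParams : CliffordGroup n → _) := by
  intro c d h
  obtain ⟨U, rfl⟩ := QuotientGroup.mk_surjective c
  obtain ⟨V, rfl⟩ := QuotientGroup.mk_surjective d
  have hU := (actsAs_iff_cliffordParams U _ _ _).2 rfl
  exact (toClifford_eq_iff hU).2 ((actsAs_iff_cliffordParams V _ _ _).2 h.symm)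

/-- The image of an element of the Pauli group in the Clifford group. -/
theorem cliffordParams_of_mem {n : ℕ} {c : CliffordGroup n} (hc : c ∈ pauliClasses n) :
    ∃ (P : pauliNormalizer n) (k : ℕ) (u : Vec n), toClifford P = c ∧
      P.1.1 = Complex.I ^ k • pauliOp u := by
  obtain ⟨P, hP, rfl⟩ := hc
  obtain ⟨k, u, h⟩ := exists_of_mem_pauliGroup (Subgroup.mem_subgroupOf.1 hP)
  exact ⟨P, k, u, rfl, h⟩

theorem exists_pauli_actsAs {n : ℕ} (r s : Fin n → ZMod 2) :
    ∃ P : pauliNormalizer n, toClifford P ∈ pauliClasses n ∧ ActsAs P.1 r s 1 := by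
  obtain ⟨k, hk⟩ := exists_phaseU_mul_pauliU_mem (Sum.elim s r : Vec n)
  refine ⟨⟨phaseU k * pauliU (Sum.elim s r), Subgroup.le_normalizer hk⟩, ⟨_, hk, rfl⟩, ?_⟩
  refine actsAs_pauli (k := k) (u := Sum.elim s r) ?_
  simp [phaseU, pauliU]

theorem cliffordParams_mul_pauli {n : ℕ} (c : CliffordGroup n) {p : CliffordGroup n}
    (hp : p ∈ pauliClasses n) :
    cliffordParams (c * p) =
      ((cliffordParams c).1 + (cliffordParams p).1, (cliffordParams c).2) := by
  obtain ⟨P, k, u, rfl, hP⟩ := cliffordParams_of_mem hp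
  obtain ⟨U, rfl⟩ := QuotientGroup.mk_surjective c
  have h1 := actsAs_pauli hP
  have h2 := (actsAs_iff_cliffordParams U _ _ _).2 rfl
  rw [(actsAs_iff_cliffordParams P _ _ _).1 h1]
  exact (actsAs_iff_cliffordParams (U * P) _ _ _).1 (h2.mul_pauli h1)

/-- The unitary built from transvections has the right symplectic part but uncontrolled signs `r'`,
`s'`; a Pauli factor with bits `r - r'` and `s - s'` corrects them. -/
theorem exists_actsAs_of_prod {n : ℕ} (r s : Fin n → ZMod 2) {S : Sp n}
    (hS : ∃ hs : List (Vec n), (hs.map transvection).prod = S.1) :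
    ∃ U : pauliNormalizer n, ActsAs U.1 r s S := by
  obtain ⟨hs, h⟩ := hS
  obtain ⟨U, hU, hc⟩ := exists_conjActs_prod hs
  rw [h] at hc
  obtain ⟨r', s', h'⟩ := hc.exists_actsAs
  obtain ⟨P, -, hP⟩ := exists_pauli_actsAs (r - r') (s - s')
  refine ⟨⟨U, hU⟩ * P, ?_⟩
  have h2 := h'.mul_pauli hP
  rwa [add_sub_cancel, add_sub_cancel] at h2

theorem ConjActs.unique {n : ℕ} {U : QubitUnitary n} {S S' : Sp n} (h : ConjActs U S.1)
    (h' : ConjActs U S'.1) : S = S' := by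
  obtain ⟨r, s, h1⟩ := h.exists_actsAs
  obtain ⟨r', s', h2⟩ := h'.exists_actsAs
  exact (h1.unique h2).2.2

theorem cliffordParams_mul_snd {n : ℕ} (c d : CliffordGroup n) :
    (cliffordParams (c * d)).2 = (cliffordParams c).2 * (cliffordParams d).2 := by
  obtain ⟨U, rfl⟩ := QuotientGroup.mk_surjective c
  obtain ⟨V, rfl⟩ := QuotientGroup.mk_surjective d
  have hU := ((actsAs_iff_cliffordParams U _ _ _).2 rfl).conjActs
  have hV := ((actsAs_iff_cliffordParams V _ _ _).2 rfl).conjActs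
  have hUV := ((actsAs_iff_cliffordParams (U * V) _ _ _).2 rfl).conjActs
  exact hUV.unique (hU.mul hV)

/-- The symplectic part of a Clifford element, as a homomorphism. -/
def cliffordToSp (n : ℕ) : CliffordGroup n →* Sp n :=
  MonoidHom.mk' (fun c => (cliffordParams c).2) cliffordParams_mul_snd

/-- An element with trivial symplectic part has the same parameters as the Pauli class with its sign
bits, and the parameters are injective. -/
theorem ker_cliffordToSp (n : ℕ) : (cliffordToSp n).ker = pauliClasses n := by
  ext c
  rw [MonoidHom.mem_ker]
  constructor
  · intro h
    obtain ⟨P, hP, hA⟩ := exists_pauli_actsAs (cliffordParams c).1.1 (cliffordParams c).1.2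
    have h1 : c = toClifford P := by
      apply cliffordParams_injective
      rw [(actsAs_iff_cliffordParams P _ _ _).1 hA]
      exact Prod.ext rfl h
    rw [h1]
    exact hP
  · intro h
    obtain ⟨P, k, u, rfl, hP⟩ := cliffordParams_of_mem h
    exact congrArg Prod.snd ((actsAs_iff_cliffordParams P _ _ _).1 (actsAs_pauli hP))

/-- The description of the Clifford group by Pauli bits and symplectic matrices, given that the
symplectic group is generated by transvections. -/
theorem clifford_structure {n : ℕ}
    (hgen : ∀ S : Sp n, ∃ hs : List (Vec n), (hs.map transvection).prod = S.1) :
    ∃ (Φ : CliffordGroup n ≃ ((Fin n → ZMod 2) × (Fin n → ZMod 2)) × Sp n)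
      (φ : (CliffordGroup n ⧸ pauliClasses n) ≃* Sp n),
      (∀ (U : pauliNormalizer n) (r s : Fin n → ZMod 2) (S : Sp n),
        ActsAs U.1 r s S ↔ Φ (toClifford U) = ((r, s), S)) ∧
      (∀ c : CliffordGroup n, φ (QuotientGroup.mk c) = (Φ c).2) ∧
      Function.Bijective (fun p : pauliClasses n => (Φ p.1).1) ∧
      (∀ c : CliffordGroup n, ∀ p ∈ pauliClasses n,
        Φ (c * p) = ((Φ c).1 + (Φ p).1, (Φ c).2)) := by
  have hsurj : Function.Surjective (cliffordParams : CliffordGroup n → _) := by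
    rintro ⟨⟨r, s⟩, S⟩
    obtain ⟨U, hU⟩ := exists_actsAs_of_prod r s (hgen S)
    exact ⟨toClifford U, (actsAs_iff_cliffordParams U _ _ _).1 hU⟩
  have hsurj' : Function.Surjective (cliffordToSp n) := fun S => by
    obtain ⟨c, hc⟩ := hsurj ((0, 0), S)
    exact ⟨c, congrArg Prod.snd hc⟩
  refine ⟨Equiv.ofBijective _ ⟨cliffordParams_injective, hsurj⟩,
    (QuotientGroup.quotientMulEquivOfEq (ker_cliffordToSp n).symm).trans
      (QuotientGroup.quotientKerEquivOfSurjective _ hsurj'), actsAs_iff_cliffordParams,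
    fun c => rfl, ⟨?_, ?_⟩, fun c p hp => cliffordParams_mul_pauli c hp⟩
  · rintro ⟨c, hc⟩ ⟨d, hd⟩ h
    apply Subtype.ext
    apply cliffordParams_injective
    rw [← ker_cliffordToSp, MonoidHom.mem_ker] at hc hd
    exact Prod.ext h (Eq.trans hc hd.symm)
  · rintro ⟨r, s⟩
    obtain ⟨P, hP, hA⟩ := exists_pauli_actsAs r s
    exact ⟨⟨_, hP⟩, congrArg Prod.fst ((actsAs_iff_cliffordParams P _ _ _).1 hA)⟩

/-! ### Transvections -/

theorem symp_mulVec_eq {n : ℕ} {M : Matrix (Fin n ⊕ Fin n) (Fin n ⊕ Fin n) (ZMod 2)}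
    (hM : M ∈ Matrix.symplecticGroup (Fin n) (ZMod 2)) (v w : Vec n) :
    symp (M *ᵥ v) (M *ᵥ w) = symp v w := by
  have h : v ⬝ᵥ (Mᵀ * Matrix.J (Fin n) (ZMod 2) * M) *ᵥ w = symp (M *ᵥ v) (M *ᵥ w) := by
    rw [symp, ← Matrix.mulVec_mulVec, ← Matrix.mulVec_mulVec, Matrix.dotProduct_mulVec v,
      Matrix.vecMul_transpose]
  rw [← h, SymplecticGroup.mem_iff'.1 hM, symp]

theorem mem_symplectic_of_symp_mulVec {n : ℕ}
    {M : Matrix (Fin n ⊕ Fin n) (Fin n ⊕ Fin n) (ZMod 2)}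
    (h : ∀ v w, symp (M *ᵥ v) (M *ᵥ w) = symp v w) :
    M ∈ Matrix.symplecticGroup (Fin n) (ZMod 2) := by
  refine mem_symplectic_of_symp fun p q => ?_
  rw [← symp_single_eq_J, ← h (Pi.single p 1), Matrix.mulVec_single_one, Matrix.mulVec_single_one]

theorem vec_add_self {n : ℕ} (v : Vec n) : v + v = 0 :=
  funext fun _ => CharTwo.add_self_eq_zero _

theorem transvection_mem {n : ℕ} (h : Vec n) :
    transvection h ∈ Matrix.symplecticGroup (Fin n) (ZMod 2) := by
  refine mem_symplectic_of_symp_mulVec fun v w => ?_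
  simp only [transvection_mulVec, symp_add_left, symp_add_right, symp_smul_left, symp_smul_right,
    symp_self, symp_comm h w]
  -- Each of the two cross terms equals `⟨v, h⟩⟨w, h⟩`, so they cancel in characteristic two.
  linear_combination CharTwo.add_self_eq_zero (symp v h * symp w h)

theorem transvection_mul_self {n : ℕ} (h : Vec n) : transvection h * transvection h = 1 := by
  apply Matrix.ext_of_mulVec_single
  intro p
  rw [← Matrix.mulVec_mulVec, transvection_mulVec, transvection_mulVec, Matrix.one_mulVec,
    symp_add_left, symp_smul_left, symp_self, mul_zero, add_zero, add_assoc,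
    vec_add_self, add_zero]

theorem transvection_prod_mem {n : ℕ} (hs : List (Vec n)) :
    (hs.map transvection).prod ∈ Matrix.symplecticGroup (Fin n) (ZMod 2) := by
  refine list_prod_mem fun A hA => ?_
  obtain ⟨h, -, rfl⟩ := List.mem_map.1 hA
  exact transvection_mem h

theorem transvection_prod_fixes {n : ℕ} {v : Vec n} {hs : List (Vec n)}
    (h : ∀ w ∈ hs, symp v w = 0) : (hs.map transvection).prod *ᵥ v = v := by
  induction hs with
  | nil => simp
  | cons w hs ih =>
    rw [List.map_cons, List.prod_cons, ← Matrix.mulVec_mulVec,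
      ih fun u hu => h u (List.mem_cons_of_mem w hu), transvection_mulVec,
      h w List.mem_cons_self, zero_smul, add_zero]

/-- As `⟨e, g⟩ = 1`, the transvection along `e + g` moves `e` to `g`. The one along `f + g` then
moves `g` to `f`; when `g = f` its vector is zero and it is the identity. -/
theorem transvection_pair_mulVec {n : ℕ} {e f g : Vec n} (he : symp e g = 1)
    (hg : symp g f = 1 ∨ g = f) :
    transvection (f + g) *ᵥ (transvection (e + g) *ᵥ e) = f := by
  have h1 : transvection (e + g) *ᵥ e = g := by
    rw [transvection_mulVec, symp_add_right, symp_self, he, zero_add, one_smul, ← add_assoc,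
      vec_add_self, zero_add]
  rw [h1, transvection_mulVec, symp_add_right, symp_self, add_zero]
  rcases hg with hg | rfl
  · rw [hg, one_smul, add_comm f, ← add_assoc, vec_add_self, zero_add]
  · rw [symp_self, zero_smul, add_zero]

theorem transvection_fixes {n : ℕ} {e b : Vec n} (t : ZMod 2) (hb : symp e b = 0) :
    transvection (e + b) *ᵥ (transvection (t • e) *ᵥ e) = e := by
  rw [transvection_mulVec _ e, transvection_mulVec, symp_smul_right, symp_self, mul_zero, zero_smul,
    add_zero, symp_add_right, symp_self, hb, add_zero, zero_smul, add_zero]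

/-- Together with `transvection_fixes` this moves the second vector of a hyperbolic pair while the
first stays put. The second transvection always contributes one `e`, and so the coefficient is `1 +
t`. -/
theorem transvection_shear {n : ℕ} {e e' b : Vec n} (t : ZMod 2) (he : symp e' e = 1)
    (hb : symp e b = 0) (hb' : symp e' b = 0) :
    transvection (e + b) *ᵥ (transvection (t • e) *ᵥ e') = e' + (1 + t) • e + b := by
  have ht : t * t = t := by rcases zmod_two_cases t with rfl | rfl <;> rfl
  rw [transvection_mulVec _ e', transvection_mulVec, symp_smul_right, he, mul_one, smul_smul, ht,
    symp_add_left, symp_smul_left, symp_add_right, symp_add_right, symp_self, he, hb, hb']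
  simp only [add_zero, mul_zero, one_smul, add_smul]
  abel

/-! ### Vectors given by bit functions -/

@[simp] theorem toF2_false : toF2 false = 0 := rfl

@[simp] theorem toF2_true : toF2 true = 1 := rfl

theorem toF2_xor (a b : Bool) : toF2 (a ^^ b) = toF2 a + toF2 b := by
  cases a <;> cases b <;> rfl

theorem toF2_and (a b : Bool) : toF2 (a && b) = toF2 a * toF2 b := by
  cases a <;> cases b <;> rfl

theorem toF2_not (a : Bool) : toF2 (!a) = 1 + toF2 a := by
  cases a <;> rfl

theorem toF2_injective : Function.Injective toF2 := by
  intro a b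
  cases a <;> cases b <;> decide

theorem toF2_decide_eq_one (a : ZMod 2) : toF2 (decide (a = 1)) = a := by
  rcases zmod_two_cases a with rfl | rfl <;> rfl

theorem toF2_eq_one {a : Bool} : toF2 a = 1 ↔ a = true := by cases a <;> simp

theorem pos_injective {n : ℕ} : Function.Injective (pos : Fin n ⊕ Fin n → ℕ) := by
  rintro (i | i) (j | j) h <;> simp only [pos] at h
  · rw [Fin.ext (show i.val = j.val by omega)]
  · omega
  · omega
  · rw [Fin.ext (show i.val = j.val by omega)]

theorem pos_lt {n : ℕ} (P : Fin n ⊕ Fin n) : pos P < 2 * n := by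
  rcases P with i | i <;> simp only [pos] <;> omega

theorem exists_pos {n k : ℕ} (h : k < 2 * n) : ∃ P : Fin n ⊕ Fin n, pos P = k := by
  rcases Nat.mod_two_eq_zero_or_one k with h0 | h0
  · exact ⟨Sum.inl ⟨k / 2, by omega⟩, by simp only [pos]; omega⟩
  · exact ⟨Sum.inr ⟨k / 2, by omega⟩, by simp only [pos]; omega⟩

/-- The vector with bits `c` from position `2j` on, and zero before. -/
def vecAt {n : ℕ} (j : ℕ) (c : ℕ → Bool) : Vec n := fun P =>
  if pos P < 2 * j then 0 else toF2 (c (pos P - 2 * j))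

theorem vecAt_apply {n j p : ℕ} {c : ℕ → Bool} {P : Fin n ⊕ Fin n} (hP : pos P = 2 * j + p) :
    (vecAt j c : Vec n) P = toF2 (c p) := by
  rw [vecAt, hP, if_neg (by omega), Nat.add_sub_cancel_left]

theorem vecAt_congr {n j : ℕ} {c d : ℕ → Bool} (h : ∀ p < 2 * (n - j), c p = d p) :
    (vecAt j c : Vec n) = vecAt j d := by
  ext P
  unfold vecAt
  split_ifs with hP
  · rfl
  · rw [h]
    have := pos_lt P
    omega

theorem vecAt_xor {n : ℕ} (j : ℕ) (c d : ℕ → Bool) :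
    (vecAt j (fun p => c p ^^ d p) : Vec n) = vecAt j c + vecAt j d := by
  ext P
  simp only [vecAt, Pi.add_apply]
  split_ifs
  · simp
  · exact toF2_xor _ _

/-- The coordinate vector of `Xⱼ`. -/
abbrev unitX {n : ℕ} (j : Fin n) : Vec n := Pi.single (Sum.inl j) 1

/-- The coordinate vector of `Zⱼ`. -/
abbrev unitZ {n : ℕ} (j : Fin n) : Vec n := Pi.single (Sum.inr j) 1

theorem vecAt_eq_single {n j w : ℕ} {P : Fin n ⊕ Fin n} (hP : pos P = 2 * j + w) :
    (vecAt j (fun p => decide (p = w)) : Vec n) = Pi.single P 1 := by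
  ext Q
  unfold vecAt
  by_cases h : Q = P
  · subst h
    rw [if_neg (by omega), Pi.single_eq_same, hP, Nat.add_sub_cancel_left]
    simp
  · rw [Pi.single_eq_of_ne h]
    have h1 : pos Q ≠ pos P := fun h' => h (pos_injective h')
    split_ifs with h2
    · rfl
    · rw [← toF2_false]
      exact congrArg toF2 (decide_eq_false (by omega))

theorem vecAt_unitX {n : ℕ} (j : Fin n) : vecAt j.val (fun p => decide (p = 0)) = unitX j :=
  vecAt_eq_single rfl

theorem vecAt_unitZ {n : ℕ} (j : Fin n) : vecAt j.val (fun p => decide (p = 1)) = unitZ j :=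
  vecAt_eq_single rfl

theorem symp_unitX {n : ℕ} (j : Fin n) (v : Vec n) : symp (unitX j) v = v (Sum.inr j) := by
  rw [symp_comm, symp_single_inl]

theorem symp_unitZ {n : ℕ} (j : Fin n) (v : Vec n) : symp (unitZ j) v = v (Sum.inl j) := by
  rw [symp_comm, symp_single_inr]

/-! ### The four transvections of one level -/

/-- The symplectic partner of the last index below `2k` where `b` is set. -/
def lastPartner (b : ℕ → Bool) : ℕ → ℕ
  | 0 => 0
  | k + 1 => if b (2 * k + 1) then 2 * k else if b (2 * k) then 2 * k + 1 else lastPartner b k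

/-- The position of the second coordinate that is set in the auxiliary vector of a level. -/
def partner (m : ℕ) (b : ℕ → Bool) : ℕ := if b 0 then 1 else lastPartner b m

/-- The bits of the auxiliary vector `g` of a level with first column `f`: `⟨e₁, g⟩ = 1`, and
`⟨g, f⟩ = 1` or `g = f`. -/
def auxBit (w : ℕ) (b : ℕ → Bool) (p : ℕ) : Bool :=
  if b 1 then b p else decide (p = 1) || decide (p = w)

/-- The bits of the four transvection vectors of level `m`. The bits `b 0, …, b (2m - 1)` are the
first column, the following `2m - 1` bits describe the second one. -/
def levelBit (m w : ℕ) (b : ℕ → Bool) (t p : ℕ) : Bool :=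
  if t = 0 then b p ^^ auxBit w b p
  else if t = 1 then decide (p = 0) ^^ auxBit w b p
  else if t = 2 then decide (p = 0) || (!decide (p < 2) && b (2 * m - 1 + p))
  else decide (p = 0) && b (2 * m)

theorem lastPartner_congr {b c : ℕ → Bool} {k : ℕ} (h : ∀ p < 2 * k, b p = c p) :
    lastPartner b k = lastPartner c k := by
  induction k with
  | zero => rfl
  | succ k ih =>
    rw [lastPartner, lastPartner, h _ (by omega), h _ (by omega), ih fun p hp => h p (by omega)]

theorem partner_congr {m : ℕ} {b c : ℕ → Bool} (hm : 0 < m) (h : ∀ p < 2 * m, b p = c p) :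
    partner m b = partner m c := by
  rw [partner, partner, h 0 (by omega), lastPartner_congr h]

/-- The count `4m - 1` arises as follows. The second column needs a bit for its coefficient of `e`,
stored at `2m`, and bits for the positions from `2` on, stored with shift `2m - 1`. Its coefficient
of `e'` is forced to be `1` and occupies no bit. -/
theorem levelBit_congr {m w : ℕ} {b c : ℕ → Bool} (hm : 0 < m)
    (h : ∀ p < 4 * m - 1, b p = c p) {t p : ℕ} (hp : p < 2 * m) :
    levelBit m w b t p = levelBit m w c t p := by
  simp only [levelBit, auxBit]
  rw [h p (by omega), h 1 (by omega), h (2 * m - 1 + p) (by omega), h (2 * m) (by omega)]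

theorem levelBit_congr_of_lt_two {m w : ℕ} {b c : ℕ → Bool} (hm : 0 < m)
    (h : ∀ p < 2 * m, b p = c p) {t p : ℕ} (ht : t < 2) (hp : p < 2 * m) :
    levelBit m w b t p = levelBit m w c t p := by
  simp only [levelBit, auxBit]
  rw [h p (by omega), h 1 (by omega)]
  interval_cases t <;> simp

theorem lastPartner_spec {b : ℕ → Bool} {k : ℕ} (h : ∃ p < 2 * k, b p = true) :
    ∃ i < k, (lastPartner b k = 2 * i ∧ b (2 * i + 1) = true) ∨
      (lastPartner b k = 2 * i + 1 ∧ b (2 * i) = true) := by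
  induction k with
  | zero => obtain ⟨p, hp, -⟩ := h; omega
  | succ k ih =>
    rw [lastPartner]
    by_cases h1 : b (2 * k + 1) = true
    · exact ⟨k, by omega, Or.inl ⟨by rw [if_pos h1], h1⟩⟩
    rw [if_neg h1]
    by_cases h2 : b (2 * k) = true
    · exact ⟨k, by omega, Or.inr ⟨by rw [if_pos h2], h2⟩⟩
    rw [if_neg h2]
    obtain ⟨p, hp, hb⟩ := h
    have h3 : p ≠ 2 * k := fun h' => h2 (h' ▸ hb)
    have h4 : p ≠ 2 * k + 1 := fun h' => h1 (h' ▸ hb)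
    obtain ⟨i, hi, h5⟩ := ih ⟨p, by omega, hb⟩
    exact ⟨i, by omega, h5⟩

section Level

variable {n : ℕ} (j : Fin n) (b : ℕ → Bool)

theorem symp_unitX_aux (w : ℕ) : symp (unitX j) (vecAt j.val (auxBit w b)) = 1 := by
  rw [symp_unitX, vecAt_apply (p := 1) rfl, auxBit]
  cases h : b 1 <;> simp

/-- If `b 1` is set, then `f` itself pairs to `1` with `e` and serves as `g`. Otherwise `g` contains
`e'`, which pairs with `f` to `b 0`. If that is `1`, no correction is needed; if it is `0`, adding
the coordinate vector dual to a set coordinate of `f` makes the pairing `1`. -/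
theorem symp_aux (hb : ∃ p < 2 * (n - j.val), b p = true) :
    symp (vecAt j.val (auxBit (partner (n - j.val) b) b) : Vec n) (vecAt j.val b) = 1 ∨
      (vecAt j.val (auxBit (partner (n - j.val) b) b) : Vec n) = vecAt j.val b := by
  by_cases h1 : b 1 = true
  · right
    congr 1
    funext p
    rw [auxBit, if_pos h1]
  left
  have hx : ∀ w, 1 ≠ w → (vecAt j.val (auxBit w b) : Vec n) =
      unitZ j + vecAt j.val (fun p => decide (p = w)) := by
    intro w hw
    rw [← vecAt_unitZ, ← vecAt_xor]
    congr 1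
    funext p
    rw [auxBit, if_neg h1]
    by_cases hp : p = 1
    · subst hp; simp [hw]
    · simp [hp]
  have hj0 : ∀ i : Fin n, j ≤ i → (vecAt j.val b : Vec n) (Sum.inl i) =
      toF2 (b (2 * (i.val - j.val))) := by
    intro i hi
    have : j.val ≤ i.val := hi
    exact vecAt_apply (by simp only [pos]; omega)
  have hj1 : ∀ i : Fin n, j ≤ i → (vecAt j.val b : Vec n) (Sum.inr i) =
      toF2 (b (2 * (i.val - j.val) + 1)) := by
    intro i hi
    have : j.val ≤ i.val := hi
    exact vecAt_apply (by simp only [pos]; omega)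
  by_cases h0 : b 0 = true
  · have hw : partner (n - j.val) b = 1 := by rw [partner, if_pos h0]
    have h2 : (vecAt j.val (auxBit 1 b) : Vec n) = unitZ j := by
      rw [← vecAt_unitZ]
      congr 1
      funext p
      rw [auxBit, if_neg h1, Bool.or_self]
    rw [hw, h2, symp_unitZ, hj0 j le_rfl, Nat.sub_self, mul_zero, h0, toF2_true]
  · have hw : partner (n - j.val) b = lastPartner b (n - j.val) := by rw [partner, if_neg h0]
    rw [Bool.not_eq_true] at h0 h1
    obtain ⟨i, hi, h3 | h3⟩ := lastPartner_spec hb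
    · have hi0 : i ≠ 0 := by
        rintro rfl
        rw [h1] at h3
        exact Bool.false_ne_true h3.2
      rw [hw, h3.1, hx _ (by omega), vecAt_eq_single (P := Sum.inl ⟨j.val + i, by omega⟩)
        (by simp only [pos]; omega), symp_add_left, symp_unitZ, symp_unitX, hj0 j le_rfl,
        hj1 _ (by simp [Fin.le_def]), Nat.sub_self, mul_zero, h0,
        show j.val + i - j.val = i by omega, h3.2]
      rfl
    · have hi0 : i ≠ 0 := by
        rintro rfl
        rw [h0] at h3
        exact Bool.false_ne_true h3.2
      rw [hw, h3.1, hx _ (by omega), vecAt_eq_single (P := Sum.inr ⟨j.val + i, by omega⟩)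
        (by simp only [pos]; omega), symp_add_left, symp_unitZ, symp_unitZ, hj0 j le_rfl,
        hj0 _ (by simp [Fin.le_def]), Nat.sub_self, mul_zero, h0,
        show j.val + i - j.val = i by omega, h3.2]
      rfl

/-- The `t`-th transvection vector of the level that starts at coordinate pair `j`. -/
def levelVec (n j : ℕ) (b : ℕ → Bool) (t : ℕ) : Vec n :=
  vecAt j (levelBit (n - j) (partner (n - j) b) b t)

/-- The part of the second column of a level outside its first coordinate pair. -/
def tailVec (n j : ℕ) (b : ℕ → Bool) : Vec n :=
  vecAt j fun p => !decide (p < 2) && b (2 * (n - j) - 1 + p)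

theorem levelVec_zero : levelVec n j.val b 0 =
    vecAt j.val b + vecAt j.val (auxBit (partner (n - j.val) b) b) := by
  rw [levelVec, ← vecAt_xor]
  rfl

theorem levelVec_one : levelVec n j.val b 1 =
    unitX j + vecAt j.val (auxBit (partner (n - j.val) b) b) := by
  rw [levelVec, ← vecAt_unitX, ← vecAt_xor]
  rfl

theorem levelVec_two : levelVec n j.val b 2 = unitX j + tailVec n j.val b := by
  rw [levelVec, ← vecAt_unitX, tailVec, ← vecAt_xor]
  congr 1
  funext p
  simp only [levelBit, OfNat.ofNat_ne_zero, if_false, if_true, show (2 : ℕ) ≠ 1 by decide]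
  by_cases hp : p = 0
  · simp [hp]
  · simp [hp]

/-- The switch `t` is encoded by allowing the zero vector, whose transvection is the identity; thus
every level uses exactly four vectors. -/
theorem levelVec_three : levelVec n j.val b 3 = toF2 (b (2 * (n - j.val))) • unitX j := by
  rw [levelVec, ← vecAt_unitX]
  ext P
  simp only [vecAt, Pi.smul_apply, smul_eq_mul, levelBit]
  split_ifs
  · simp
  · simp_all
  · simp_all
  · simp_all
  · rw [toF2_and, mul_comm]

theorem symp_unitX_tailVec : symp (unitX j) (tailVec n j.val b) = 0 := by
  rw [symp_unitX, tailVec, vecAt_apply (p := 1) rfl]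
  simp

theorem symp_unitZ_tailVec : symp (unitZ j) (tailVec n j.val b) = 0 := by
  rw [symp_unitZ, tailVec, vecAt_apply (p := 0) rfl]
  simp

theorem symp_unitZ_unitX : symp (unitZ j) (unitX j) = 1 := by
  rw [symp_unitZ, unitX, Pi.single_eq_same]

theorem level_lower_unitX : transvection (levelVec n j.val b 2) *ᵥ
    (transvection (levelVec n j.val b 3) *ᵥ unitX j) = unitX j := by
  rw [levelVec_two, levelVec_three, transvection_fixes _ (symp_unitX_tailVec j b)]

theorem level_lower_unitZ : transvection (levelVec n j.val b 2) *ᵥ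
    (transvection (levelVec n j.val b 3) *ᵥ unitZ j) =
      unitZ j + (1 + toF2 (b (2 * (n - j.val)))) • unitX j + tailVec n j.val b := by
  rw [levelVec_two, levelVec_three, transvection_shear _ (symp_unitZ_unitX j)
    (symp_unitX_tailVec j b) (symp_unitZ_tailVec j b)]

theorem level_upper_unitX (hb : ∃ p < 2 * (n - j.val), b p = true) :
    transvection (levelVec n j.val b 0) *ᵥ
    (transvection (levelVec n j.val b 1) *ᵥ unitX j) = vecAt j.val b := by
  rw [levelVec_zero, levelVec_one,
    transvection_pair_mulVec (symp_unitX_aux j b _) (symp_aux j b hb)]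

end Level

/-! ### The embedding `S ↦ 1₂ ⊕ S` -/

/-- The vector `v` moved to the coordinate pairs from the second one on. -/
def shiftVec {n : ℕ} (v : Vec n) : Vec (n + 1) :=
  Sum.elim (Fin.cons 0 (v ∘ Sum.inl)) (Fin.cons 0 (v ∘ Sum.inr))

@[simp] theorem shiftVec_inl_zero {n : ℕ} (v : Vec n) : shiftVec v (Sum.inl 0) = 0 := rfl

@[simp] theorem shiftVec_inr_zero {n : ℕ} (v : Vec n) : shiftVec v (Sum.inr 0) = 0 := rfl

@[simp] theorem shiftVec_inl_succ {n : ℕ} (v : Vec n) (i : Fin n) :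
    shiftVec v (Sum.inl i.succ) = v (Sum.inl i) := rfl

@[simp] theorem shiftVec_inr_succ {n : ℕ} (v : Vec n) (i : Fin n) :
    shiftVec v (Sum.inr i.succ) = v (Sum.inr i) := rfl

theorem shiftVec_injective {n : ℕ} : Function.Injective (shiftVec : Vec n → _) := by
  intro v w h
  ext P
  rcases P with i | i
  · exact congrFun h (Sum.inl i.succ)
  · exact congrFun h (Sum.inr i.succ)

theorem symp_shiftVec {n : ℕ} (v w : Vec n) : symp (shiftVec v) (shiftVec w) = symp v w := by
  simp [symp_eq, Fin.sum_univ_succ]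

theorem shiftVec_add {n : ℕ} (v w : Vec n) : shiftVec (v + w) = shiftVec v + shiftVec w := by
  ext P
  rcases P with i | i <;> refine Fin.cases ?_ (fun i => ?_) i <;> simp

theorem shiftVec_smul {n : ℕ} (a : ZMod 2) (v : Vec n) : shiftVec (a • v) = a • shiftVec v := by
  ext P
  rcases P with i | i <;> refine Fin.cases ?_ (fun i => ?_) i <;> simp

theorem exists_shiftVec {n : ℕ} {v : Vec (n + 1)} (hx : v (Sum.inl 0) = 0)
    (hz : v (Sum.inr 0) = 0) : ∃ w : Vec n, v = shiftVec w := by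
  refine ⟨Sum.elim (fun i => v (Sum.inl i.succ)) (fun i => v (Sum.inr i.succ)), ?_⟩
  ext P
  rcases P with i | i <;> refine Fin.cases ?_ (fun i => ?_) i <;> simp [hx, hz]

theorem shiftVec_vecAt {n j : ℕ} (c : ℕ → Bool) :
    shiftVec (vecAt j c : Vec n) = vecAt (j + 1) c := by
  ext P
  rcases P with i | i <;> refine Fin.cases ?_ (fun i => ?_) i
  · simp [vecAt, pos]
  · simp only [shiftVec_inl_succ, vecAt, pos, Fin.val_succ,
      show 2 * (i.val + 1) - 2 * (j + 1) = 2 * i.val - 2 * j by omega]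
    exact if_congr (by omega) rfl rfl
  · rw [shiftVec_inr_zero, vecAt, if_pos (by simp only [pos, Fin.val_zero]; omega)]
  · simp only [shiftVec_inr_succ, vecAt, pos, Fin.val_succ,
      show 2 * (i.val + 1) + 1 - 2 * (j + 1) = 2 * i.val + 1 - 2 * j by omega]
    exact if_congr (by omega) rfl rfl

theorem oneTwoSum_mulVec_shiftVec {n : ℕ} (S : Matrix (Fin n ⊕ Fin n) (Fin n ⊕ Fin n) (ZMod 2))
    (v : Vec n) : oneTwoSum S *ᵥ shiftVec v = shiftVec (S *ᵥ v) := by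
  ext P
  rcases P with i | i <;> refine Fin.cases ?_ (fun i => ?_) i <;>
    simp [Matrix.mulVec, dotProduct, Fintype.sum_sum_type, Fin.sum_univ_succ, oneTwoSum, border,
      Matrix.toBlocks₁₁, Matrix.toBlocks₁₂, Matrix.toBlocks₂₁, Matrix.toBlocks₂₂]

theorem oneTwoSum_mulVec_unitX {n : ℕ} (S : Matrix (Fin n ⊕ Fin n) (Fin n ⊕ Fin n) (ZMod 2)) :
    oneTwoSum S *ᵥ unitX 0 = unitX 0 := by
  rw [unitX, Matrix.mulVec_single_one]
  ext P
  rcases P with i | i <;> refine Fin.cases ?_ (fun i => ?_) i <;>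
    simp [Matrix.col, oneTwoSum, border]

theorem oneTwoSum_mulVec_unitZ {n : ℕ} (S : Matrix (Fin n ⊕ Fin n) (Fin n ⊕ Fin n) (ZMod 2)) :
    oneTwoSum S *ᵥ unitZ 0 = unitZ 0 := by
  rw [unitZ, Matrix.mulVec_single_one]
  ext P
  rcases P with i | i <;> refine Fin.cases ?_ (fun i => ?_) i <;>
    simp [Matrix.col, oneTwoSum, border]

theorem matrix_ext_shift {n : ℕ}
    {M N : Matrix (Fin (n + 1) ⊕ Fin (n + 1)) (Fin (n + 1) ⊕ Fin (n + 1)) (ZMod 2)}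
    (hx : M *ᵥ unitX 0 = N *ᵥ unitX 0) (hz : M *ᵥ unitZ 0 = N *ᵥ unitZ 0)
    (h : ∀ v : Vec n, M *ᵥ shiftVec v = N *ᵥ shiftVec v) : M = N := by
  apply Matrix.ext_of_mulVec_single
  intro P
  rcases P with i | i <;> refine Fin.cases ?_ (fun i => ?_) i
  · exact hx
  · obtain ⟨w, hw⟩ := exists_shiftVec (v := (Pi.single (Sum.inl i.succ) 1 : Vec (n + 1)))
      (Pi.single_eq_of_ne (by simp [Fin.ext_iff]) _) (Pi.single_eq_of_ne (by simp) _)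
    rw [hw]
    exact h w
  · exact hz
  · obtain ⟨w, hw⟩ := exists_shiftVec (v := (Pi.single (Sum.inr i.succ) 1 : Vec (n + 1)))
      (Pi.single_eq_of_ne (by simp) _) (Pi.single_eq_of_ne (by simp [Fin.ext_iff]) _)
    rw [hw]
    exact h w

/-- Shifted vectors are orthogonal to the first hyperbolic pair, so their transvections fix that
pair; on the complement the shift preserves the form. -/
theorem oneTwoSum_transvection_prod {n : ℕ} (hs : List (Vec n)) :
    ((hs.map shiftVec).map transvection).prod = oneTwoSum (hs.map transvection).prod := by
  have hfix : ∀ u : Vec (n + 1), (∀ w ∈ hs, symp u (shiftVec w) = 0) →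
      ((hs.map shiftVec).map transvection).prod *ᵥ u = u := by
    intro u hu
    refine transvection_prod_fixes fun w hw => ?_
    obtain ⟨w', hw', rfl⟩ := List.mem_map.1 hw
    exact hu w' hw'
  apply matrix_ext_shift
  · rw [oneTwoSum_mulVec_unitX, hfix]
    exact fun w _ => by rw [symp_unitX, shiftVec_inr_zero]
  · rw [oneTwoSum_mulVec_unitZ, hfix]
    exact fun w _ => by rw [symp_unitZ, shiftVec_inl_zero]
  · intro v
    rw [oneTwoSum_mulVec_shiftVec]
    induction hs with
    | nil => simp
    | cons h hs ih =>
      have hfix' : ∀ u : Vec (n + 1), (∀ w ∈ hs, symp u (shiftVec w) = 0) →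
          ((hs.map shiftVec).map transvection).prod *ᵥ u = u := by
        intro u hu
        refine transvection_prod_fixes fun w hw => ?_
        obtain ⟨w', hw', rfl⟩ := List.mem_map.1 hw
        exact hu w' hw'
      rw [List.map_cons, List.map_cons, List.prod_cons, ← Matrix.mulVec_mulVec, ih hfix',
        List.map_cons, List.prod_cons, ← Matrix.mulVec_mulVec, transvection_mulVec,
        transvection_mulVec, symp_shiftVec, shiftVec_add, shiftVec_smul]

theorem oneTwoSum_injective {n : ℕ} : Function.Injective
    (oneTwoSum : Matrix (Fin n ⊕ Fin n) (Fin n ⊕ Fin n) (ZMod 2) → _) := by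
  intro S T h
  apply Matrix.ext_of_mulVec_single
  intro P
  apply shiftVec_injective
  rw [← oneTwoSum_mulVec_shiftVec, ← oneTwoSum_mulVec_shiftVec, h]

/-- A symplectic map fixing a hyperbolic pair preserves its orthogonal complement, and the
restriction is again symplectic. -/
theorem exists_oneTwoSum {n : ℕ}
    {M : Matrix (Fin (n + 1) ⊕ Fin (n + 1)) (Fin (n + 1) ⊕ Fin (n + 1)) (ZMod 2)}
    (hM : M ∈ Matrix.symplecticGroup (Fin (n + 1)) (ZMod 2)) (hx : M *ᵥ unitX 0 = unitX 0)
    (hz : M *ᵥ unitZ 0 = unitZ 0) : ∃ S : Sp n, M = oneTwoSum S.1 := by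
  have key : ∀ v : Vec n, ∃ w : Vec n, M *ᵥ shiftVec v = shiftVec w := by
    intro v
    apply exists_shiftVec
    · rw [← symp_unitZ 0 (M *ᵥ shiftVec v), ← hz, symp_mulVec_eq hM, symp_unitZ, shiftVec_inl_zero]
    · rw [← symp_unitX 0 (M *ᵥ shiftVec v), ← hx, symp_mulVec_eq hM, symp_unitX, shiftVec_inr_zero]
  choose f hf using key
  have hadd : ∀ v w, f (v + w) = f v + f w := fun v w => shiftVec_injective (by
    rw [← hf, shiftVec_add, Matrix.mulVec_add, hf, hf, shiftVec_add])
  have hsmul : ∀ (a : ZMod 2) v, f (a • v) = a • f v := fun a v => shiftVec_injective (by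
    rw [← hf, shiftVec_smul, Matrix.mulVec_smul, hf, shiftVec_smul])
  let L : Vec n →ₗ[ZMod 2] Vec n := ⟨⟨f, hadd⟩, hsmul⟩
  have hL : ∀ v, LinearMap.toMatrix' L *ᵥ v = f v := fun v => LinearMap.toMatrix'_mulVec L v
  refine ⟨⟨LinearMap.toMatrix' L, mem_symplectic_of_symp_mulVec fun v w => ?_⟩, ?_⟩
  · rw [hL, hL, ← symp_shiftVec, ← hf, ← hf, symp_mulVec_eq hM, symp_shiftVec]
  · apply matrix_ext_shift
    · rw [hx, oneTwoSum_mulVec_unitX]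
    · rw [hz, oneTwoSum_mulVec_unitZ]
    · intro v
      rw [oneTwoSum_mulVec_shiftVec, hL, hf]

/-! ### Numbers and levels -/

/-- The number `N(m) = 2^(2m-1) (4^m - 1)` of elements of a level. -/
def levelSize (m : ℕ) : ℕ := 2 ^ (2 * m - 1) * (4 ^ m - 1)

/-- The number whose lowest `4m - 1` bits describe the first two columns of level `m` for the
index `x`: the quotient of `x` by `4^m - 1`, followed by the remainder plus one. -/
def levelNum (m x : ℕ) : ℕ := 2 ^ (2 * m) * (x / (4 ^ m - 1)) + (x % (4 ^ m - 1) + 1)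

theorem four_pow_eq (m : ℕ) : 4 ^ m = 2 ^ (2 * m) := by
  rw [pow_mul]
  norm_num

theorem four_le_four_pow {m : ℕ} (hm : 0 < m) : 4 ≤ 4 ^ m :=
  Nat.le_self_pow hm.ne' 4

theorem levelSize_pos {m : ℕ} (hm : 0 < m) : 0 < levelSize m :=
  Nat.mul_pos (by positivity) (by have := four_le_four_pow hm; omega)

theorem levelSize_succ (n : ℕ) : levelSize (n + 1) = 2 ^ (2 * n + 1) * (4 ^ (n + 1) - 1) := rfl

theorem mod_add_one_lt {m : ℕ} (hm : 0 < m) (x : ℕ) : x % (4 ^ m - 1) + 1 < 2 ^ (2 * m) := by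
  have h1 := four_le_four_pow hm
  have h2 := Nat.mod_lt x (show 4 ^ m - 1 > 0 by omega)
  rw [← four_pow_eq]
  omega

/-- With `x = (4^m - 1) y + r`, trading the factor `4^m - 1` for `4^m` adds one more `y`. This
identity lets the programs pass between `x` and its code by additions alone. -/
theorem levelNum_eq {m : ℕ} (hm : 0 < m) (x : ℕ) : levelNum m x = x / (4 ^ m - 1) + x + 1 := by
  have h1 := four_le_four_pow hm
  have h2 := Nat.div_add_mod x (4 ^ m - 1)
  have h3 : 4 ^ m * (x / (4 ^ m - 1)) =
      (4 ^ m - 1) * (x / (4 ^ m - 1)) + x / (4 ^ m - 1) := by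
    rw [← Nat.succ_mul]
    congr 1
    omega
  rw [levelNum, ← four_pow_eq]
  omega

theorem levelNum_testBit_low {m : ℕ} (hm : 0 < m) (x : ℕ) {p : ℕ} (hp : p < 2 * m) :
    (levelNum m x).testBit p = (x % (4 ^ m - 1) + 1).testBit p := by
  rw [levelNum, Nat.testBit_two_pow_mul_add _ (mod_add_one_lt hm x), if_pos hp]

theorem levelNum_testBit_high {m : ℕ} (hm : 0 < m) (x p : ℕ) :
    (levelNum m x).testBit (2 * m + p) = (x / (4 ^ m - 1)).testBit p := by
  rw [levelNum, Nat.testBit_two_pow_mul_add _ (mod_add_one_lt hm x), if_neg (by omega),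
    Nat.add_sub_cancel_left]

theorem div_levelSize (m x : ℕ) : x / levelSize m = x / (4 ^ m - 1) / 2 ^ (2 * m - 1) := by
  rw [levelSize, mul_comm, Nat.div_div_eq_div_mul]

/-- Dividing by `levelSize m` is a mere shift of the code, so the index for the next level needs no
computation of its own. -/
theorem levelNum_testBit_next {m : ℕ} (hm : 0 < m) (x p : ℕ) :
    (levelNum m x).testBit (4 * m - 1 + p) = (x / levelSize m).testBit p := by
  rw [div_levelSize, Nat.testBit_div_two_pow, ← levelNum_testBit_high hm]
  congr 1
  omega

theorem levelNum_div {m : ℕ} (hm : 0 < m) (x : ℕ) :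
    levelNum m x / 2 ^ (2 * m) = x / (4 ^ m - 1) := by
  rw [levelNum, Nat.mul_add_div (by positivity), Nat.div_eq_of_lt (mod_add_one_lt hm x), add_zero]

theorem levelNum_add_mul {m : ℕ} (hm : 0 < m) (c q : ℕ) :
    levelNum m (c + levelSize m * q) = 2 ^ (4 * m - 1) * q + levelNum m c := by
  have h1 := four_le_four_pow hm
  have h2 : levelSize m * q = (4 ^ m - 1) * (2 ^ (2 * m - 1) * q) := by
    rw [levelSize]; ring
  have h3 : 2 ^ (4 * m - 1) = 2 ^ (2 * m) * 2 ^ (2 * m - 1) := by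
    rw [← pow_add]; congr 1; omega
  rw [levelNum, levelNum, h2, Nat.add_mul_div_left _ _ (by omega), Nat.add_mul_mod_self_left, h3]
  ring

theorem levelNum_lt {m : ℕ} (hm : 0 < m) {c : ℕ} (hc : c < levelSize m) :
    levelNum m c < 2 ^ (4 * m - 1) := by
  have h1 := four_le_four_pow hm
  have h2 : c / (4 ^ m - 1) < 2 ^ (2 * m - 1) := by
    rw [Nat.div_lt_iff_lt_mul (by omega)]
    exact hc
  have h3 : 2 ^ (4 * m - 1) = 2 ^ (2 * m) * 2 ^ (2 * m - 1) := by
    rw [← pow_add]; congr 1; omega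
  have h4 := mod_add_one_lt hm c
  rw [levelNum, h3]
  calc _ < 2 ^ (2 * m) * (c / (4 ^ m - 1)) + 2 ^ (2 * m) := by omega
    _ = 2 ^ (2 * m) * (c / (4 ^ m - 1) + 1) := by ring
    _ ≤ _ := Nat.mul_le_mul_left _ h2

theorem levelNum_mod {m : ℕ} (hm : 0 < m) {c : ℕ} (hc : c < levelSize m) (q : ℕ) {p : ℕ}
    (hp : p < 4 * m - 1) :
    (levelNum m (c + levelSize m * q)).testBit p = (levelNum m c).testBit p := by
  rw [levelNum_add_mul hm, Nat.testBit_two_pow_mul_add _ (levelNum_lt hm hc), if_pos hp]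

theorem levelNum_injective {m : ℕ} (hm : 0 < m) {x y : ℕ} (h : levelNum m x = levelNum m y) :
    x = y := by
  have h1 := levelNum_div hm x
  rw [h, levelNum_div hm] at h1
  have h2 := levelNum_eq hm x
  have h3 := levelNum_eq hm y
  omega

/-- The low part is a remainder plus one; the shift by one excludes precisely the zero column. -/
theorem exists_bit_levelNum {m : ℕ} (hm : 0 < m) (x : ℕ) :
    ∃ p < 2 * m, (levelNum m x).testBit p = true := by
  by_contra h
  have h0 : x % (4 ^ m - 1) + 1 = 0 := by
    apply Nat.eq_of_testBit_eq
    intro p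
    rw [Nat.zero_testBit]
    by_cases hp : p < 2 * m
    · rw [← levelNum_testBit_low hm x hp]
      by_contra h'
      exact h ⟨p, hp, by simpa using h'⟩
    · exact Nat.testBit_lt_two_pow ((mod_add_one_lt hm x).trans_le
        (Nat.pow_le_pow_right (by omega) (by omega)))
  omega

/-- Every bit pattern with a nonzero first column occurs. -/
theorem exists_levelNum {m : ℕ} (hm : 0 < m) (b : ℕ → Bool) (hb : ∃ p < 2 * m, b p = true) :
    ∃ c < levelSize m, ∀ p < 4 * m - 1, (levelNum m c).testBit p = b p := by
  have h1 := four_le_four_pow hm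
  set f := Nat.ofBits fun i : Fin (2 * m) => b i with hf
  set l := Nat.ofBits fun i : Fin (2 * m - 1) => b (2 * m + i) with hl
  have hf1 : f < 2 ^ (2 * m) := Nat.ofBits_lt_two_pow _
  have hl1 : l < 2 ^ (2 * m - 1) := Nat.ofBits_lt_two_pow _
  have hf0 : 0 < f := by
    obtain ⟨p, hp, hb⟩ := hb
    rcases Nat.eq_zero_or_pos f with h0 | h0
    · have h2 := Nat.testBit_ofBits_lt (fun i : Fin (2 * m) => b i) p hp
      rw [← hf, h0, Nat.zero_testBit, hb] at h2
      exact absurd h2 (by simp)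
    · exact h0
  rw [← four_pow_eq] at hf1
  have hlt : f - 1 < 4 ^ m - 1 := by omega
  have hnum : levelNum m (f - 1 + (4 ^ m - 1) * l) = 2 ^ (2 * m) * l + f := by
    rw [levelNum, Nat.add_mul_div_left _ _ (by omega), Nat.add_mul_mod_self_left,
      Nat.div_eq_of_lt hlt, Nat.mod_eq_of_lt hlt, zero_add]
    omega
  refine ⟨f - 1 + (4 ^ m - 1) * l, ?_, fun p hp => ?_⟩
  · calc f - 1 + (4 ^ m - 1) * l < (4 ^ m - 1) + (4 ^ m - 1) * l := by omega
      _ = (4 ^ m - 1) * (l + 1) := by ring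
      _ ≤ (4 ^ m - 1) * 2 ^ (2 * m - 1) := Nat.mul_le_mul_left _ hl1
      _ = levelSize m := mul_comm _ _
  · rw [hnum, Nat.testBit_two_pow_mul_add _ (by rwa [← four_pow_eq])]
    split_ifs with h2
    · exact Nat.testBit_ofBits_lt _ p h2
    · rw [hl, Nat.testBit_ofBits_lt _ _ (by omega)]
      simp only
      congr 1
      omega

/-! ### The canonical enumeration of the symplectic group -/

/-- The index that is left after `j` levels. -/
def levelIndex (n x : ℕ) : ℕ → ℕ
  | 0 => x
  | j + 1 => levelIndex n x j / levelSize (n - j)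

theorem levelIndex_succ_succ (n x j : ℕ) :
    levelIndex (n + 1) x (j + 1) = levelIndex n (x / levelSize (n + 1)) j := by
  induction j with
  | zero => rfl
  | succ j ih =>
    rw [levelIndex, ih, levelIndex, Nat.add_sub_add_right]

/-- The bits that describe level `j`. -/
def levelBits (n x j : ℕ) : ℕ → Bool := (levelNum (n - j) (levelIndex n x j)).testBit

/-- The `k`-th transvection vector of the element with index `x`. -/
def spVec (n x k : ℕ) : Vec n := levelVec n (k / 4) (levelBits n x (k / 4)) (k % 4)

/-- The `4n` transvection vectors of the element with index `x`. -/
def spVecs (n x : ℕ) : List (Vec n) := (List.range (4 * n)).map (spVec n x)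

/-- The symplectic matrix with index `x`. -/
def spElem (n x : ℕ) : Sp n := ⟨((spVecs n x).map transvection).prod, transvection_prod_mem _⟩

/-- The product of the four transvections of a level. -/
def levelElem (n : ℕ) (b : ℕ → Bool) : Sp n :=
  ⟨(((List.range 4).map (levelVec n 0 b)).map transvection).prod, transvection_prod_mem _⟩

theorem levelElem_val (n : ℕ) (b : ℕ → Bool) : (levelElem n b).1 =
    transvection (levelVec n 0 b 0) * (transvection (levelVec n 0 b 1) *
      (transvection (levelVec n 0 b 2) * transvection (levelVec n 0 b 3))) := by
  simp [levelElem, List.range_succ]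

theorem levelVec_congr {n j : ℕ} {b c : ℕ → Bool} (hj : j < n)
    (h : ∀ p < 4 * (n - j) - 1, b p = c p) (t : ℕ) : levelVec n j b t = levelVec n j c t := by
  rw [levelVec, levelVec, partner_congr (by omega) fun p hp => h p (by omega)]
  exact vecAt_congr fun p hp => levelBit_congr (by omega) h hp

theorem levelElem_congr {n : ℕ} {b c : ℕ → Bool} (h : ∀ p < 4 * (n + 1) - 1, b p = c p) :
    levelElem (n + 1) b = levelElem (n + 1) c := by
  apply Subtype.ext
  simp only [levelElem_val, levelVec_congr (n := n + 1) (j := 0) (by omega) h]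

theorem spVec_succ_add_four (n x k : ℕ) :
    spVec (n + 1) x (4 + k) = shiftVec (spVec n (x / levelSize (n + 1)) k) := by
  rw [spVec, spVec, levelVec, levelVec, shiftVec_vecAt, show (4 + k) / 4 = k / 4 + 1 by omega,
    show (4 + k) % 4 = k % 4 by omega, levelBits, levelBits, levelIndex_succ_succ,
    Nat.add_sub_add_right]

theorem spVecs_succ (n x : ℕ) : spVecs (n + 1) x =
    (List.range 4).map (levelVec (n + 1) 0 (levelNum (n + 1) x).testBit) ++
      (spVecs n (x / levelSize (n + 1))).map shiftVec := by
  rw [spVecs, show 4 * (n + 1) = 4 + 4 * n by ring, List.range_add, List.map_append, List.map_map,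
    spVecs, List.map_map]
  congr 1
  exact List.map_congr_left fun k _ => spVec_succ_add_four n x k

theorem spElem_succ (n x : ℕ) : (spElem (n + 1) x).1 =
    (levelElem (n + 1) (levelNum (n + 1) x).testBit).1 *
      oneTwoSum (spElem n (x / levelSize (n + 1))).1 := by
  simp only [spElem, levelElem]
  rw [spVecs_succ, List.map_append, List.prod_append, oneTwoSum_transvection_prod]

theorem spElem_succ_add {n c : ℕ} (hc : c < levelSize (n + 1)) (q : ℕ) :
    (spElem (n + 1) (c + levelSize (n + 1) * q)).1 =
      (levelElem (n + 1) (levelNum (n + 1) c).testBit).1 * oneTwoSum (spElem n q).1 := by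
  rw [spElem_succ, Nat.add_mul_div_left _ _ (levelSize_pos (by omega)), Nat.div_eq_of_lt hc,
    zero_add, levelElem_congr fun p hp => levelNum_mod (by omega) hc q hp]

theorem levelElem_mulVec_unitX {n : ℕ} {b : ℕ → Bool} (hb : ∃ p < 2 * (n + 1), b p = true) :
    (levelElem (n + 1) b).1 *ᵥ unitX 0 = vecAt 0 b := by
  simp only [levelElem_val, ← Matrix.mulVec_mulVec]
  have h1 := level_lower_unitX (n := n + 1) 0 b
  have h2 := level_upper_unitX (n := n + 1) 0 b hb
  rw [Fin.val_zero] at h1 h2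
  rw [h1, h2]

theorem spOrder_succ (n : ℕ) : spOrder (n + 1) = levelSize (n + 1) * spOrder n := by
  rw [spOrder, spOrder, levelSize_succ, Finset.prod_Icc_succ_top (by omega),
    show (n + 1) ^ 2 = 2 * n + 1 + n ^ 2 by ring, pow_add]
  ring

theorem mulVec_injective_of_mem {n : ℕ} {M : Matrix (Fin n ⊕ Fin n) (Fin n ⊕ Fin n) (ZMod 2)}
    (hM : M ∈ Matrix.symplecticGroup (Fin n) (ZMod 2)) : Function.Injective (M *ᵥ ·) :=
  Matrix.mulVec_injective_iff_isUnit.2 ((Matrix.isUnit_iff_isUnit_det M).2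
    (SymplecticGroup.symplectic_det hM))

/-- The second column of a level, after removal of the first two transvections, determines the
bits behind the first column. -/
theorem lowBits_of_shear_eq {n : ℕ} {j : Fin n} {b c : ℕ → Bool}
    (h : (unitZ j + (1 + toF2 (b (2 * (n - j.val)))) • unitX j + tailVec n j.val b : Vec n) =
      unitZ j + (1 + toF2 (c (2 * (n - j.val)))) • unitX j + tailVec n j.val c) {p : ℕ}
    (hp : 2 * (n - j.val) ≤ p) (hp' : p < 4 * (n - j.val) - 1) : b p = c p := by
  apply toF2_injective
  by_cases h0 : p = 2 * (n - j.val)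
  · have h1 := congrFun h (Sum.inl j)
    simp only [Pi.add_apply, Pi.smul_apply, tailVec, smul_eq_mul,
      vecAt_apply (P := Sum.inl j) (p := 0) rfl, unitX, unitZ, Pi.single_eq_same] at h1
    simp at h1
    rw [h0, h1]
  · obtain ⟨P, hP⟩ := exists_pos (n := n) (k := 2 * j.val + (p - (2 * (n - j.val) - 1))) (by omega)
    have hX : (unitX j : Vec n) P = 0 := Pi.single_eq_of_ne (by
      rintro rfl
      simp only [pos] at hP
      omega) _
    have hZ : (unitZ j : Vec n) P = 0 := Pi.single_eq_of_ne (by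
      rintro rfl
      simp only [pos] at hP
      omega) _
    have h1 := congrFun h P
    simp only [Pi.add_apply, Pi.smul_apply, tailVec, vecAt_apply hP, hX, hZ, smul_zero,
      zero_add] at h1
    rw [show 2 * (n - j.val) - 1 + (p - (2 * (n - j.val) - 1)) = p by omega] at h1
    have h2 : decide (p - (2 * (n - j.val) - 1) < 2) = false := by
      rw [decide_eq_false_iff_not]; omega
    simpa only [h2, Bool.not_false, Bool.true_and] using h1

/-- The image of `unitX 0` recovers the first `2(n+1)` bits of the level and the image of `unitZ 0`
the others. The level then cancels, and the remaining factors are compared by induction. -/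
theorem spElem_injOn (n : ℕ) : Set.InjOn (spElem n) (Set.Iio (spOrder n)) := by
  induction n with
  | zero =>
    intro x hx y hy _
    simp only [spOrder, Set.mem_Iio] at hx hy
    simp at hx hy
    omega
  | succ n ih =>
    intro x hx y hy hxy
    have hN := levelSize_pos (m := n + 1) (by omega)
    simp only [Set.mem_Iio, spOrder_succ] at hx hy
    have hval := congrArg Subtype.val hxy
    rw [spElem_succ, spElem_succ] at hval
    set b := (levelNum (n + 1) x).testBit with hb
    set c := (levelNum (n + 1) y).testBit with hc
    have hbx := exists_bit_levelNum (m := n + 1) (by omega) x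
    have hcy := exists_bit_levelNum (m := n + 1) (by omega) y
    rw [← hb] at hbx
    rw [← hc] at hcy
    have hX : (vecAt 0 b : Vec (n + 1)) = vecAt 0 c := by
      have h := congrArg (· *ᵥ unitX 0) hval
      simp only [← Matrix.mulVec_mulVec, oneTwoSum_mulVec_unitX] at h
      rwa [levelElem_mulVec_unitX hbx, levelElem_mulVec_unitX hcy] at h
    have hlow : ∀ p < 2 * (n + 1), b p = c p := by
      intro p hp
      obtain ⟨P, hP⟩ := exists_pos hp
      have h := congrFun hX P
      rw [vecAt_apply (p := p) (by omega), vecAt_apply (p := p) (by omega)] at h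
      exact toF2_injective h
    -- The first two vectors of a level depend on the first column only, so these transvections
    -- agree on both sides and can be cancelled from the images of `unitZ 0`.
    have hup : ∀ t < 2, levelVec (n + 1) 0 b t = levelVec (n + 1) 0 c t := by
      intro t ht
      rw [levelVec, levelVec, partner_congr (m := n + 1 - 0) (by omega) hlow]
      exact vecAt_congr fun p hp => levelBit_congr_of_lt_two (by omega) hlow ht hp
    have hZ := congrArg (· *ᵥ unitZ 0) hval
    simp only [← Matrix.mulVec_mulVec, oneTwoSum_mulVec_unitZ, levelElem_val, hup 0 (by omega),
      hup 1 (by omega)] at hZ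
    have hZ' := mulVec_injective_of_mem (transvection_mem _)
      (mulVec_injective_of_mem (transvection_mem _) hZ)
    have h1 := level_lower_unitZ (n := n + 1) 0 b
    have h2 := level_lower_unitZ (n := n + 1) 0 c
    rw [Fin.val_zero] at h1 h2
    rw [h1, h2] at hZ'
    have hall : ∀ p < 4 * (n + 1) - 1, b p = c p := by
      intro p hp
      by_cases hp' : p < 2 * (n + 1)
      · exact hlow p hp'
      · exact lowBits_of_shear_eq (n := n + 1) (j := 0) hZ' (by simp; omega) (by simpa using hp)
    rw [levelElem_congr hall] at hval
    have hq : spElem n (x / levelSize (n + 1)) = spElem n (y / levelSize (n + 1)) := by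
      apply Subtype.ext
      apply oneTwoSum_injective
      exact (((Matrix.isUnit_iff_isUnit_det _).2
        (SymplecticGroup.symplectic_det (levelElem (n + 1) c).2)).mul_right_inj).1 hval
    have hq' := ih (Set.mem_Iio.2 (Nat.div_lt_of_lt_mul hx))
      (Set.mem_Iio.2 (Nat.div_lt_of_lt_mul hy)) hq
    -- The code of an index below `levelSize (n + 1)` has no bits from position `4 * (n + 1) - 1`
    -- on, so the bits just compared determine it entirely.
    have hm : x % levelSize (n + 1) = y % levelSize (n + 1) := by
      apply levelNum_injective (m := n + 1) (by omega)
      apply Nat.eq_of_testBit_eq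
      intro p
      have hx' := Nat.mod_lt x hN
      have hy' := Nat.mod_lt y hN
      by_cases hp : p < 4 * (n + 1) - 1
      · rw [← levelNum_mod (by omega) hx' (x / levelSize (n + 1)) hp,
          ← levelNum_mod (by omega) hy' (y / levelSize (n + 1)) hp, Nat.mod_add_div,
          Nat.mod_add_div]
        exact hall p hp
      · have h3 := Nat.pow_le_pow_right (n := 2) (by omega) (not_lt.1 hp)
        rw [Nat.testBit_lt_two_pow ((levelNum_lt (by omega) hx').trans_le h3),
          Nat.testBit_lt_two_pow ((levelNum_lt (by omega) hy').trans_le h3)]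
    rw [← Nat.mod_add_div x (levelSize (n + 1)), ← Nat.mod_add_div y (levelSize (n + 1)), hm, hq']

/-- This is elimination: the level bits are read from the first two columns so that undoing the
level leaves a matrix fixing the first hyperbolic pair, to which induction applies. -/
theorem spElem_surjOn (n : ℕ) : Set.SurjOn (spElem n) (Set.Iio (spOrder n)) Set.univ := by
  induction n with
  | zero =>
    intro S _
    refine ⟨0, by simp [spOrder], Subtype.ext ?_⟩
    ext P
    rcases P with i | i <;> exact i.elim0
  | succ n ih =>
    rintro M -
    have hinj := mulVec_injective_of_mem M.2
    -- the bits of the first column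
    have hbits : ∀ v : Vec (n + 1), ∃ c : ℕ → Bool, v = vecAt 0 c := by
      intro v
      have h1 : ∀ k, ∃ a : Bool, ∀ P, pos P = k → toF2 a = v P := by
        intro k
        by_cases hk : k < 2 * (n + 1)
        · obtain ⟨P, hP⟩ := exists_pos hk
          refine ⟨decide (v P = 1), fun Q hQ => ?_⟩
          rw [pos_injective (hQ.trans hP.symm), toF2_decide_eq_one]
        · exact ⟨false, fun Q hQ => absurd (pos_lt Q) (by omega)⟩
      choose a ha using h1
      refine ⟨a, funext fun P => ?_⟩
      rw [vecAt_apply (p := pos P) (by omega), ha _ P rfl]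
    obtain ⟨f, hf⟩ := hbits (M.1 *ᵥ unitX 0)
    have hf0 : ∃ p < 2 * (n + 1), f p = true := by
      by_contra h
      have h1 : (vecAt 0 f : Vec (n + 1)) = 0 := by
        ext P
        rw [vecAt_apply (p := pos P) (by omega), Pi.zero_apply, ← toF2_false]
        congr 1
        by_contra h'
        exact h ⟨pos P, pos_lt P, by simpa using h'⟩
      rw [h1, ← Matrix.mulVec_zero M.1] at hf
      have h2 := congrFun (hinj hf) (Sum.inl 0)
      simp at h2
    set T := transvection (levelVec (n + 1) 0 f 0) with hT
    set T' := transvection (levelVec (n + 1) 0 f 1) with hT'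
    have hTT : T * T = 1 := transvection_mul_self _
    have hTT' : T' * T' = 1 := transvection_mul_self _
    have hM' : T' * (T * M.1) ∈ Matrix.symplecticGroup (Fin (n + 1)) (ZMod 2) :=
      mul_mem (transvection_mem _) (mul_mem (transvection_mem _) M.2)
    have hX : (T' * (T * M.1)) *ᵥ unitX 0 = unitX 0 := by
      have h2 := level_upper_unitX (n := n + 1) 0 f hf0
      rw [Fin.val_zero, ← hT, ← hT'] at h2
      rw [← Matrix.mulVec_mulVec, ← Matrix.mulVec_mulVec, hf, ← h2, Matrix.mulVec_mulVec _ T T, hTT,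
        Matrix.one_mulVec, Matrix.mulVec_mulVec _ T' T', hTT', Matrix.one_mulVec]
    obtain ⟨u, hu⟩ := hbits ((T' * (T * M.1)) *ᵥ unitZ 0)
    -- The form is preserved and `unitX 0` is fixed, so the image of `unitZ 0` still pairs to `1`
    -- with it. This is the coordinate for which no bit is stored.
    have hu1 : u 1 = true := by
      have h := symp_mulVec_eq hM' (unitX 0) (unitZ 0)
      rw [hX, hu, symp_unitX, vecAt_apply (p := 1) rfl, symp_unitX, unitZ, Pi.single_eq_same] at h
      exact toF2_eq_one.1 h
    -- all bits of the level
    let b : ℕ → Bool := fun p => if p < 2 * (n + 1) then f p else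
      if p = 2 * (n + 1) then !u 0 else u (p - (2 * (n + 1) - 1))
    have hbf : ∀ p < 2 * (n + 1), b p = f p := fun p hp => if_pos hp
    have hshear : (vecAt 0 u : Vec (n + 1)) =
        unitZ 0 + (1 + toF2 (b (2 * (n + 1 - 0)))) • unitX 0 + tailVec (n + 1) 0 b := by
      -- The shear has coefficient `1 + t` at `unitX 0`, so the stored bit `t` is the complement of
      -- the observed coordinate.
      have hb0 : b (2 * (n + 1)) = !u 0 := by
        simp [b]
      ext P
      rw [vecAt_apply (p := pos P) (by omega), Nat.sub_zero, hb0, toF2_not, ← add_assoc,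
        CharTwo.add_self_eq_zero, zero_add]
      simp only [Pi.add_apply, Pi.smul_apply, tailVec, smul_eq_mul]
      rw [vecAt_apply (p := pos P) (by omega)]
      by_cases hP0 : pos P = 0
      · obtain rfl : P = Sum.inl 0 := pos_injective hP0
        simp [pos]
      by_cases hP1 : pos P = 1
      · obtain rfl : P = Sum.inr 0 := pos_injective hP1
        simp [pos, hu1]
      · have hX0 : (unitX 0 : Vec (n + 1)) P = 0 :=
          Pi.single_eq_of_ne (by rintro rfl; exact hP0 rfl) _
        have hZ0 : (unitZ 0 : Vec (n + 1)) P = 0 :=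
          Pi.single_eq_of_ne (by rintro rfl; exact hP1 rfl) _
        have h2 : decide (pos P < 2) = false := by
          rw [decide_eq_false_iff_not]; omega
        have h3 : b (2 * (n + 1 - 0) - 1 + pos P) = u (pos P) := by
          simp only [b]
          rw [if_neg (by omega), if_neg (by omega)]
          congr 1
          omega
        rw [hX0, hZ0, h2, h3]
        simp
    obtain ⟨c, hc, hcb⟩ := exists_levelNum (m := n + 1) (by omega) b
      (by obtain ⟨p, hp, h⟩ := hf0; exact ⟨p, hp, (hbf p hp).trans h⟩)
    have hE : levelElem (n + 1) (levelNum (n + 1) c).testBit = levelElem (n + 1) b :=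
      levelElem_congr hcb
    have hup : ∀ t < 2, levelVec (n + 1) 0 b t = levelVec (n + 1) 0 f t := by
      intro t ht
      rw [levelVec, levelVec, partner_congr (m := n + 1 - 0) (by omega) hbf]
      exact vecAt_congr fun p hp => levelBit_congr_of_lt_two (by omega) hbf ht hp
    set R := transvection (levelVec (n + 1) 0 b 2) with hR
    set R' := transvection (levelVec (n + 1) 0 b 3) with hR'
    have hRR : R * R = 1 := transvection_mul_self _
    have hRR' : R' * R' = 1 := transvection_mul_self _
    have h1 := level_lower_unitX (n := n + 1) 0 b
    have h2 := level_lower_unitZ (n := n + 1) 0 b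
    rw [Fin.val_zero, ← hR, ← hR'] at h1 h2
    have hcancel : ∀ v, R' *ᵥ (R *ᵥ (R *ᵥ (R' *ᵥ v))) = v := by
      intro v
      rw [Matrix.mulVec_mulVec _ R R, hRR, Matrix.one_mulVec, Matrix.mulVec_mulVec, hRR',
        Matrix.one_mulVec]
    -- Transvections are involutions, so the inverse of the level is the same four factors in
    -- reversed order.
    obtain ⟨S, hS⟩ := exists_oneTwoSum (M := R' * (R * (T' * (T * M.1))))
      (mul_mem (transvection_mem _) (mul_mem (transvection_mem _) hM'))
      (by rw [← Matrix.mulVec_mulVec, ← Matrix.mulVec_mulVec _ R, hX]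
          nth_rewrite 1 [← h1]
          exact hcancel _)
      (by rw [← Matrix.mulVec_mulVec, ← Matrix.mulVec_mulVec _ R, hu, hshear, ← h2]
          exact hcancel _)
    obtain ⟨q, hq, rfl⟩ := ih (Set.mem_univ S)
    refine ⟨c + levelSize (n + 1) * q, ?_, ?_⟩
    · rw [Set.mem_Iio, spOrder_succ]
      calc c + levelSize (n + 1) * q < levelSize (n + 1) + levelSize (n + 1) * q := by omega
        _ = levelSize (n + 1) * (q + 1) := by ring
        _ ≤ _ := Nat.mul_le_mul_left _ hq
    · apply Subtype.ext
      rw [spElem_succ_add hc, hE, ← hS, levelElem_val, hup 0 (by omega), hup 1 (by omega), ← hT,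
        ← hT', ← hR, ← hR']
      calc T * (T' * (R * R')) * (R' * (R * (T' * (T * M.1))))
          = T * (T' * (R * (R' * R') * R) * T') * T * M.1 := by simp only [Matrix.mul_assoc]
        _ = M.1 := by
          rw [hRR', Matrix.mul_one, hRR, Matrix.mul_one, hTT', Matrix.mul_one, hTT, Matrix.one_mul]

theorem spElem_bijOn (n : ℕ) : Set.BijOn (spElem n) (Set.Iio (spOrder n)) Set.univ :=
  ⟨Set.mapsTo_univ _ _, spElem_injOn n, spElem_surjOn n⟩

theorem exists_transvection_prod {n : ℕ} (S : Sp n) :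
    ∃ hs : List (Vec n), (hs.map transvection).prod = S.1 := by
  obtain ⟨x, -, rfl⟩ := spElem_surjOn n (Set.mem_univ S)
  exact ⟨spVecs n x, rfl⟩

theorem card_Sp (n : ℕ) : Nat.card (Sp n) = spOrder n := by
  have h := Nat.card_congr (Set.BijOn.equiv _ (spElem_bijOn n))
  rw [Nat.card_congr (Equiv.Set.univ _)] at h
  rw [← h]
  simp

/-! ### Reasoning about programs -/

@[simp] theorem Store.setReg_reg (σ : Store) (x v y : ℕ) :
    (σ.setReg x v).reg y = if y = x then v else σ.reg y := by
  simp [Store.setReg, Function.update_apply]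

@[simp] theorem Store.setReg_bit (σ : Store) (x v : ℕ) : (σ.setReg x v).bit = σ.bit := rfl

@[simp] theorem Store.setBit_reg (σ : Store) (a i j : ℕ) (b : Bool) :
    (σ.setBit a i j b).reg = σ.reg := rfl

@[simp] theorem Store.setBit_bit (σ : Store) (a i j : ℕ) (b : Bool) (a' i' j' : ℕ) :
    (σ.setBit a i j b).bit a' i' j' =
      if a' = a ∧ i' = i ∧ j' = j then b else σ.bit a' i' j' := rfl

attribute [simp] BitExp.eval

@[simp] theorem Prog.run_zero (x : ℕ) (σ : Store) : (Prog.zero x).run σ = σ.setReg x 0 := rfl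

@[simp] theorem Prog.run_skip (σ : Store) : Prog.skip.run σ = σ := rfl

@[simp] theorem Prog.run_copy (x y : ℕ) (σ : Store) :
    (Prog.copy x y).run σ = σ.setReg x (σ.reg y) := rfl

@[simp] theorem Prog.run_succ (x : ℕ) (σ : Store) :
    (Prog.succ x).run σ = σ.setReg x (σ.reg x + 1) := rfl

@[simp] theorem Prog.run_pred (x : ℕ) (σ : Store) :
    (Prog.pred x).run σ = σ.setReg x (σ.reg x - 1) := rfl

@[simp] theorem Prog.run_store (a x y : ℕ) (e : BitExp) (σ : Store) :
    (Prog.store a x y e).run σ = σ.setBit a (σ.reg x) (σ.reg y) (e.eval σ) := rfl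

@[simp] theorem Prog.run_seq (c d : Prog) (σ : Store) : (c.seq d).run σ = d.run (c.run σ) := rfl

@[simp] theorem Prog.run_ite (e : BitExp) (c d : Prog) (σ : Store) :
    (Prog.ite e c d).run σ = if e.eval σ then c.run σ else d.run σ := rfl

/-- The registers that a program writes. -/
def Prog.regs : Prog → List ℕ
  | skip => []
  | zero x => [x]
  | copy x _ => [x]
  | succ x => [x]
  | pred x => [x]
  | store _ _ _ _ => []
  | seq c d => c.regs ++ d.regs
  | ite _ c d => c.regs ++ d.regs
  | loop x _ c => x :: c.regs

/-- The bit arrays that a program writes. -/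
def Prog.arrays : Prog → List ℕ
  | skip => []
  | zero _ => []
  | copy _ _ => []
  | succ _ => []
  | pred _ => []
  | store a _ _ _ => [a]
  | seq c d => c.arrays ++ d.arrays
  | ite _ c d => c.arrays ++ d.arrays
  | loop _ _ c => c.arrays

theorem Prog.run_reg_of_notMem (c : Prog) (σ : Store) {r : ℕ} (h : r ∉ c.regs) :
    (c.run σ).reg r = σ.reg r := by
  induction c generalizing σ with
  | seq c d hc hd =>
    simp only [regs, List.mem_append, not_or] at h
    rw [Prog.run, hd _ h.2, hc _ h.1]
  | ite e c d hc hd =>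
    simp only [regs, List.mem_append, not_or] at h
    rw [Prog.run]
    split_ifs
    · exact hc _ h.1
    · exact hd _ h.2
  | loop x y c hc =>
    simp only [regs, List.mem_cons, not_or] at h
    rw [Prog.run]
    induction σ.reg y with
    | zero => rfl
    | succ k ih => rw [rounds, hc _ h.2, Store.setReg_reg, if_neg h.1, ih]
  | _ => simp_all [regs]

theorem Prog.run_bit_of_notMem (c : Prog) (σ : Store) {a : ℕ} (h : a ∉ c.arrays) (i j : ℕ) :
    (c.run σ).bit a i j = σ.bit a i j := by
  induction c generalizing σ with
  | seq c d hc hd =>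
    simp only [arrays, List.mem_append, not_or] at h
    rw [Prog.run, hd _ h.2, hc _ h.1]
  | ite e c d hc hd =>
    simp only [arrays, List.mem_append, not_or] at h
    rw [Prog.run]
    split_ifs
    · exact hc _ h.1
    · exact hd _ h.2
  | loop x y c hc =>
    simp only [arrays] at h
    rw [Prog.run]
    induction σ.reg y with
    | zero => rfl
    | succ k ih => rw [rounds, hc _ h, Store.setReg_bit, ih]
  | _ => simp_all [arrays]

/-- The loop rule: an invariant that holds on entry and is preserved by every round
holds at the end. In a round, everything that the loop does not write is known to be unchanged. -/
theorem Prog.loop_invariant {x y : ℕ} {c : Prog} {σ : Store} (I : ℕ → Store → Prop)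
    (h0 : I 0 σ)
    (hs : ∀ k < σ.reg y, ∀ τ : Store, (∀ r, r ∉ (loop x y c).regs → τ.reg r = σ.reg r) →
      (∀ a, a ∉ (loop x y c).arrays → ∀ i j, τ.bit a i j = σ.bit a i j) → I k τ →
      I (k + 1) (c.run (τ.setReg x k))) :
    I (σ.reg y) ((loop x y c).run σ) := by
  have key : ∀ k ≤ σ.reg y, I k (rounds c.run x σ k) ∧
      (∀ r, r ∉ (loop x y c).regs → (rounds c.run x σ k).reg r = σ.reg r) ∧
      ∀ a, a ∉ (loop x y c).arrays → ∀ i j, (rounds c.run x σ k).bit a i j = σ.bit a i j := by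
    intro k
    induction k with
    | zero => exact fun _ => ⟨h0, fun _ _ => rfl, fun _ _ _ _ => rfl⟩
    | succ k ih =>
      intro hk
      obtain ⟨h1, h2, h3⟩ := ih (by omega)
      refine ⟨hs k (by omega) _ h2 h3 h1, fun r hr => ?_, fun a ha i j => ?_⟩
      · have hr' := hr
        simp only [regs, List.mem_cons, not_or] at hr'
        rw [rounds, run_reg_of_notMem _ _ hr'.2, Store.setReg_reg, if_neg hr'.1, h2 r hr]
      · rw [rounds, run_bit_of_notMem c _ ha, Store.setReg_bit, h3 a ha]
  exact (key _ le_rfl).1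

/-- An upper bound for the number of steps, if the registers of class `k ≠ 0` hold at most `B k`. -/
def Prog.cost (κ B : ℕ → ℕ) : Prog → ℕ
  | skip => 1
  | zero _ => 1
  | copy _ _ => 1
  | succ _ => 1
  | pred _ => 1
  | store _ _ _ e => e.size + 1
  | seq c d => c.cost κ B + d.cost κ B
  | ite e c d => e.size + 1 + (c.cost κ B + d.cost κ B)
  | loop _ y c => 1 + B (κ y) * (1 + c.cost κ B)

/-- Loops are bounded by registers of class `≠ 0`, and these are never increased except by copying
within a class. -/
def Prog.Tame (κ : ℕ → ℕ) : Prog → Prop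
  | skip => True
  | zero _ => True
  | copy x y => κ x = 0 ∨ κ x = κ y
  | succ x => κ x = 0
  | pred _ => True
  | store _ _ _ _ => True
  | seq c d => c.Tame κ ∧ d.Tame κ
  | ite _ c d => c.Tame κ ∧ d.Tame κ
  | loop x y c => κ x = 0 ∧ κ y ≠ 0 ∧ c.Tame κ

/-- The registers of class `k ≠ 0` hold at most `B k`. -/
def Store.Bounded (κ B : ℕ → ℕ) (σ : Store) : Prop := ∀ r, κ r ≠ 0 → σ.reg r ≤ B (κ r)

theorem Store.Bounded.setReg_of_eq_zero {κ B : ℕ → ℕ} {σ : Store} (h : σ.Bounded κ B) {x : ℕ}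
    (hx : κ x = 0) (v : ℕ) : (σ.setReg x v).Bounded κ B := by
  intro r hr
  rw [Store.setReg_reg, if_neg (by rintro rfl; exact hr hx)]
  exact h r hr

theorem Store.Bounded.setReg_of_le {κ B : ℕ → ℕ} {σ : Store} (h : σ.Bounded κ B) {x v : ℕ}
    (hx : v ≤ B (κ x)) : (σ.setReg x v).Bounded κ B := by
  intro r hr
  rw [Store.setReg_reg]
  split_ifs with h'
  · rwa [h']
  · exact h r hr

/-- Time and register bounds are proved together: a loop count is at most the bound of its
register's class, and no tame instruction breaks a bound. Loop counters have class `0`, so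
overwriting them in each round is harmless. -/
theorem Prog.time_le_cost {κ B : ℕ → ℕ} (c : Prog) {σ : Store} (hσ : σ.Bounded κ B)
    (hc : c.Tame κ) : c.time σ ≤ c.cost κ B ∧ (c.run σ).Bounded κ B := by
  induction c generalizing σ with
  | skip => exact ⟨le_rfl, hσ⟩
  | zero x => exact ⟨le_rfl, hσ.setReg_of_le (Nat.zero_le _)⟩
  | copy x y =>
    refine ⟨le_rfl, ?_⟩
    by_cases hx : κ x = 0
    · exact hσ.setReg_of_eq_zero hx _
    · have hxy : κ x = κ y := hc.resolve_left hx
      refine hσ.setReg_of_le ?_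
      rw [hxy] at hx ⊢
      exact hσ y hx
  | succ x => exact ⟨le_rfl, hσ.setReg_of_eq_zero hc _⟩
  | pred x =>
    refine ⟨le_rfl, ?_⟩
    by_cases hx : κ x = 0
    · exact hσ.setReg_of_eq_zero hx _
    · exact hσ.setReg_of_le ((Nat.sub_le _ _).trans (hσ x hx))
  | store a x y e => exact ⟨le_rfl, hσ⟩
  | seq c d ihc ihd =>
    obtain ⟨h1, h2⟩ := ihc hσ hc.1
    obtain ⟨h3, h4⟩ := ihd h2 hc.2
    exact ⟨Nat.add_le_add h1 h3, h4⟩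
  | ite e c d ihc ihd =>
    obtain ⟨h1, h2⟩ := ihc hσ hc.1
    obtain ⟨h3, h4⟩ := ihd hσ hc.2
    rw [time, cost, run]
    split_ifs
    · exact ⟨by omega, h2⟩
    · exact ⟨by omega, h4⟩
  | loop x y c ih =>
    obtain ⟨hx, hy, hc⟩ := hc
    have key : ∀ k, (rounds c.run x σ k).Bounded κ B := by
      intro k
      induction k with
      | zero => exact hσ
      | succ k ihk => exact (ih (ihk.setReg_of_eq_zero hx k) hc).2
    refine ⟨?_, key _⟩
    rw [time, cost]
    refine Nat.add_le_add_left ?_ 1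
    calc _ ≤ ∑ _k ∈ Finset.range (σ.reg y), (1 + c.cost κ B) :=
          Finset.sum_le_sum fun k _ =>
            Nat.add_le_add_left (ih ((key k).setReg_of_eq_zero hx k) hc).1 1
      _ = σ.reg y * (1 + c.cost κ B) := by rw [Finset.sum_const, Finset.card_range, smul_eq_mul]
      _ ≤ _ := Nat.mul_le_mul_right _ (hσ y hy)

infixr:60 " ;; " => Prog.seq

/-! ### Bit sequences and numbers -/

/-- The weighted sum of the first `M` bits of `b`. -/
def bitSum (w : ℕ → ℕ) (b : ℕ → Bool) (M : ℕ) : ℕ := ∑ u ∈ Finset.range M, (b u).toNat * w u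

/-- Stated with the old and new contributions on opposite sides, which avoids truncated subtraction.
-/
theorem bitSum_update (w : ℕ → ℕ) (b b' : ℕ → Bool) {M p : ℕ} (hp : p < M)
    (h : ∀ u, u ≠ p → b' u = b u) :
    bitSum w b' M + (b p).toNat * w p = bitSum w b M + (b' p).toNat * w p := by
  have hp' := Finset.mem_range.2 hp
  rw [bitSum, bitSum, ← Finset.sum_erase_add _ _ hp', ← Finset.sum_erase_add _ _ hp',
    Finset.sum_congr rfl fun u hu => by rw [h u (Finset.ne_of_mem_erase hu)]]
  ring

theorem bitSum_succ (w : ℕ → ℕ) (b : ℕ → Bool) (M : ℕ) :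
    bitSum w b (M + 1) = bitSum w b M + (b M).toNat * w M := Finset.sum_range_succ _ _

theorem bitSum_lt (b : ℕ → Bool) (M : ℕ) : bitSum (fun u => 2 ^ u) b M < 2 ^ M := by
  induction M with
  | zero => simp [bitSum]
  | succ M ih =>
    rw [bitSum_succ, pow_succ]
    have : (b M).toNat * 2 ^ M ≤ 2 ^ M := by
      have h := Bool.toNat_le (b M)
      calc _ ≤ 1 * 2 ^ M := Nat.mul_le_mul_right _ h
        _ = _ := one_mul _
    omega

theorem testBit_bitSum (b : ℕ → Bool) {M u : ℕ} (hu : u < M) :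
    (bitSum (fun u => 2 ^ u) b M).testBit u = b u := by
  induction M with
  | zero => omega
  | succ M ih =>
    rw [bitSum_succ, add_comm, mul_comm, Nat.testBit_two_pow_mul_add _ (bitSum_lt b M)]
    split_ifs with h
    · exact ih h
    · obtain rfl : u = M := by omega
      rw [Nat.sub_self]
      cases b u <;> rfl

theorem bitSum_one_le (b : ℕ → Bool) (M : ℕ) : bitSum (fun _ => 1) b M ≤ M := by
  rw [bitSum]
  calc _ ≤ ∑ _u ∈ Finset.range M, 1 := Finset.sum_le_sum fun u _ => by
        simpa using Bool.toNat_le (b u)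
    _ = M := by simp

/-- The carry of an addition of three bits. -/
def majority (a x c : Bool) : Bool := (a && x) ^^ (c && (a ^^ x))

theorem full_adder (a x c : Bool) :
    a.toNat + x.toNat + c.toNat = (a ^^ x ^^ c).toNat + 2 * (majority a x c).toNat := by
  cases a <;> cases x <;> cases c <;> rfl

theorem div_two_pow_succ (x t : ℕ) :
    x / 2 ^ t = (x.testBit t).toNat + 2 * (x / 2 ^ (t + 1)) := by
  have h : (x.testBit t).toNat = x / 2 ^ t % 2 := by
    rw [Nat.testBit_eq_decide_div_mod_eq]
    rcases Nat.mod_two_eq_zero_or_one (x / 2 ^ t) with h | h <;> simp [h]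
  rw [h, pow_succ, ← Nat.div_div_eq_div_mul]
  omega

/-- One step of the bitwise comparison of `q + x + c` with `z`. -/
theorem carry_step {q x z t : ℕ} {c : Bool}
    (h : q / 2 ^ t + x / 2 ^ t + c.toNat = z / 2 ^ t) :
    (q.testBit t ^^ x.testBit t ^^ c) = z.testBit t ∧
      q / 2 ^ (t + 1) + x / 2 ^ (t + 1) + (majority (q.testBit t) (x.testBit t) c).toNat =
        z / 2 ^ (t + 1) := by
  have h1 := full_adder (q.testBit t) (x.testBit t) c
  rw [div_two_pow_succ q, div_two_pow_succ x, div_two_pow_succ z] at h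
  generalize (q.testBit t ^^ x.testBit t ^^ c) = s at h1 ⊢
  generalize majority (q.testBit t) (x.testBit t) c = c' at h1 ⊢
  generalize z.testBit t = y at h ⊢
  have hs := Bool.toNat_le s
  have hy := Bool.toNat_le y
  have hsy : s.toNat = y.toNat := by omega
  exact ⟨by revert hsy; cases s <;> cases y <;> simp, by omega⟩

/-! ### Subprograms -/

/-- The expression for the carry of an addition of three bits. -/
def majExp (a x c : BitExp) : BitExp := .xor (.and a x) (.and c (.xor a x))

@[simp] theorem eval_majExp (a x c : BitExp) (σ : Store) :
    (majExp a x c).eval σ = majority (a.eval σ) (x.eval σ) (c.eval σ) := rfl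

/-- One round of the cyclic addition in `remProg`. -/
def remBody : Prog :=
  .store 7 4 5 (majExp (.cell 0 14 15) (.cell 0 20 16) (.cell 7 4 4)) ;;
  .store 0 14 15 (.xor (.xor (.cell 0 14 15) (.cell 0 20 16)) (.cell 7 4 4)) ;;
  .store 7 4 4 (.cell 7 4 5) ;; .succ 15 ;; .succ 16 ;; .ite (.lt 15 7) .skip (.zero 15)

/-- Row `reg 14` of array `0` receives `x mod (4^m - 1) + 1`, where `x` is the number whose bits
are in row `reg 20` from position `reg 6` on, and `reg 7 = 2m`. -/
def remProg : Prog :=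
  .zero 15 ;; .copy 16 6 ;; .store 7 4 4 (.const true) ;; .loop 21 3 remBody

/-- The invariant of the cyclic addition. -/
structure RemInv (σ : Store) (m x T t : ℕ) (τ : Store) : Prop where
  ptr : τ.reg 15 < 2 * m
  src : τ.reg 16 = σ.reg 6 + t
  rows : ∀ i, i ≠ σ.reg 14 → ∀ q, τ.bit 0 i q = σ.bit 0 i q
  high : ∀ q, 2 * m ≤ q → τ.bit 0 (σ.reg 14) q = false
  pos : 0 < bitSum (fun u => 2 ^ u) (τ.bit 0 (σ.reg 14)) (2 * m) +
    (τ.bit 7 0 0).toNat * 2 ^ τ.reg 15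
  cong : bitSum (fun u => 2 ^ u) (τ.bit 0 (σ.reg 14)) (2 * m) +
    ((τ.bit 7 0 0).toNat + x / 2 ^ t) * 2 ^ τ.reg 15 ≡ x + 1 [MOD 4 ^ m - 1]
  carry : τ.bit 7 0 0 = true → T ≤ t →
    bitSum (fun _ => 1) (τ.bit 0 (σ.reg 14)) (2 * m) + (t - T) ≤ 2 * m

theorem remBody_run {τ : Store} (h4 : τ.reg 4 = 0) (h5 : τ.reg 5 = 1) :
    (remBody.run τ).reg 15 = (if τ.reg 15 + 1 < τ.reg 7 then τ.reg 15 + 1 else 0) ∧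
    (remBody.run τ).reg 16 = τ.reg 16 + 1 ∧
    (remBody.run τ).bit 7 0 0 = majority (τ.bit 0 (τ.reg 14) (τ.reg 15))
      (τ.bit 0 (τ.reg 20) (τ.reg 16)) (τ.bit 7 0 0) ∧
    ∀ i q, (remBody.run τ).bit 0 i q = if i = τ.reg 14 ∧ q = τ.reg 15 then
      (τ.bit 0 (τ.reg 14) (τ.reg 15) ^^ τ.bit 0 (τ.reg 20) (τ.reg 16) ^^ τ.bit 7 0 0)
      else τ.bit 0 i q := by
  by_cases h : τ.reg 15 + 1 < τ.reg 7 <;> simp [remBody, h4, h5, h]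

/-- Adding one bit keeps the sum of the cells, the carry and the unread part of `x` unchanged as a
number. When the pointer wraps around, the weight `2^(2m)` is replaced by `1`, which changes nothing
modulo `4^m - 1`. -/
theorem RemInv.step {σ τ τ' : Store} {m x T t : ℕ} (h : RemInv σ m x T t τ) (hm : 0 < m)
    (hT : x < 2 ^ T) (hne : σ.reg 20 ≠ σ.reg 14)
    (hx : ∀ u, σ.bit 0 (σ.reg 20) (σ.reg 6 + u) = x.testBit u)
    (h15 : τ'.reg 15 = (if τ.reg 15 + 1 < 2 * m then τ.reg 15 + 1 else 0))
    (h16 : τ'.reg 16 = τ.reg 16 + 1)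
    (h7 : τ'.bit 7 0 0 = majority (τ.bit 0 (σ.reg 14) (τ.reg 15))
      (τ.bit 0 (σ.reg 20) (τ.reg 16)) (τ.bit 7 0 0))
    (h0 : ∀ i q, τ'.bit 0 i q = if i = σ.reg 14 ∧ q = τ.reg 15 then
      (τ.bit 0 (σ.reg 14) (τ.reg 15) ^^ τ.bit 0 (σ.reg 20) (τ.reg 16) ^^ τ.bit 7 0 0)
      else τ.bit 0 i q) : RemInv σ m x T (t + 1) τ' := by
  have hb : τ.bit 0 (σ.reg 20) (τ.reg 16) = x.testBit t := by
    rw [h.rows _ hne, h.src, hx]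
  rw [hb] at h7
  simp only [hb] at h0
  have hp := h.ptr
  have hsrc := h.src
  have hrows := h.rows
  have hhigh := h.high
  have hpos := h.pos
  have hcong := h.cong
  have hcarry := h.carry
  set p := τ.reg 15
  set a := τ.bit 0 (σ.reg 14) p
  set c := τ.bit 7 0 0
  set V := bitSum (fun u => 2 ^ u) (τ.bit 0 (σ.reg 14)) (2 * m) with hV
  set V' := bitSum (fun u => 2 ^ u) (τ'.bit 0 (σ.reg 14)) (2 * m) with hV'
  have hup : ∀ u, u ≠ p → τ'.bit 0 (σ.reg 14) u = τ.bit 0 (σ.reg 14) u := by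
    intro u hu
    rw [h0, if_neg (by simp [hu])]
  have hnew : τ'.bit 0 (σ.reg 14) p = (a ^^ x.testBit t ^^ c) := by
    rw [h0, if_pos ⟨rfl, rfl⟩]
  have hfa := full_adder a (x.testBit t) c
  have hsum := bitSum_update (fun u => 2 ^ u) _ _ hp hup
  have hone := bitSum_update (fun _ => 1) _ _ hp hup
  rw [hnew, ← hV, ← hV'] at hsum
  rw [hnew] at hone
  simp only [mul_one] at hsum hone
  have hdiv := div_two_pow_succ x t
  rw [← h7] at hfa
  have hc'0 : 0 ≤ (τ'.bit 7 0 0).toNat := Nat.zero_le _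
  -- the represented number
  have hval : V' + ((τ'.bit 7 0 0).toNat + x / 2 ^ (t + 1)) * 2 ^ (p + 1) =
      V + (c.toNat + x / 2 ^ t) * 2 ^ p := by
    rw [hdiv]
    have h1 := congrArg (· * 2 ^ p) hfa
    simp only [add_mul] at h1
    rw [pow_succ]
    linear_combination hsum - h1
  -- Positivity is tracked without the unread bits of `x`: the cells and the carry can only gain
  -- from a new bit.
  have hval' : 0 < V' + (τ'.bit 7 0 0).toNat * 2 ^ (p + 1) := by
    have h1 := congrArg (· * 2 ^ p) hfa
    simp only [add_mul] at h1
    have h2 : V' + (τ'.bit 7 0 0).toNat * 2 ^ (p + 1) =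
        V + c.toNat * 2 ^ p + (x.testBit t).toNat * 2 ^ p := by
      rw [pow_succ]
      linear_combination hsum - h1
    omega
  refine ⟨?_, ?_, ?_, ?_, ?_, ?_, ?_⟩
  · rw [h15]; split_ifs <;> omega
  · rw [h16, hsrc, add_assoc]
  · intro i hi q
    rw [h0, if_neg (by simp [hi]), hrows i hi]
  · intro q hq
    rw [hup q (by omega), hhigh q hq]
  · rw [h15]
    split_ifs with hlt
    · exact hval'
    · rw [pow_zero, mul_one]
      by_contra h'
      have h2 : V' = 0 ∧ (τ'.bit 7 0 0).toNat = 0 := by omega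
      rw [h2.1, h2.2] at hval'
      simp at hval'
  · rw [h15]
    split_ifs with hlt
    · rw [hval]; exact hcong
    · refine Nat.ModEq.trans ?_ hcong
      rw [← hval, show p + 1 = 2 * m by omega, ← four_pow_eq]
      refine Nat.ModEq.add_left _ (Nat.ModEq.mul_left _ ?_)
      rw [pow_zero]
      have h4 := four_le_four_pow hm
      refine (Nat.modEq_iff_dvd' (by omega)).2 dvd_rfl
  -- Beyond the bits of `x`, an outgoing carry requires an incoming carry and a set cell, and it
  -- clears that cell. The number of set cells thus pays for the further rounds.
  · intro hc ht
    have hle := bitSum_one_le (τ'.bit 0 (σ.reg 14)) (2 * m)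
    by_cases htT : T = t + 1
    · omega
    have htT' : T ≤ t := by omega
    have hx0 : x.testBit t = false :=
      Nat.testBit_lt_two_pow (hT.trans_le (Nat.pow_le_pow_right (by omega) htT'))
    rw [hc, hx0] at hfa
    rw [hx0] at hone
    have hca : c = true ∧ a = true := by
      revert hfa
      cases a <;> cases c <;> simp
    have := hcarry hca.1 htT'
    have ha : τ.bit 0 (σ.reg 14) p = true := hca.2
    rw [hca.1, hca.2, ha] at hone
    simp at hone
    omega

/-- After the `T` bits of `x`, a carry survives at most `2m` rounds, so it is gone at the end. The
cells then hold a number between `1` and `4^m - 1` congruent to `x + 1`. Positivity selects the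
representative `4^m - 1` in place of `0`, and this is the remainder plus one. -/
theorem remProg_run {σ : Store} {m x T : ℕ} (h4 : σ.reg 4 = 0) (h5 : σ.reg 5 = 1)
    (h7 : σ.reg 7 = 2 * m) (hm : 0 < m) (hT : x < 2 ^ T) (hL : T + 2 * m + 1 ≤ σ.reg 3)
    (hne : σ.reg 20 ≠ σ.reg 14) (hz : ∀ q, σ.bit 0 (σ.reg 14) q = false)
    (hx : ∀ u, σ.bit 0 (σ.reg 20) (σ.reg 6 + u) = x.testBit u) :
    (∀ i, i ≠ σ.reg 14 → ∀ q, (remProg.run σ).bit 0 i q = σ.bit 0 i q) ∧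
    ∀ q, (remProg.run σ).bit 0 (σ.reg 14) q = (x % (4 ^ m - 1) + 1).testBit q := by
  set σ₁ := (Prog.zero 15 ;; .copy 16 6 ;; .store 7 4 4 (.const true)).run σ with hσ₁
  have hrun : remProg.run σ = (Prog.loop 21 3 remBody).run σ₁ := rfl
  have hr : ∀ r, r ≠ 15 → r ≠ 16 → σ₁.reg r = σ.reg r := by
    intro r h15 h16
    simp [hσ₁, h15, h16]
  have hb0 : ∀ i q, σ₁.bit 0 i q = σ.bit 0 i q := by simp [hσ₁]
  have hc1 : σ₁.bit 7 0 0 = true := by simp [hσ₁, h4]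
  have key : RemInv σ m x T (σ₁.reg 3) ((Prog.loop 21 3 remBody).run σ₁) := by
    refine Prog.loop_invariant (RemInv σ m x T) ?_ ?_
    · have h15 : σ₁.reg 15 = 0 := by simp [hσ₁]
      have h16 : σ₁.reg 16 = σ.reg 6 := by simp [hσ₁]
      have hs : ∀ w, bitSum w (σ₁.bit 0 (σ.reg 14)) (2 * m) = 0 := fun w =>
        Finset.sum_eq_zero fun u _ => by rw [hb0, hz]; simp
      refine ⟨by omega, h16, fun i _ q => hb0 i q, fun q _ => by rw [hb0, hz], ?_, ?_, ?_⟩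
      · rw [hs, hc1, h15]; simp
      · rw [hs, hc1, h15]; simp [add_comm 1]; rfl
      · intro _ h; rw [hs]; omega
    · intro k hk τ hreg hbit hI
      have hreg' : ∀ r, r ∉ [15, 16, 21] → τ.reg r = σ.reg r := by
        intro r hr'
        simp only [List.mem_cons, List.not_mem_nil, or_false, not_or] at hr'
        rw [hreg r (by simp [Prog.regs, remBody, hr']), hr r hr'.1 hr'.2.1]
      have e4 := hreg' 4 (by decide)
      have e5 := hreg' 5 (by decide)
      have e7 := hreg' 7 (by decide)
      have e14 := hreg' 14 (by decide)
      have e20 := hreg' 20 (by decide)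
      obtain ⟨f1, f2, f3, f4⟩ := remBody_run (τ := τ.setReg 21 k) (by simp [e4, h4])
        (by simp [e5, h5])
      simp only [Store.setReg_reg, Store.setReg_bit, e7, e14, e20, h7] at f1 f2 f3 f4
      exact hI.step hm hT hne hx (by simpa using f1) (by simpa using f2) (by simpa using f3)
        (by simpa using f4)
  rw [hr 3 (by decide) (by decide)] at key
  rw [← hrun] at key
  refine ⟨key.rows, ?_⟩
  have hx0 : x / 2 ^ σ.reg 3 = 0 :=
    Nat.div_eq_of_lt (hT.trans_le (Nat.pow_le_pow_right (by omega) (by omega)))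
  have hc0 : (remProg.run σ).bit 7 0 0 = false := by
    by_contra h
    have := key.carry (by simpa using h) (by omega)
    omega
  have hpos := key.pos
  have hcong := key.cong
  rw [hc0] at hpos hcong
  rw [hx0] at hcong
  simp only [Bool.toNat_false, zero_mul, add_zero] at hpos hcong
  have hlt := bitSum_lt ((remProg.run σ).bit 0 (σ.reg 14)) (2 * m)
  have hlt' := mod_add_one_lt hm x
  have hB := four_le_four_pow hm
  rw [← four_pow_eq] at hlt hlt'
  have heq : bitSum (fun u => 2 ^ u) ((remProg.run σ).bit 0 (σ.reg 14)) (2 * m) =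
      x % (4 ^ m - 1) + 1 := by
    set V := bitSum (fun u => 2 ^ u) ((remProg.run σ).bit 0 (σ.reg 14)) (2 * m)
    obtain ⟨V', hV'⟩ := Nat.exists_eq_add_of_lt hpos
    rw [zero_add] at hV'
    rw [hV'] at hcong
    -- Removing the common summand `1` leaves a number below the modulus, which must be the
    -- remainder of `x`.
    have h1 := Nat.ModEq.add_right_cancel' 1 hcong
    have h2 : V' % (4 ^ m - 1) = V' := Nat.mod_eq_of_lt (by omega)
    rw [Nat.ModEq, h2] at h1
    omega
  intro q
  by_cases hq : q < 2 * m
  · rw [← heq, testBit_bitSum _ hq]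
  · rw [key.high q (by omega), Nat.testBit_lt_two_pow ((mod_add_one_lt hm x).trans_le
      (Nat.pow_le_pow_right (by omega) (by omega)))]

/-- One round of the subtraction in `quotProg`. -/
def quotBody : Prog :=
  .store 0 14 17 (.xor (.xor (.cell 0 14 21) (.cell 0 20 16)) (.cell 7 4 4)) ;;
  .store 7 4 4 (majExp (.cell 0 14 17) (.cell 0 20 16) (.cell 7 4 4)) ;; .succ 16 ;; .succ 17

/-- Row `reg 14` of array `0`, which holds `x mod (4^m - 1) + 1`, is completed to `levelNum m x`,
where `x` is the number in row `reg 20` from position `reg 6` on, and `reg 7 = 2m`. -/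
def quotProg : Prog :=
  .copy 16 6 ;; .copy 17 7 ;; .store 7 4 4 (.const true) ;; .loop 21 3 quotBody

theorem quotBody_run {τ : Store} (h4 : τ.reg 4 = 0) :
    (quotBody.run τ).reg 16 = τ.reg 16 + 1 ∧
    (quotBody.run τ).reg 17 = τ.reg 17 + 1 ∧
    (quotBody.run τ).bit 7 0 0 = majority
      (τ.bit 0 (τ.reg 14) (τ.reg 21) ^^ τ.bit 0 (τ.reg 20) (τ.reg 16) ^^ τ.bit 7 0 0)
      (if τ.reg 20 = τ.reg 14 ∧ τ.reg 16 = τ.reg 17 then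
        (τ.bit 0 (τ.reg 14) (τ.reg 21) ^^ τ.bit 0 (τ.reg 20) (τ.reg 16) ^^ τ.bit 7 0 0)
        else τ.bit 0 (τ.reg 20) (τ.reg 16)) (τ.bit 7 0 0) ∧
    ∀ i q, (quotBody.run τ).bit 0 i q = if i = τ.reg 14 ∧ q = τ.reg 17 then
      (τ.bit 0 (τ.reg 14) (τ.reg 21) ^^ τ.bit 0 (τ.reg 20) (τ.reg 16) ^^ τ.bit 7 0 0)
      else τ.bit 0 i q := by
  simp [quotBody, h4]

/-- In `y + x + 1 = z` the initial carry supplies the `1`. Bit `k` of `y` is the exclusive or of bit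
`k` of `z`, bit `k` of `x` and the carry, and it is bit `2m + k` of `z`. Writing therefore runs `2m`
positions ahead of reading, and the low `2m` bits from `remProg` start the process. -/
theorem quotProg_run {σ : Store} {m x : ℕ} (h4 : σ.reg 4 = 0)
    (h7 : σ.reg 7 = 2 * m) (hm : 0 < m) (hL : x < 2 ^ σ.reg 3)
    (hne : σ.reg 20 ≠ σ.reg 14)
    (hz : ∀ q, σ.bit 0 (σ.reg 14) q = (x % (4 ^ m - 1) + 1).testBit q)
    (hx : ∀ u, σ.bit 0 (σ.reg 20) (σ.reg 6 + u) = x.testBit u) :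
    (∀ i, i ≠ σ.reg 14 → ∀ q, (quotProg.run σ).bit 0 i q = σ.bit 0 i q) ∧
    ∀ q, (quotProg.run σ).bit 0 (σ.reg 14) q = (levelNum m x).testBit q := by
  set σ₁ := (Prog.copy 16 6 ;; .copy 17 7 ;; .store 7 4 4 (.const true)).run σ with hσ₁
  have hrun : quotProg.run σ = (Prog.loop 21 3 quotBody).run σ₁ := rfl
  have hr : ∀ r, r ≠ 16 → r ≠ 17 → σ₁.reg r = σ.reg r := by
    intro r h15 h16
    simp [hσ₁, h15, h16]
  have hb0 : ∀ i q, σ₁.bit 0 i q = σ.bit 0 i q := by simp [hσ₁]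
  set z := levelNum m x with hzdef
  set y := x / (4 ^ m - 1) with hy
  have hzlow : ∀ q < 2 * m, (x % (4 ^ m - 1) + 1).testBit q = z.testBit q := fun q hq =>
    (levelNum_testBit_low hm x hq).symm
  have hzhigh : ∀ q, z.testBit (2 * m + q) = y.testBit q := levelNum_testBit_high hm x
  have key := Prog.loop_invariant (x := 21) (y := 3) (c := quotBody) (σ := σ₁)
    (fun t (τ : Store) => τ.reg 16 = σ.reg 6 + t ∧ τ.reg 17 = 2 * m + t ∧
      y / 2 ^ t + x / 2 ^ t + (τ.bit 7 0 0).toNat = z / 2 ^ t ∧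
      (∀ i, i ≠ σ.reg 14 → ∀ q, τ.bit 0 i q = σ.bit 0 i q) ∧
      ∀ q, τ.bit 0 (σ.reg 14) q = if q < 2 * m + t then z.testBit q else false)
    (by
      refine ⟨by simp [hσ₁], by simp [hσ₁, h7], ?_, fun i _ q => hb0 i q, fun q => ?_⟩
      · have hc1 : σ₁.bit 7 0 0 = true := by simp [hσ₁, h4]
        rw [hc1, pow_zero, Nat.div_one, Nat.div_one, Nat.div_one, hzdef, levelNum_eq hm]
        rfl
      · rw [hb0, hz]
        split_ifs with hq
        · exact hzlow q hq
        · exact Nat.testBit_lt_two_pow ((mod_add_one_lt hm x).trans_le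
            (Nat.pow_le_pow_right (by omega) (by omega))))
    (by
      rintro k hk τ hreg - ⟨h16, h17, hc, hrows, hrow⟩
      have hreg' : ∀ r, r ∉ [16, 17, 21] → τ.reg r = σ.reg r := by
        intro r hr'
        simp only [List.mem_cons, List.not_mem_nil, or_false, not_or] at hr'
        rw [hreg r (by simp [Prog.regs, quotBody, hr']), hr r hr'.1 hr'.2.1]
      have e4 := hreg' 4 (by decide)
      have e14 := hreg' 14 (by decide)
      have e20 := hreg' 20 (by decide)
      obtain ⟨f1, f2, f3, f4⟩ := quotBody_run (τ := τ.setReg 21 k) (by simp [e4, h4])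
      simp [e14, e20, h16, h17, hne, hrows _ hne, hx, hrow,
        show k < 2 * m + k by omega] at f1 f2 f3 f4
      obtain ⟨g1, g2⟩ := carry_step hc
      have g3 : (z.testBit k != (x.testBit k != τ.bit 7 0 0)) = y.testBit k := by
        rw [← g1]
        generalize y.testBit k = a
        generalize x.testBit k = b
        generalize τ.bit 7 0 0 = c
        revert a b c
        decide
      refine ⟨by rw [f1]; ring, by rw [f2]; ring, ?_, ?_, ?_⟩
      · rw [f3, g3]
        exact g2
      · intro i hi q
        rw [f4, if_neg (by simp [hi]), hrows i hi]
      · intro q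
        rw [f4]
        by_cases hq : q = 2 * m + k
        · subst hq
          rw [if_pos ⟨rfl, rfl⟩, if_pos (by omega), g3, hzhigh]
        · rw [if_neg (by simp [hq]), hrow]
          exact if_congr (by omega) rfl rfl)
  rw [← hrun, hr 3 (by decide) (by decide)] at key
  obtain ⟨-, -, -, hrows, hrow⟩ := key
  refine ⟨hrows, fun q => ?_⟩
  rw [hrow]
  split_ifs with hq
  · rfl
  · symm
    -- One pass over `reg 3` positions suffices, since `z` has no bits beyond those written.
    have h1 : z < 2 ^ (2 * m + σ.reg 3) := by
      have h2 : y ≤ x := Nat.div_le_self _ _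
      have h3 : 2 ^ σ.reg 3 * 2 ≤ 2 ^ σ.reg 3 * 2 ^ (2 * m) :=
        Nat.mul_le_mul_left _ (Nat.le_self_pow (by omega) 2)
      have h4 := levelNum_eq hm x
      rw [← hzdef, ← hy] at h4
      rw [add_comm (2 * m), pow_add]
      omega
    exact Nat.testBit_lt_two_pow (h1.trans_le (Nat.pow_le_pow_right (by omega) (by omega)))

/-! ### The transvection vectors of a level -/

/-- One round of the search in `partnerProg`. -/
def partnerBody : Prog :=
  .copy 24 18 ;; .succ 24 ;; .ite (.cell 0 14 18) (.copy 19 24) .skip ;;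
  .ite (.cell 0 14 24) (.copy 19 18) .skip ;; .succ 18 ;; .succ 18

/-- Register `19` receives `partner m b`, where `b` is in row `reg 14` of array `0` and
`reg 23 = m`. -/
def partnerProg : Prog :=
  .zero 18 ;; .zero 19 ;; .loop 22 23 partnerBody ;; .ite (.cell 0 14 4) (.copy 19 5) .skip

theorem partnerBody_run (τ : Store) :
    (partnerBody.run τ).reg 18 = τ.reg 18 + 2 ∧
    (partnerBody.run τ).reg 19 = if τ.bit 0 (τ.reg 14) (τ.reg 18 + 1) then τ.reg 18 else
      if τ.bit 0 (τ.reg 14) (τ.reg 18) then τ.reg 18 + 1 else τ.reg 19 := by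
  by_cases h1 : τ.bit 0 (τ.reg 14) (τ.reg 18) = true <;>
    by_cases h2 : τ.bit 0 (τ.reg 14) (τ.reg 18 + 1) = true <;>
    simp [partnerBody, h1, h2]

/-- The scan goes upwards and later writes overwrite earlier ones, so the last set index wins as in
`lastPartner`; the case where bit `0` is set overrides everything at the end. -/
theorem partnerProg_run {σ : Store} (h4 : σ.reg 4 = 0) (h5 : σ.reg 5 = 1) :
    (partnerProg.run σ).reg 19 = partner (σ.reg 23) (σ.bit 0 (σ.reg 14)) := by
  set σ₁ := (Prog.zero 18 ;; .zero 19).run σ with hσ₁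
  have hrun : partnerProg.run σ = (Prog.ite (.cell 0 14 4) (.copy 19 5) .skip).run
    ((Prog.loop 22 23 partnerBody).run σ₁) := rfl
  have key := Prog.loop_invariant (x := 22) (y := 23) (c := partnerBody) (σ := σ₁)
    (fun k (τ : Store) => τ.reg 18 = 2 * k ∧ τ.reg 19 = lastPartner (σ.bit 0 (σ.reg 14)) k)
    (by simp [hσ₁, lastPartner])
    (by
      rintro k - τ hreg hbit ⟨h18, h19⟩
      have e14 : τ.reg 14 = σ.reg 14 := by
        rw [hreg 14 (by decide)]; simp [hσ₁]
      have hb : τ.bit 0 = σ.bit 0 := by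
        ext i j
        rw [hbit 0 (by decide)]; simp [hσ₁]
      obtain ⟨f1, f2⟩ := partnerBody_run (τ.setReg 22 k)
      simp [e14, hb, h18, h19] at f1 f2
      exact ⟨f1, f2⟩)
  have e23 : σ₁.reg 23 = σ.reg 23 := by simp [hσ₁]
  rw [e23] at key
  rw [hrun]
  set τ := (Prog.loop 22 23 partnerBody).run σ₁ with hτ
  have e : ∀ r, r ∉ [18, 19, 22, 24] → τ.reg r = σ.reg r := by
    intro r hr
    simp only [List.mem_cons, List.not_mem_nil, or_false, not_or] at hr
    rw [hτ, Prog.run_reg_of_notMem _ _ (by simp [Prog.regs, partnerBody, hr])]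
    simp [hσ₁, hr]
  have hb : τ.bit 0 = σ.bit 0 := by
    ext i j
    rw [hτ, Prog.run_bit_of_notMem _ _ (by decide)]; simp [hσ₁]
  rw [partner]
  by_cases h : σ.bit 0 (σ.reg 14) 0 = true
  · simp [e 14 (by decide), e 4 (by decide), e 5 (by decide), hb, h, h4, h5]
  · simp [e 14 (by decide), e 4 (by decide), hb, h, h4, key.2]

/-- The bits of the auxiliary vector, as an expression. -/
def auxExp : BitExp :=
  .xor (.and (.cell 0 14 5) (.cell 0 14 22))
    (.and (.not (.cell 0 14 5)) (.not (.and (.not (.and (.not (.lt 22 5)) (.not (.lt 5 22))))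
      (.not (.and (.not (.lt 22 19)) (.not (.lt 19 22)))))))

/-- Expressions have only the comparison `lt`, so equality of registers is the absence of both
strict inequalities, and disjunction is obtained by De Morgan. -/
theorem eval_auxExp {τ : Store} (h5 : τ.reg 5 = 1) : auxExp.eval τ =
    auxBit (τ.reg 19) (τ.bit 0 (τ.reg 14)) (τ.reg 22) := by
  have h : ∀ a b : ℕ, (!decide (a < b) && !decide (b < a)) = decide (a = b) := by
    intro a b
    by_cases h1 : a < b
    · simp [h1, h1.ne]
    · by_cases h2 : b < a
      · simp [h2, h2.ne']
      · simp [show a = b by omega]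
  simp only [auxExp, BitExp.eval, h5, h, auxBit]
  cases τ.bit 0 (τ.reg 14) 1 <;> simp

/-- One round of `levelProg`. -/
def levelBody : Prog :=
  .store 3 25 16 (.xor (.cell 0 14 22) auxExp) ;;
  .store 3 26 16 (.xor (.not (.lt 4 22)) auxExp) ;;
  .store 3 27 16 (.not (.and (.lt 4 22) (.not (.and (.lt 5 22) (.cell 0 14 17))))) ;;
  .store 3 28 16 (.and (.not (.lt 4 22)) (.cell 0 14 7)) ;; .succ 16 ;; .succ 17

/-- The rows `reg 25, …, reg 28` of array `3` receive the vectors of the level that is described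
by row `reg 14` of array `0`; `reg 7 = 2m` and `reg 8` is the position where the level starts. -/
def levelProg : Prog :=
  .copy 16 8 ;; .copy 17 7 ;; .pred 17 ;; .loop 22 7 levelBody

theorem levelBody_run {τ : Store} {R : ℕ} (h4 : τ.reg 4 = 0) (h5 : τ.reg 5 = 1)
    (h25 : τ.reg 25 = R) (h26 : τ.reg 26 = R + 1) (h27 : τ.reg 27 = R + 2)
    (h28 : τ.reg 28 = R + 3) :
    (levelBody.run τ).reg 16 = τ.reg 16 + 1 ∧ (levelBody.run τ).reg 17 = τ.reg 17 + 1 ∧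
    (∀ q, (levelBody.run τ).bit 3 R q = if q = τ.reg 16 then
      τ.bit 0 (τ.reg 14) (τ.reg 22) ^^
        auxBit (τ.reg 19) (τ.bit 0 (τ.reg 14)) (τ.reg 22) else τ.bit 3 R q) ∧
    (∀ q, (levelBody.run τ).bit 3 (R + 1) q = if q = τ.reg 16 then
      decide (τ.reg 22 = 0) ^^
        auxBit (τ.reg 19) (τ.bit 0 (τ.reg 14)) (τ.reg 22) else τ.bit 3 (R + 1) q) ∧
    (∀ q, (levelBody.run τ).bit 3 (R + 2) q = if q = τ.reg 16 then
      decide (τ.reg 22 = 0) || (!decide (τ.reg 22 < 2) && τ.bit 0 (τ.reg 14) (τ.reg 17))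
        else τ.bit 3 (R + 2) q) ∧
    (∀ q, (levelBody.run τ).bit 3 (R + 3) q = if q = τ.reg 16 then
      decide (τ.reg 22 = 0) && τ.bit 0 (τ.reg 14) (τ.reg 7) else τ.bit 3 (R + 3) q) ∧
    ∀ i, ¬(R ≤ i ∧ i < R + 4) → ∀ q, (levelBody.run τ).bit 3 i q = τ.bit 3 i q := by
  have haux : ∀ τ' : Store, τ'.reg = τ.reg → τ'.bit 0 = τ.bit 0 →
      auxExp.eval τ' = auxBit (τ.reg 19) (τ.bit 0 (τ.reg 14)) (τ.reg 22) := by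
    intro τ' hr hb
    rw [eval_auxExp (by rw [hr, h5]), hr, hb]
  have h0 : (!decide (0 < τ.reg 22)) = decide (τ.reg 22 = 0) := by
    by_cases h : τ.reg 22 = 0
    · simp [h]
    · simp [h, Nat.pos_of_ne_zero h]
  have h1 : decide (0 < τ.reg 22) = !decide (τ.reg 22 = 0) := by rw [← h0, Bool.not_not]
  have h2 : decide (1 < τ.reg 22) = !decide (τ.reg 22 < 2) := by
    by_cases h : 1 < τ.reg 22
    · simp [h]
    · simp [h]; omega
  refine ⟨by simp [levelBody], by simp [levelBody], ?_, ?_, ?_, ?_, ?_⟩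
  · intro q
    simp [levelBody, h25, h26, h27, h28]
    rw [haux _ rfl rfl]
  · intro q
    simp [levelBody, h25, h26, h27, h28, h4]
    rw [haux τ rfl rfl, haux (τ.setBit 3 R (τ.reg 16) _) rfl (by ext i j; simp)]
    simp [Nat.pos_iff_ne_zero]
  · intro q
    simp [levelBody, h25, h26, h27, h28, h4, h5]
    simp [h1, h2]
  · intro q
    simp [levelBody, h25, h26, h27, h28, h4]
    simp [h1]
  · intro i hi q
    have e : ∀ a < 4, i ≠ R + a := fun a ha h => hi (by omega)
    simp [levelBody, h25, h26, h27, h28, e 1 (by omega), e 2 (by omega), e 3 (by omega),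
      show i ≠ R from e 0 (by omega)]

theorem levelProg_run {σ : Store} {m R : ℕ} (h4 : σ.reg 4 = 0) (h5 : σ.reg 5 = 1)
    (h7 : σ.reg 7 = 2 * m)
    (h25 : σ.reg 25 = R) (h26 : σ.reg 26 = R + 1) (h27 : σ.reg 27 = R + 2)
    (h28 : σ.reg 28 = R + 3) :
    (∀ t < 4, ∀ q, (levelProg.run σ).bit 3 (R + t) q =
      if σ.reg 8 ≤ q ∧ q < σ.reg 8 + 2 * m then
        levelBit m (σ.reg 19) (σ.bit 0 (σ.reg 14)) t (q - σ.reg 8) else σ.bit 3 (R + t) q) ∧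
    ∀ i, ¬(R ≤ i ∧ i < R + 4) → ∀ q, (levelProg.run σ).bit 3 i q = σ.bit 3 i q := by
  set σ₁ := (Prog.copy 16 8 ;; .copy 17 7 ;; .pred 17).run σ with hσ₁
  have hrun : levelProg.run σ = (Prog.loop 22 7 levelBody).run σ₁ := rfl
  have hr : ∀ r, r ≠ 16 → r ≠ 17 → σ₁.reg r = σ.reg r := by
    intro r h15 h16
    simp [hσ₁, h15, h16]
  have hb : ∀ a i q, σ₁.bit a i q = σ.bit a i q := by simp [hσ₁]
  have key := Prog.loop_invariant (x := 22) (y := 7) (c := levelBody) (σ := σ₁)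
    (fun k (τ : Store) => τ.reg 16 = σ.reg 8 + k ∧ τ.reg 17 = 2 * m - 1 + k ∧
      (∀ t < 4, ∀ q, τ.bit 3 (R + t) q = if σ.reg 8 ≤ q ∧ q < σ.reg 8 + k then
        levelBit m (σ.reg 19) (σ.bit 0 (σ.reg 14)) t (q - σ.reg 8) else σ.bit 3 (R + t) q) ∧
      ∀ i, ¬(R ≤ i ∧ i < R + 4) → ∀ q, τ.bit 3 i q = σ.bit 3 i q)
    (by
      refine ⟨by simp [hσ₁], by simp [hσ₁, h7], fun t _ q => ?_, fun i _ q => hb 3 i q⟩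
      rw [hb, if_neg (by omega)])
    (by
      rintro k hk τ hreg hbit ⟨h16, h17, hrows, hother⟩
      have e : ∀ r, r ∉ [16, 17, 22] → τ.reg r = σ.reg r := by
        intro r hr'
        simp only [List.mem_cons, List.not_mem_nil, or_false, not_or] at hr'
        rw [hreg r (by simp [Prog.regs, levelBody, hr']), hr r hr'.1 hr'.2.1]
      have hb0 : τ.bit 0 = σ.bit 0 := by
        ext i j
        rw [hbit 0 (by decide), hb]
      obtain ⟨f16, f17, f0, f1, f2, f3, f4⟩ := levelBody_run (τ := τ.setReg 22 k) (R := R)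
        (by simp [e 4 (by decide), h4]) (by simp [e 5 (by decide), h5])
        (by simp [e 25 (by decide), h25]) (by simp [e 26 (by decide), h26])
        (by simp [e 27 (by decide), h27]) (by simp [e 28 (by decide), h28])
      simp only [Store.setReg_reg, Store.setReg_bit, hb0] at f16 f17 f0 f1 f2 f3 f4
      simp only [Nat.reduceEqDiff, if_false, if_true, h16, h17, e 14 (by decide),
        e 19 (by decide), e 7 (by decide), h7] at f16 f17 f0 f1 f2 f3
      have hstep : ∀ t < 4, ∀ q, (levelBody.run (τ.setReg 22 k)).bit 3 (R + t) q =
          if q = σ.reg 8 + k then levelBit m (σ.reg 19) (σ.bit 0 (σ.reg 14)) t k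
          else τ.bit 3 (R + t) q := by
        intro t ht q
        interval_cases t
        · exact f0 q
        · exact f1 q
        · exact f2 q
        · exact f3 q
      refine ⟨f16, f17, fun t ht q => ?_, fun i hi q => ?_⟩
      · rw [hstep t ht, hrows t ht]
        by_cases hq : q = σ.reg 8 + k
        · rw [if_pos hq, if_pos (by omega)]
          congr 1
          omega
        · rw [if_neg hq]
          exact if_congr (by omega) rfl rfl
      · rw [f4 i hi, hother i hi])
  rw [← hrun, hr 7 (by decide) (by decide), h7] at key
  exact ⟨key.2.2.1, key.2.2.2⟩

/-! ### Multiplication of a stored matrix by a transvection -/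

/-- One round of `swapProg`. -/
def swapBody : Prog :=
  .copy 24 18 ;; .succ 24 ;; .store 4 30 18 (.cell 3 30 24) ;; .store 4 30 24 (.cell 3 30 18) ;;
  .succ 18 ;; .succ 18

/-- Row `reg 30` of array `4` receives `J h`, where `h` is in the same row of array `3`. -/
def swapProg : Prog := .zero 18 ;; .loop 22 0 swapBody

@[simp] theorem swapProg_regs : swapProg.regs = [18, 22, 24, 24, 18, 18] := rfl

@[simp] theorem swapProg_arrays : swapProg.arrays = [4, 4] := rfl

theorem swapProg_run (σ : Store) (k : ℕ) (hk : k < σ.reg 0) :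
    (swapProg.run σ).bit 4 (σ.reg 30) (2 * k) = σ.bit 3 (σ.reg 30) (2 * k + 1) ∧
    (swapProg.run σ).bit 4 (σ.reg 30) (2 * k + 1) = σ.bit 3 (σ.reg 30) (2 * k) := by
  set σ₁ := (Prog.zero 18).run σ with hσ₁
  have hrun : swapProg.run σ = (Prog.loop 22 0 swapBody).run σ₁ := rfl
  have key := Prog.loop_invariant (x := 22) (y := 0) (c := swapBody) (σ := σ₁)
    (fun l (τ : Store) => τ.reg 18 = 2 * l ∧ ∀ k < l,
      τ.bit 4 (σ.reg 30) (2 * k) = σ.bit 3 (σ.reg 30) (2 * k + 1) ∧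
      τ.bit 4 (σ.reg 30) (2 * k + 1) = σ.bit 3 (σ.reg 30) (2 * k))
    ⟨by simp [hσ₁], by omega⟩
    (by
      rintro l hl τ hreg hbit ⟨h18, hI⟩
      have e30 : τ.reg 30 = σ.reg 30 := by
        rw [hreg 30 (by decide)]; simp [hσ₁]
      have hb : ∀ i j, τ.bit 3 i j = σ.bit 3 i j := by
        intro i j
        rw [hbit 3 (by decide)]; simp [hσ₁]
      refine ⟨by simp [swapBody, h18]; ring, fun k hk => ?_⟩
      have h1 : 2 * k ≠ 2 * l + 1 := by omega
      have h2 : 2 * k + 1 ≠ 2 * l := by omega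
      by_cases hkl : k = l
      · subst hkl
        simp [swapBody, h18, e30, hb]
      · have h3 := hI k (by omega)
        simp [swapBody, h18, e30, h1, h2, hkl, h3])
  have e0 : σ₁.reg 0 = σ.reg 0 := by simp [hσ₁]
  rw [e0, ← hrun] at key
  exact key.2 k hk

/-- `A := A + (A u) vᵀ` for the matrix in array `A` and the rows `reg 30` of the arrays `u`, `v`. -/
def rankOneProg (A u v : ℕ) : Prog :=
  .loop 31 2 (.store 7 4 4 (.const false) ;;
    .loop 32 2 (.store 7 4 4 (.xor (.cell 7 4 4) (.and (.cell A 31 32) (.cell u 30 32)))) ;;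
    .loop 32 2 (.store A 31 32 (.xor (.cell A 31 32) (.and (.cell 7 4 4) (.cell v 30 32)))))

theorem dotLoop_run {A u : ℕ} {σ : Store} (h4 : σ.reg 4 = 0) (hA : A ≠ 7) (hu : u ≠ 7)
    (h7 : σ.bit 7 0 0 = false) :
    toF2 (((Prog.loop 32 2 (.store 7 4 4 (.xor (.cell 7 4 4)
      (.and (.cell A 31 32) (.cell u 30 32))))).run σ).bit 7 0 0) =
      ∑ p ∈ Finset.range (σ.reg 2),
        toF2 (σ.bit A (σ.reg 31) p) * toF2 (σ.bit u (σ.reg 30) p) := by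
  refine Prog.loop_invariant (fun k (τ : Store) => toF2 (τ.bit 7 0 0) =
      ∑ p ∈ Finset.range k, toF2 (σ.bit A (σ.reg 31) p) * toF2 (σ.bit u (σ.reg 30) p)) ?_ ?_
  · simp [h7]
  · intro k hk τ hreg hbit hI
    rw [Finset.sum_range_succ, ← hI]
    simp only [Prog.regs, List.mem_cons, List.not_mem_nil, or_false] at hreg
    simp only [Prog.arrays, List.mem_cons, List.not_mem_nil, or_false] at hbit
    simp only [Prog.run_store, Store.setReg_reg, hreg 4 (by decide), h4, hreg 31 (by decide),
      hreg 30 (by decide), Store.setBit_bit, Store.setReg_bit, BitExp.eval,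
      hbit A hA, hbit u hu, Nat.reduceEqDiff, if_false, if_true, and_self]
    rw [toF2_xor, toF2_and]

theorem addLoop_run {A v : ℕ} {σ : Store} (h4 : σ.reg 4 = 0) (hA : A ≠ 7)
    (hv : v ≠ A) :
    (∀ i, i ≠ σ.reg 31 → ∀ q, ((Prog.loop 32 2 (.store A 31 32 (.xor (.cell A 31 32)
      (.and (.cell 7 4 4) (.cell v 30 32))))).run σ).bit A i q = σ.bit A i q) ∧
    ∀ q < σ.reg 2, ((Prog.loop 32 2 (.store A 31 32 (.xor (.cell A 31 32)
      (.and (.cell 7 4 4) (.cell v 30 32))))).run σ).bit A (σ.reg 31) q =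
      (σ.bit A (σ.reg 31) q ^^ (σ.bit 7 0 0 && σ.bit v (σ.reg 30) q)) := by
  have key := Prog.loop_invariant (x := 32) (y := 2) (σ := σ)
    (c := .store A 31 32 (.xor (.cell A 31 32) (.and (.cell 7 4 4) (.cell v 30 32))))
    (fun k (τ : Store) => (∀ i, i ≠ σ.reg 31 → ∀ q, τ.bit A i q = σ.bit A i q) ∧
      ∀ q, τ.bit A (σ.reg 31) q = if q < k then
        (σ.bit A (σ.reg 31) q ^^ (σ.bit 7 0 0 && σ.bit v (σ.reg 30) q)) else
        σ.bit A (σ.reg 31) q)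
    (by simp)
    (by
      rintro k hk τ hreg hbit ⟨hI, hI'⟩
      simp only [Prog.regs, List.mem_cons, List.not_mem_nil, or_false] at hreg
      simp only [Prog.arrays, List.mem_cons, List.not_mem_nil, or_false] at hbit
      simp only [Prog.run_store, Store.setReg_reg, hreg 4 (by decide), h4, hreg 31 (by decide),
        hreg 30 (by decide), Store.setBit_bit, Store.setReg_bit, BitExp.eval,
        hbit 7 hA.symm, hbit v hv, Nat.reduceEqDiff, if_false, if_true, true_and]
      refine ⟨fun i hi q => ?_, fun q => ?_⟩
      · rw [if_neg (by simp [hi]), hI i hi]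
      · by_cases hq : q = k
        · subst hq
          rw [if_pos rfl, if_pos (by omega), hI', if_neg (by omega)]
        · rw [if_neg hq, hI']
          exact if_congr (by omega) rfl rfl)
  refine ⟨key.1, fun q hq => ?_⟩
  rw [key.2, if_pos hq]

/-- The new row `i` depends only on the old row `i`. Its dot product with `u` is finished in the
scratch bit before the row is overwritten, so the update can be made in place. -/
theorem rankOneProg_run {A u v : ℕ} {σ : Store} (h4 : σ.reg 4 = 0) (hA : A ≠ 7) (hu : u ≠ 7)
    (hv : v ≠ 7) (hu' : u ≠ A) (hv' : v ≠ A) {i q : ℕ} (hi : i < σ.reg 2) (hq : q < σ.reg 2) :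
    toF2 (((rankOneProg A u v).run σ).bit A i q) = toF2 (σ.bit A i q) +
      (∑ p ∈ Finset.range (σ.reg 2),
        toF2 (σ.bit A i p) * toF2 (σ.bit u (σ.reg 30) p)) * toF2 (σ.bit v (σ.reg 30) q) := by
  have key := Prog.loop_invariant (x := 31) (y := 2) (σ := σ)
    (c := .store 7 4 4 (.const false) ;;
      .loop 32 2 (.store 7 4 4 (.xor (.cell 7 4 4) (.and (.cell A 31 32) (.cell u 30 32)))) ;;
      .loop 32 2 (.store A 31 32 (.xor (.cell A 31 32) (.and (.cell 7 4 4) (.cell v 30 32)))))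
    (fun k (τ : Store) => (∀ i, k ≤ i → ∀ q, τ.bit A i q = σ.bit A i q) ∧
      ∀ i < k, ∀ q < σ.reg 2, toF2 (τ.bit A i q) = toF2 (σ.bit A i q) +
        (∑ p ∈ Finset.range (σ.reg 2),
          toF2 (σ.bit A i p) * toF2 (σ.bit u (σ.reg 30) p)) * toF2 (σ.bit v (σ.reg 30) q))
    ⟨fun _ _ _ => rfl, by omega⟩
    (by
      rintro k hk τ hreg hbit ⟨hI, hI'⟩
      simp only [Prog.regs, List.nil_append, List.cons_append, List.mem_cons,
        List.not_mem_nil, or_false, not_or] at hreg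
      simp only [Prog.arrays, List.nil_append, List.cons_append, List.mem_cons,
        List.not_mem_nil, or_false, not_or] at hbit
      rw [Prog.run_seq, Prog.run_seq]
      set τ₁ := (Prog.store 7 4 4 (.const false)).run (τ.setReg 31 k) with hτ₁
      have e4 : τ₁.reg 4 = 0 := by simp [hτ₁, hreg 4 (by decide), h4]
      have e31 : τ₁.reg 31 = k := by simp [hτ₁]
      have e30 : τ₁.reg 30 = σ.reg 30 := by simp [hτ₁, hreg 30 (by decide)]
      have e2 : τ₁.reg 2 = σ.reg 2 := by simp [hτ₁, hreg 2 (by decide)]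
      have b7 : τ₁.bit 7 0 0 = false := by simp [hτ₁, hreg 4 (by decide), h4]
      have bA : ∀ i q, τ₁.bit A i q = τ.bit A i q := by simp [hτ₁, hA]
      have bu : ∀ i q, τ₁.bit u i q = σ.bit u i q := by
        simp [hτ₁, hu, hbit u ⟨hu, hu, hu'⟩]
      have bv : ∀ i q, τ₁.bit v i q = σ.bit v i q := by
        simp [hτ₁, hv, hbit v ⟨hv, hv, hv'⟩]
      have hdot := dotLoop_run (A := A) (u := u) e4 hA hu b7
      set d : Prog := .loop 32 2 (.store 7 4 4 (.xor (.cell 7 4 4)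
        (.and (.cell A 31 32) (.cell u 30 32)))) with hd
      have dreg : ∀ r, r ≠ 32 → (d.run τ₁).reg r = τ₁.reg r := fun r hr =>
        Prog.run_reg_of_notMem _ _ (by simp [hd, Prog.regs, hr])
      have dbit : ∀ a, a ≠ 7 → ∀ i q, (d.run τ₁).bit a i q = τ₁.bit a i q := fun a ha i q =>
        Prog.run_bit_of_notMem _ _ (by simp [hd, Prog.arrays, ha]) i q
      obtain ⟨g1, g2⟩ := addLoop_run (A := A) (v := v) (σ := d.run τ₁)
        (by rw [dreg 4 (by decide), e4]) hA hv'
      rw [dreg 31 (by decide), e31] at g1 g2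
      rw [dreg 2 (by decide), e2] at g2
      refine ⟨fun i hi q => ?_, fun i hi q hq => ?_⟩
      · rw [g1 i (by omega), dbit A hA, bA, hI i (by omega)]
      · by_cases hik : i = k
        · subst hik
          rw [g2 q hq, toF2_xor, toF2_and, hdot, dbit A hA, dbit v hv, bA, bv,
            dreg 30 (by decide), e30, e2, e31, hI i le_rfl]
          simp only [bA, bu, hI i le_rfl]
        · rw [g1 i hik, dbit A hA, bA, hI' i (by omega) q hq])
  exact key.2 i hi q hq

/-- Multiplication of the matrix in array `A` by a transvection. -/
def applyProg (A u v : ℕ) : Prog := swapProg ;; rankOneProg A u v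

@[simp] theorem applyProg_regs (A u v : ℕ) :
    (applyProg A u v).regs = [18, 22, 24, 24, 18, 18, 31, 32, 32] := rfl

@[simp] theorem applyProg_arrays (A u v : ℕ) : (applyProg A u v).arrays = [4, 4, 7, 7, A] := rfl

theorem sum_range_pos {n : ℕ} (F : ℕ → ZMod 2) :
    ∑ p ∈ Finset.range (2 * n), F p = ∑ P : Fin n ⊕ Fin n, F (pos P) := by
  rw [Fintype.sum_sum_type]
  simp only [pos]
  rw [← Finset.sum_add_distrib]
  induction n with
  | zero => simp
  | succ n ih =>
    rw [Fin.sum_univ_castSucc, show 2 * (n + 1) = 2 * n + 1 + 1 by ring, Finset.sum_range_succ,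
      Finset.sum_range_succ, ih, add_assoc]
    rfl

/-- Row `R` of array `3` holds the vector `h`. -/
def HoldsRow {n : ℕ} (σ : Store) (R : ℕ) (h : Vec n) : Prop :=
  ∀ P, toF2 (σ.bit 3 R (pos P)) = h P

theorem swapProg_holds {n : ℕ} {σ : Store} {h : Vec n} (h0 : σ.reg 0 = n)
    (hh : HoldsRow σ (σ.reg 30) h) (P : Fin n ⊕ Fin n) :
    toF2 ((swapProg.run σ).bit 4 (σ.reg 30) (pos P)) = (Matrix.J (Fin n) (ZMod 2) *ᵥ h) P := by
  rcases P with j | j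
  · rw [J_mulVec_inl, ← hh]
    exact congrArg toF2 (swapProg_run σ j (by omega)).1
  · rw [J_mulVec_inr, ← hh]
    exact congrArg toF2 (swapProg_run σ j (by omega)).2

/-- `M (1 + h (Jh)ᵀ) = M + (M h)(Jh)ᵀ`, a rank-one update with `u = h` and `v = Jh`. -/
theorem applyProg_run_right {n : ℕ} {σ : Store} {h : Vec n}
    {M : Matrix (Fin n ⊕ Fin n) (Fin n ⊕ Fin n) (ZMod 2)} (h0 : σ.reg 0 = n)
    (h2 : σ.reg 2 = 2 * n) (h4 : σ.reg 4 = 0) (hh : HoldsRow σ (σ.reg 30) h)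
    (hM : ∀ P Q, toF2 (σ.bit 2 (pos P) (pos Q)) = M P Q) (P Q : Fin n ⊕ Fin n) :
    toF2 (((applyProg 2 3 4).run σ).bit 2 (pos P) (pos Q)) = (M * transvection h) P Q := by
  have e : ∀ r, r ∉ [18, 22, 24] → (swapProg.run σ).reg r = σ.reg r := fun r hr =>
    Prog.run_reg_of_notMem _ _ (by simp at hr ⊢; tauto)
  have b : ∀ a, a ≠ 4 → ∀ i q, (swapProg.run σ).bit a i q = σ.bit a i q := fun a ha i q =>
    Prog.run_bit_of_notMem _ _ (by simp [ha]) i q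
  rw [applyProg, Prog.run_seq, rankOneProg_run (by rw [e 4 (by decide), h4]) (by decide)
    (by decide) (by decide) (by decide) (by decide)
    (by rw [e 2 (by decide), h2]; exact pos_lt P) (by rw [e 2 (by decide), h2]; exact pos_lt Q),
    e 2 (by decide), e 30 (by decide), h2, sum_range_pos, swapProg_holds h0 hh,
    transvection, Matrix.mul_add, Matrix.mul_one, Matrix.add_apply, Matrix.mul_vecMulVec,
    Matrix.vecMulVec_apply]
  simp only [b 2 (by decide), b 3 (by decide), hM, hh _]
  rfl

/-- Array `5` stores the transpose, and `(T M)ᵀ = Mᵀ + (Mᵀ J h) hᵀ` for the transvection `T` along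
`h`; hence the roles of `h` and `Jh` are exchanged. -/
theorem applyProg_run_left {n : ℕ} {σ : Store} {h : Vec n}
    {M : Matrix (Fin n ⊕ Fin n) (Fin n ⊕ Fin n) (ZMod 2)} (h0 : σ.reg 0 = n)
    (h2 : σ.reg 2 = 2 * n) (h4 : σ.reg 4 = 0) (hh : HoldsRow σ (σ.reg 30) h)
    (hM : ∀ P Q, toF2 (σ.bit 5 (pos P) (pos Q)) = M Q P) (P Q : Fin n ⊕ Fin n) :
    toF2 (((applyProg 5 4 3).run σ).bit 5 (pos P) (pos Q)) = (transvection h * M) Q P := by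
  have e : ∀ r, r ∉ [18, 22, 24] → (swapProg.run σ).reg r = σ.reg r := fun r hr =>
    Prog.run_reg_of_notMem _ _ (by simp at hr ⊢; tauto)
  have b : ∀ a, a ≠ 4 → ∀ i q, (swapProg.run σ).bit a i q = σ.bit a i q := fun a ha i q =>
    Prog.run_bit_of_notMem _ _ (by simp [ha]) i q
  rw [applyProg, Prog.run_seq, rankOneProg_run (by rw [e 4 (by decide), h4]) (by decide)
    (by decide) (by decide) (by decide) (by decide)
    (by rw [e 2 (by decide), h2]; exact pos_lt P) (by rw [e 2 (by decide), h2]; exact pos_lt Q),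
    e 2 (by decide), e 30 (by decide), h2, sum_range_pos, b 5 (by decide), b 3 (by decide), hM,
    hh, transvection, Matrix.add_mul, Matrix.one_mul, Matrix.add_apply, Matrix.vecMulVec_mul,
    Matrix.vecMulVec_apply, mul_comm]
  simp only [b 5 (by decide), swapProg_holds h0 hh, hM, Matrix.vecMul, dotProduct]
  simp only [mul_comm]

/-! ### Register bookkeeping and input bits -/

/-- Registers `1`, `2`, `3`, `5` receive `4n`, `2n`, `6n²`, `1`, where `n` is in register `0`. -/
def sizesProg : Prog :=
  .loop 10 0 (.succ 1 ;; .succ 1 ;; .succ 1 ;; .succ 1) ;; .loop 10 0 (.succ 2 ;; .succ 2) ;;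
  .loop 10 0 (.loop 11 0 (.succ 3 ;; .succ 3 ;; .succ 3 ;; .succ 3 ;; .succ 3 ;; .succ 3)) ;;
  .succ 5

/-- The registers after `sizesProg`. -/
structure SizeRegs (σ : Store) (n : ℕ) : Prop where
  reg0 : σ.reg 0 = n
  reg1 : σ.reg 1 = 4 * n
  reg2 : σ.reg 2 = 2 * n
  reg3 : σ.reg 3 = 6 * n * n
  reg4 : σ.reg 4 = 0
  reg5 : σ.reg 5 = 1

theorem SizeRegs.run {σ : Store} {n : ℕ} (h : SizeRegs σ n) (c : Prog)
    (hc : ∀ r < 6, r ∉ c.regs) : SizeRegs (c.run σ) n := by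
  have e : ∀ r < 6, (c.run σ).reg r = σ.reg r := fun r hr => c.run_reg_of_notMem σ (hc r hr)
  obtain ⟨h0, h1, h2, h3, h4, h5⟩ := h
  constructor <;> rw [e _ (by decide)] <;> assumption

theorem sizesProg_run {σ : Store} {n : ℕ} (hσ : ∀ r, σ.reg r = if r = 0 then n else 0) :
    SizeRegs (sizesProg.run σ) n := by
  have h1 := Prog.loop_invariant (x := 10) (y := 0)
    (c := .succ 1 ;; .succ 1 ;; .succ 1 ;; .succ 1) (σ := σ)
    (fun k (τ : Store) => τ.reg 1 = 4 * k) (by simp [hσ])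
    (by rintro k - τ - - h; simp [h]; ring)
  set σ₁ := (Prog.loop 10 0 (.succ 1 ;; .succ 1 ;; .succ 1 ;; .succ 1)).run σ with hσ₁
  have e1 : ∀ r, r ∉ [10, 1] → σ₁.reg r = σ.reg r := fun r hr =>
    Prog.run_reg_of_notMem _ _ (by simpa [Prog.regs] using hr)
  have h2 := Prog.loop_invariant (x := 10) (y := 0) (c := .succ 2 ;; .succ 2) (σ := σ₁)
    (fun k (τ : Store) => τ.reg 2 = 2 * k) (by simp [hσ, e1])
    (by rintro k - τ - - h; simp [h]; ring)
  set σ₂ := (Prog.loop 10 0 (.succ 2 ;; .succ 2)).run σ₁ with hσ₂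
  have e2 : ∀ r, r ∉ [10, 2] → σ₂.reg r = σ₁.reg r := fun r hr =>
    Prog.run_reg_of_notMem _ _ (by simpa [Prog.regs] using hr)
  have h3 := Prog.loop_invariant (x := 10) (y := 0) (c := .loop 11 0
      (.succ 3 ;; .succ 3 ;; .succ 3 ;; .succ 3 ;; .succ 3 ;; .succ 3)) (σ := σ₂)
    (fun k (τ : Store) => τ.reg 3 = 6 * n * k) (by simp [hσ, e1, e2])
    (by
      rintro k - τ hr - h
      have e0 : (τ.setReg 10 k).reg 0 = n := by
        simp [hr 0 (by decide), e1, e2, hσ]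
      have := Prog.loop_invariant (x := 11) (y := 0)
        (c := .succ 3 ;; .succ 3 ;; .succ 3 ;; .succ 3 ;; .succ 3 ;; .succ 3) (σ := τ.setReg 10 k)
        (fun l (τ : Store) => τ.reg 3 = 6 * n * k + 6 * l) (by simp [h])
        (by rintro l - τ - - h; simp [h]; ring)
      rw [e0] at this
      rw [this]
      ring)
  set σ₃ := (Prog.loop 10 0 (.loop 11 0
    (.succ 3 ;; .succ 3 ;; .succ 3 ;; .succ 3 ;; .succ 3 ;; .succ 3))).run σ₂ with hσ₃
  have e3 : ∀ r, r ∉ [10, 11, 3] → σ₃.reg r = σ₂.reg r := fun r hr =>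
    Prog.run_reg_of_notMem _ _ (by simpa [Prog.regs] using hr)
  have hrun : sizesProg.run σ = (Prog.succ 5).run σ₃ := rfl
  rw [hrun]
  have e0 : σ₁.reg 0 = n := by simp [e1, hσ]
  have e0' : σ₂.reg 0 = n := by simp [e2, e0]
  rw [hσ 0, if_pos rfl] at h1
  rw [e0] at h2
  rw [e0'] at h3
  constructor
  · simp [e3, e0']
  · simp [e3, e2, h1]
  · simp [e3, h2]
  · simp [h3]
  · simp [e3, e2, e1, hσ]
  · simp [e3, e2, e1, hσ]

/-- Prepares the registers for level `0`. -/
def levelInitProg : Prog :=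
  .copy 6 2 ;; .copy 7 2 ;; .zero 8 ;; .copy 23 0 ;; .zero 25 ;; .copy 26 5 ;; .copy 27 5 ;;
  .succ 27 ;; .copy 28 27 ;; .succ 28 ;; .copy 29 5

/-- Prepares the registers for the next level. -/
def levelNextProg : Prog :=
  .copy 6 7 ;; .loop 21 7 (.succ 6) ;; .pred 6 ;; .pred 7 ;; .pred 7 ;; .succ 8 ;; .succ 8 ;;
  .pred 23 ;; .succ 25 ;; .succ 25 ;; .succ 25 ;; .succ 25 ;;
  .succ 26 ;; .succ 26 ;; .succ 26 ;; .succ 26 ;; .succ 27 ;; .succ 27 ;; .succ 27 ;; .succ 27 ;;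
  .succ 28 ;; .succ 28 ;; .succ 28 ;; .succ 28 ;; .succ 29 ;; .succ 29

/-- The position in row `j` of array `0` at which the index of level `j` starts. -/
def levelOffset (n j : ℕ) : ℕ := if j = 0 then 2 * n else 4 * (n - j) + 3

/-- The registers at the beginning of level `j`. -/
structure LevelRegs (σ : Store) (n j : ℕ) : Prop extends SizeRegs σ n where
  reg6 : σ.reg 6 = levelOffset n j
  reg7 : σ.reg 7 = 2 * (n - j)
  reg8 : σ.reg 8 = 2 * j
  reg23 : σ.reg 23 = n - j
  reg25 : σ.reg 25 = 4 * j
  reg26 : σ.reg 26 = 4 * j + 1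
  reg27 : σ.reg 27 = 4 * j + 2
  reg28 : σ.reg 28 = 4 * j + 3
  reg29 : σ.reg 29 = 2 * j + 1

theorem LevelRegs.congr {σ τ : Store} {n j : ℕ} (h : LevelRegs σ n j)
    (e : ∀ r ∈ [0, 1, 2, 3, 4, 5, 6, 7, 8, 23, 25, 26, 27, 28, 29], τ.reg r = σ.reg r) :
    LevelRegs τ n j := by
  obtain ⟨⟨h0, h1, h2, h3, h4, h5⟩, h6, h7, h8, h9, h10, h11, h12, h13, h14⟩ := h
  constructor
  · constructor <;> rw [e _ (by decide)] <;> assumption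
  all_goals rw [e _ (by decide)]; assumption

theorem LevelRegs.run {σ : Store} {n j : ℕ} (h : LevelRegs σ n j) (c : Prog)
    (hc : ∀ r ∈ [0, 1, 2, 3, 4, 5, 6, 7, 8, 23, 25, 26, 27, 28, 29], r ∉ c.regs) :
    LevelRegs (c.run σ) n j :=
  h.congr fun r hr => c.run_reg_of_notMem σ (hc r hr)

theorem levelInitProg_run {σ : Store} {n : ℕ} (h : SizeRegs σ n) :
    LevelRegs (levelInitProg.run σ) n 0 := by
  obtain ⟨h0, h1, h2, h3, h4, h5⟩ := h
  constructor
  · constructor <;> simp [levelInitProg, *]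
  all_goals simp [levelInitProg, *, levelOffset]

/-- The new offset is `2m + 2m - 1` for the old `m = n - j`: the next index begins right behind the
`4m - 1` bits of the level just handled. -/
theorem levelNextProg_run {σ : Store} {n j : ℕ} (h : LevelRegs σ n j) (hj : j < n) :
    LevelRegs (levelNextProg.run σ) n (j + 1) := by
  have h6 := Prog.loop_invariant (x := 21) (y := 7) (c := .succ 6) (σ := (Prog.copy 6 7).run σ)
    (fun k (τ : Store) => τ.reg 6 = 2 * (n - j) + k) (by simp [h.reg7])
    (by rintro k - τ - - h; simp [h]; ring)
  set σ₁ := (Prog.loop 21 7 (.succ 6)).run ((Prog.copy 6 7).run σ) with hσ₁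
  have e1 : ∀ r, r ∉ [21, 6] → σ₁.reg r = σ.reg r := fun r hr => by
    rw [hσ₁, Prog.run_reg_of_notMem _ _ (by simpa [Prog.regs] using hr)]
    simp at hr
    simp [hr]
  have e7 : ((Prog.copy 6 7).run σ).reg 7 = 2 * (n - j) := by simp [h.reg7]
  rw [e7] at h6
  obtain ⟨⟨h0, h1, h2, h3, h4, h5⟩, -, h7, h8, h9, h10, h11, h12, h13, h14⟩ := h
  have hrun : levelNextProg.run σ = Prog.run (.pred 6 ;; .pred 7 ;; .pred 7 ;; .succ 8 ;; .succ 8 ;;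
    .pred 23 ;; .succ 25 ;; .succ 25 ;; .succ 25 ;; .succ 25 ;;
    .succ 26 ;; .succ 26 ;; .succ 26 ;; .succ 26 ;; .succ 27 ;; .succ 27 ;; .succ 27 ;; .succ 27 ;;
    .succ 28 ;; .succ 28 ;; .succ 28 ;; .succ 28 ;; .succ 29 ;; .succ 29) σ₁ := rfl
  rw [hrun]
  constructor
  · constructor <;> simp [e1, h0, h1, h2, h3, h4, h5]
  all_goals simp [h6, e1, h7, h8, h9, h10, h11, h12, h13, h14, levelOffset]
  all_goals omega

/-- The rows `reg 25, …, reg 28` of array `3` receive the four vectors of a level. -/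
def vectorsProg : Prog := partnerProg ;; levelProg

/-- Positions below `2j` are never written, so they must be zero beforehand for the rows to hold
vectors supported on the remaining pairs. -/
theorem vectorsProg_run {σ : Store} {n j : ℕ} {b : ℕ → Bool} (h : LevelRegs σ n j) (hj : j < n)
    (hb : ∀ q, σ.bit 0 (σ.reg 14) q = b q)
    (hz : ∀ t < 4, ∀ q < 2 * j, σ.bit 3 (4 * j + t) q = false) :
    (∀ t < 4, HoldsRow (vectorsProg.run σ) (4 * j + t) (levelVec n j b t)) ∧
    (∀ t < 4, ∀ q < 2 * j, (vectorsProg.run σ).bit 3 (4 * j + t) q = false) ∧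
    ∀ i, ¬(4 * j ≤ i ∧ i < 4 * j + 4) → ∀ q, (vectorsProg.run σ).bit 3 i q = σ.bit 3 i q := by
  obtain rfl : σ.bit 0 (σ.reg 14) = b := funext hb
  have hp := partnerProg_run h.reg4 h.reg5
  rw [h.reg23] at hp
  have h' := h.run partnerProg (by decide)
  have e14 : (partnerProg.run σ).reg 14 = σ.reg 14 := Prog.run_reg_of_notMem _ _ (by decide)
  have eb : (partnerProg.run σ).bit = σ.bit := by
    ext a i q
    rw [Prog.run_bit_of_notMem _ _ List.not_mem_nil]
  obtain ⟨h1, h2⟩ := levelProg_run h'.reg4 h'.reg5 h'.reg7 h'.reg25 h'.reg26 h'.reg27 h'.reg28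
  rw [hp, e14, eb, h'.reg8] at h1
  rw [eb] at h2
  refine ⟨fun t ht P => ?_, fun t ht q hq => ?_, h2⟩
  · rw [vectorsProg, Prog.run_seq, h1 t ht, levelVec, vecAt]
    have hP := pos_lt P
    by_cases h : pos P < 2 * j
    · rw [if_neg (by omega), if_pos h, hz t ht _ h]
      rfl
    · rw [if_pos (by omega), if_neg h]
  · rw [vectorsProg, Prog.run_seq, h1 t ht, if_neg (by omega), hz t ht q hq]

/-- Copies the lowest `2n` bits of row `0` of array `0` to the rows `0` and `1` of array `1`. -/
def readBitsProg : Prog :=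
  .copy 12 0 ;;
  .loop 10 0 (.store 1 4 10 (.cell 0 4 10) ;; .store 1 5 10 (.cell 0 4 12) ;; .succ 12)

theorem readBitsProg_run {σ : Store} {n : ℕ} (h : SizeRegs σ n) {q : ℕ} (hq : q < n) :
    (readBitsProg.run σ).bit 1 0 q = σ.bit 0 0 q ∧
    (readBitsProg.run σ).bit 1 1 q = σ.bit 0 0 (n + q) := by
  have key := Prog.loop_invariant (x := 10) (y := 0) (σ := (Prog.copy 12 0).run σ)
    (c := .store 1 4 10 (.cell 0 4 10) ;; .store 1 5 10 (.cell 0 4 12) ;; .succ 12)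
    (fun k (τ : Store) => τ.reg 12 = n + k ∧ ∀ q < k, τ.bit 1 0 q = σ.bit 0 0 q ∧
      τ.bit 1 1 q = σ.bit 0 0 (n + q)) (by simp [h.reg0])
    (by
      rintro k - τ hreg hbit ⟨h12, hI⟩
      have e4 : τ.reg 4 = 0 := by rw [hreg 4 (by decide)]; simp [h.reg4]
      have e5 : τ.reg 5 = 1 := by rw [hreg 5 (by decide)]; simp [h.reg5]
      have b0 : ∀ i q, τ.bit 0 i q = σ.bit 0 i q := fun i q => hbit 0 (by decide) i q
      refine ⟨by simp [h12]; ring, fun q hq => ?_⟩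
      by_cases hqk : q = k
      · subst hqk
        simp [e4, e5, b0, h12]
      · have := hI q (by omega)
        simp [e4, e5, hqk, this])
  have e0 : ((Prog.copy 12 0).run σ).reg 0 = n := by simp [h.reg0]
  rw [e0] at key
  exact key.2 q hq

/-! ### From the index to the element -/

/-- Computes the transvection vectors of all levels. -/
def levelsProg : Prog :=
  .loop 20 0 (.copy 14 20 ;; .succ 14 ;; remProg ;; quotProg ;; vectorsProg ;; levelNextProg)

/-- The state of `levelsProg` at the beginning of level `j`. -/
structure LevelsInv (n x j : ℕ) (τ : Store) : Prop where
  regs : LevelRegs τ n j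
  index : ∀ t, τ.bit 0 j (levelOffset n j + t) = (levelIndex n x j).testBit t
  free : ∀ i, j < i → ∀ q, τ.bit 0 i q = false
  vecs : ∀ l < 4 * j, HoldsRow τ l (spVec n x l)
  free' : ∀ l, 4 * j ≤ l → ∀ q, τ.bit 3 l q = false

theorem levelIndex_le (n x j : ℕ) : levelIndex n x j ≤ x := by
  induction j with
  | zero => exact le_rfl
  | succ j ih => exact (Nat.div_le_self _ _).trans ih

theorem spVec_four_mul_add {n x j t : ℕ} (ht : t < 4) :
    spVec n x (4 * j + t) = levelVec n j (levelBits n x j) t := by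
  rw [spVec, show (4 * j + t) / 4 = j by omega, show (4 * j + t) % 4 = t by omega]

theorem levelOffset_succ {n j : ℕ} (hj : j < n) : levelOffset n (j + 1) = 4 * (n - j) - 1 := by
  rw [levelOffset, if_neg (by omega)]
  omega

/-- Row `j + 1` receives the code of the index in row `j`. Its bits behind the level description are
already the next index, so the invariant is restored by moving the offset. -/
theorem LevelsInv.step {n x j : ℕ} {τ : Store} (h : LevelsInv n x j τ) (hj : j < n)
    (hx : x < 2 ^ (2 * n ^ 2 + n)) : LevelsInv n x (j + 1)
      ((Prog.copy 14 20 ;; .succ 14 ;; remProg ;; quotProg ;; vectorsProg ;; levelNextProg).run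
        (τ.setReg 20 j)) := by
  set τ₀ := (Prog.copy 14 20 ;; .succ 14).run (τ.setReg 20 j) with hτ₀
  have e14 : τ₀.reg 14 = j + 1 := by simp [hτ₀]
  have e20 : τ₀.reg 20 = j := by simp [hτ₀]
  have b0 : τ₀.bit = τ.bit := rfl
  have r0 : LevelRegs τ₀ n j := h.regs.congr fun r hr => by
    fin_cases hr <;> simp [hτ₀]
  have hxj : levelIndex n x j < 2 ^ (2 * n ^ 2 + n) := (levelIndex_le n x j).trans_lt hx
  -- The length `6n²` of the carry passes covers the at most `2n² + n` bits of the index and the `2m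
  -- + 1` rounds in which the carry of the cyclic addition dies out.
  have hL : 2 * n ^ 2 + n + 2 * (n - j) + 1 ≤ τ₀.reg 3 := by
    rw [r0.reg3, pow_two]
    have : n * 1 ≤ n * n := Nat.mul_le_mul_left n (by omega)
    rw [Nat.mul_assoc 6]
    omega
  have hidx : ∀ t, τ₀.bit 0 (τ₀.reg 20) (τ₀.reg 6 + t) = (levelIndex n x j).testBit t := by
    intro t
    rw [e20, r0.reg6, b0, h.index]
  obtain ⟨f1, f2⟩ := remProg_run (m := n - j) r0.reg4 r0.reg5 r0.reg7 (by omega) hxj hL (by omega)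
    (fun q => by rw [e14, b0]; exact h.free _ (by omega) q) hidx
  set τ₁ := remProg.run τ₀ with hτ₁
  have r1 : LevelRegs τ₁ n j := r0.run remProg (by decide)
  have e14' : τ₁.reg 14 = τ₀.reg 14 := Prog.run_reg_of_notMem _ _ (by decide)
  have e20' : τ₁.reg 20 = τ₀.reg 20 := Prog.run_reg_of_notMem _ _ (by decide)
  have e3' : τ₁.reg 3 = τ₀.reg 3 := Prog.run_reg_of_notMem _ _ (by decide)
  have e6' : τ₁.reg 6 = τ₀.reg 6 := Prog.run_reg_of_notMem _ _ (by decide)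
  have b3' : ∀ i q, τ₁.bit 3 i q = τ₀.bit 3 i q := Prog.run_bit_of_notMem _ _ (by decide)
  obtain ⟨g1, g2⟩ := quotProg_run (σ := τ₁) (m := n - j) (x := levelIndex n x j) r1.reg4 r1.reg7
    (by omega) (hxj.trans_le (Nat.pow_le_pow_right (by omega) (by omega))) (by omega)
    (fun q => by rw [e14', f2]) (fun t => by rw [e20', e6', f1 _ (by omega), hidx])
  set τ₂ := quotProg.run τ₁ with hτ₂
  have g2' : ∀ q, τ₂.bit 0 (j + 1) q = (levelNum (n - j) (levelIndex n x j)).testBit q :=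
    fun q => by rw [← g2 q, e14', e14]
  have r2 : LevelRegs τ₂ n j := r1.run quotProg (by decide)
  have e14'' : τ₂.reg 14 = τ₁.reg 14 := Prog.run_reg_of_notMem _ _ (by decide)
  have b3'' : ∀ i q, τ₂.bit 3 i q = τ₁.bit 3 i q := Prog.run_bit_of_notMem _ _ (by decide)
  have b3 : ∀ i q, τ₂.bit 3 i q = τ.bit 3 i q := fun i q => by rw [b3'', b3', b0]
  obtain ⟨v1, -, v3⟩ := vectorsProg_run r2 hj (b := levelBits n x j)
    (fun q => by rw [e14'', g2]; rfl)
    (fun t _ q _ => by rw [b3]; exact h.free' _ (by omega) q)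
  set τ₃ := vectorsProg.run τ₂ with hτ₃
  have r3 : LevelRegs τ₃ n j := r2.run vectorsProg (by decide)
  have b0' : ∀ i q, τ₃.bit 0 i q = τ₂.bit 0 i q := Prog.run_bit_of_notMem _ _ (by decide)
  have hrun : (Prog.copy 14 20 ;; .succ 14 ;; remProg ;; quotProg ;; vectorsProg ;;
    levelNextProg).run (τ.setReg 20 j) = levelNextProg.run τ₃ := rfl
  rw [hrun]
  have hb : ∀ a i q, (levelNextProg.run τ₃).bit a i q = τ₃.bit a i q := fun a i q =>
    Prog.run_bit_of_notMem _ _ List.not_mem_nil i q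
  refine ⟨levelNextProg_run r3 hj, fun t => ?_, fun i hi q => ?_, fun l hl P => ?_,
    fun l hl q => ?_⟩
  · rw [hb, b0', g2', levelOffset_succ hj, levelNum_testBit_next (by omega)]
    rfl
  · rw [hb, b0', g1 _ (by omega), f1 _ (by omega), b0, h.free _ (by omega)]
  · rw [hb]
    by_cases hl' : l < 4 * j
    · rw [v3 _ (by omega), b3]
      exact h.vecs l hl' P
    · obtain ⟨t, rfl⟩ := Nat.exists_eq_add_of_le (not_lt.1 hl')
      rw [spVec_four_mul_add (by omega)]
      exact v1 t (by omega) P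
  · rw [hb, v3 _ (by omega), b3, h.free' _ (by omega)]

theorem levelsProg_run {n x : ℕ} {σ : Store} (h : LevelsInv n x 0 σ)
    (hx : x < 2 ^ (2 * n ^ 2 + n)) : LevelsInv n x n (levelsProg.run σ) := by
  have key := Prog.loop_invariant (x := 20) (y := 0) (σ := σ)
    (c := .copy 14 20 ;; .succ 14 ;; remProg ;; quotProg ;; vectorsProg ;; levelNextProg)
    (LevelsInv n x) h
    (fun k hk τ _ _ hI => hI.step (by rwa [h.regs.reg0] at hk) hx)
  rwa [h.regs.reg0] at key

/-- Array `2` receives the product of the transvections in array `3`. -/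
def productProg : Prog :=
  .loop 10 2 (.store 2 10 10 (.const true)) ;; .loop 20 1 (.copy 30 20 ;; applyProg 2 3 4)

theorem productProg_run {n : ℕ} {σ : Store} {h : ℕ → Vec n} (hσ : SizeRegs σ n)
    (h2 : ∀ i q, σ.bit 2 i q = false) (hh : ∀ l < 4 * n, HoldsRow σ l (h l))
    (P Q : Fin n ⊕ Fin n) :
    toF2 ((productProg.run σ).bit 2 (pos P) (pos Q)) =
      (((List.range (4 * n)).map h).map transvection).prod P Q := by
  set σ₁ := (Prog.loop 10 2 (.store 2 10 10 (.const true))).run σ with hσ₁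
  have r1 : SizeRegs σ₁ n := hσ.run _ (by decide)
  have b3 : ∀ i q, σ₁.bit 3 i q = σ.bit 3 i q := Prog.run_bit_of_notMem _ _ (by decide)
  have key₁ := Prog.loop_invariant (x := 10) (y := 2) (σ := σ)
    (c := .store 2 10 10 (.const true))
    (fun k (τ : Store) => ∀ i q, τ.bit 2 i q = decide (i = q ∧ i < k)) (by simp [h2])
    (by
      rintro k - τ hreg hbit hI i q
      simp only [Prog.run_store, Store.setBit_bit, Store.setReg_reg, if_true, true_and,
        Store.setReg_bit, hI, BitExp.eval]
      by_cases hi : i = k ∧ q = k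
      · simp [hi]
      · rw [if_neg hi]
        congr 1
        apply propext
        omega)
  have key₂ := Prog.loop_invariant (x := 20) (y := 1) (σ := σ₁)
    (c := .copy 30 20 ;; applyProg 2 3 4)
    (fun k (τ : Store) => ∀ P Q, toF2 (τ.bit 2 (pos P) (pos Q)) =
      (((List.range k).map h).map transvection).prod P Q)
    (by
      intro P Q
      rw [key₁, hσ.reg2]
      have := pos_lt P
      by_cases hPQ : P = Q
      · subst hPQ
        simp [this]
      · have : pos P ≠ pos Q := fun h => hPQ (pos_injective h)
        simp [this, Matrix.one_apply_ne hPQ])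
    (by
      rintro k hk τ hreg hbit hI
      rw [r1.reg1] at hk
      have r : ∀ r < 6, ((Prog.copy 30 20).run (τ.setReg 20 k)).reg r = σ₁.reg r := by
        intro r hr
        rw [← hreg r (by interval_cases r <;> decide)]
        simp [show r ≠ 30 by omega, show r ≠ 20 by omega]
      have e30 : ((Prog.copy 30 20).run (τ.setReg 20 k)).reg 30 = k := by simp
      intro P Q
      rw [Prog.run_seq, applyProg_run_right (σ := (Prog.copy 30 20).run (τ.setReg 20 k)) (h := h k)
        (M := (((List.range k).map h).map transvection).prod) (by rw [r 0 (by omega), r1.reg0])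
        (by rw [r 2 (by omega), r1.reg2]) (by rw [r 4 (by omega), r1.reg4])
        (by
          intro P
          rw [e30, ← hh k hk P, ← b3, ← hbit 3 (by decide)]
          rfl) hI, List.range_succ]
      simp)
  rw [r1.reg1] at key₂
  exact key₂ P Q

/-- Everything in `toElementProg` after the computation of the sizes. -/
def toElementMain : Prog := readBitsProg ;; levelInitProg ;; levelsProg ;; productProg

/-- The program that computes the parameters and the transvections of the element with a given
index. -/
def toElementProg : Prog := sizesProg ;; toElementMain

/-- A level contributes fewer than `2^(4m-1)` elements, and these exponents sum to `2n² + n`. This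
bounds the bit length of every index. -/
theorem spOrder_le (n : ℕ) : spOrder n ≤ 2 ^ (2 * n ^ 2 + n) := by
  induction n with
  | zero => simp [spOrder]
  | succ n ih =>
    rw [spOrder_succ, levelSize_succ]
    calc _ ≤ 2 ^ (2 * n + 1) * 2 ^ (2 * (n + 1)) * 2 ^ (2 * n ^ 2 + n) := by
          rw [← four_pow_eq]
          exact Nat.mul_le_mul (Nat.mul_le_mul_left _ (Nat.sub_le _ _)) ih
      _ = _ := by rw [← pow_add, ← pow_add]; congr 1; ring

theorem cliffordOrder_eq (n : ℕ) : cliffordOrder n = 4 ^ n * spOrder n := by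
  rw [cliffordOrder, spOrder, four_pow_eq, pow_add, mul_comm (2 ^ n ^ 2), mul_assoc]

theorem toElementProg_run {n i : ℕ} (hi : i < cliffordOrder n) :
    (∀ j < n, (toElementProg.run (indexInput n i)).bit 1 0 j = i.testBit j ∧
      (toElementProg.run (indexInput n i)).bit 1 1 j = i.testBit (n + j)) ∧
    (∀ P Q, toF2 ((toElementProg.run (indexInput n i)).bit 2 (pos P) (pos Q)) =
      (spElem n (i / 4 ^ n)).1 P Q) ∧
    HoldsVectors (toElementProg.run (indexInput n i)) (spVecs n (i / 4 ^ n)) := by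
  set σ := indexInput n i with hσ
  set x := i / 4 ^ n with hxdef
  have hx : x < spOrder n := Nat.div_lt_of_lt_mul (by rwa [← cliffordOrder_eq])
  set σ₁ := sizesProg.run σ with hσ₁
  set σ₂ := readBitsProg.run σ₁ with hσ₂
  set σ₃ := levelInitProg.run σ₂ with hσ₃
  set σ₄ := levelsProg.run σ₃ with hσ₄
  have hrun : toElementProg.run σ = productProg.run σ₄ := rfl
  rw [hrun]
  have r1 : SizeRegs σ₁ n := sizesProg_run fun _ => rfl
  have r2 : SizeRegs σ₂ n := r1.run _ (by decide)
  have b1 : ∀ a i q, σ₁.bit a i q = σ.bit a i q := fun a i q =>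
    Prog.run_bit_of_notMem sizesProg _ List.not_mem_nil i q
  have b2 : ∀ a, a ≠ 1 → ∀ i q, σ₂.bit a i q = σ₁.bit a i q := fun a ha i q =>
    Prog.run_bit_of_notMem readBitsProg _ (by simp [readBitsProg, Prog.arrays, ha]) i q
  have b3 : ∀ a i q, σ₃.bit a i q = σ₂.bit a i q := fun a i q =>
    Prog.run_bit_of_notMem levelInitProg _ List.not_mem_nil i q
  have hin : ∀ a i' q, σ.bit a i' q = (decide (a = 0 ∧ i' = 0) && i.testBit q) := fun _ _ _ => rfl
  have inv := levelsProg_run (n := n) (x := x) (σ := σ₃)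
    ⟨levelInitProg_run r2, fun t => by
        rw [b3, b2 0 (by decide), b1, hin, levelOffset, if_pos rfl, levelIndex, hxdef, four_pow_eq,
          Nat.testBit_div_two_pow, add_comm]
        simp,
      fun i hi q => by
        rw [b3, b2 0 (by decide), b1, hin]
        simp [show i ≠ 0 by omega],
      fun l hl => by omega,
      fun l hl q => by
        rw [b3, b2 3 (by decide), b1, hin]
        simp⟩
    (hx.trans_le (spOrder_le n))
  refine ⟨fun j hj => ?_, fun P Q => ?_, ?_, ?_⟩
  · have e : ∀ i q, (productProg.run σ₄).bit 1 i q = σ₂.bit 1 i q := by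
      intro i q
      rw [Prog.run_bit_of_notMem productProg _ (by decide), hσ₄,
        Prog.run_bit_of_notMem levelsProg _ (by decide), b3]
    obtain ⟨h1, h2⟩ := readBitsProg_run r1 hj
    rw [e, e, hσ₂, h1, h2, b1, b1, hin, hin]
    simp
  · rw [productProg_run (h := spVec n x) inv.regs.toSizeRegs (fun i q => ?_) inv.vecs]
    · rfl
    · rw [Prog.run_bit_of_notMem levelsProg _ (by decide), b3, b2 2 (by decide), b1, hin]
      simp
  · rw [Prog.run_reg_of_notMem productProg _ (by decide), inv.regs.reg1]
    simp [spVecs]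
  · intro k P
    have hk := k.2
    simp only [spVecs, List.length_map, List.length_range] at hk
    rw [Prog.run_bit_of_notMem productProg _ (by decide), inv.vecs k hk P]
    change _ = (((List.range (4 * n)).map (spVec n x))[k.1]'(by simpa using hk)) P
    rw [List.getElem_map, List.getElem_range]

/-! ### From the element to the level bits -/

/-- The first bits of row `reg 14` of array `0` receive the column of `unitX j`. -/
def readFirstProg : Prog := .copy 16 8 ;; .loop 22 7 (.store 0 14 22 (.cell 5 8 16) ;; .succ 16)

theorem readFirstProg_run (σ : Store) :
    (∀ i, i ≠ σ.reg 14 → ∀ q, (readFirstProg.run σ).bit 0 i q = σ.bit 0 i q) ∧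
    ∀ q, (readFirstProg.run σ).bit 0 (σ.reg 14) q =
      if q < σ.reg 7 then σ.bit 5 (σ.reg 8) (σ.reg 8 + q) else σ.bit 0 (σ.reg 14) q := by
  have key := Prog.loop_invariant (x := 22) (y := 7) (σ := (Prog.copy 16 8).run σ)
    (c := .store 0 14 22 (.cell 5 8 16) ;; .succ 16)
    (fun k (τ : Store) => τ.reg 16 = σ.reg 8 + k ∧
      (∀ i, i ≠ σ.reg 14 → ∀ q, τ.bit 0 i q = σ.bit 0 i q) ∧
      ∀ q, τ.bit 0 (σ.reg 14) q =
        if q < k then σ.bit 5 (σ.reg 8) (σ.reg 8 + q) else σ.bit 0 (σ.reg 14) q) (by simp)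
    (by
      rintro k - τ hreg hbit ⟨h16, hI, hI'⟩
      have e14 : τ.reg 14 = σ.reg 14 := by rw [hreg 14 (by decide)]; simp
      have e8 : τ.reg 8 = σ.reg 8 := by rw [hreg 8 (by decide)]; simp
      have b5 : ∀ i q, τ.bit 5 i q = σ.bit 5 i q := fun i q => hbit 5 (by decide) i q
      refine ⟨by simp [h16]; ring, fun i hi q => ?_, fun q => ?_⟩
      · simp [e14, hi, hI i hi]
      · by_cases hq : q = k
        · subst hq
          simp [e14, e8, h16, b5]
        · have : q < k + 1 ↔ q < k := by omega
          simp [e14, hI', hq, this])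
  have e7 : ((Prog.copy 16 8).run σ).reg 7 = σ.reg 7 := by simp
  rw [e7] at key
  exact ⟨key.2.1, key.2.2⟩

/-- The remaining bits of row `reg 14` of array `0` receive the column of `unitZ j`. -/
def readSecondProg : Prog :=
  .copy 16 8 ;; .copy 17 7 ;; .store 0 14 7 (.not (.cell 5 29 8)) ;; .pred 17 ;;
  .loop 22 7 (.ite (.lt 5 22) (.store 0 14 17 (.cell 5 29 16)) .skip ;; .succ 16 ;; .succ 17)

theorem readSecondProg_run {σ : Store} (h5 : σ.reg 5 = 1) (h7 : 2 ≤ σ.reg 7) :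
    (∀ i, i ≠ σ.reg 14 → ∀ q, (readSecondProg.run σ).bit 0 i q = σ.bit 0 i q) ∧
    (readSecondProg.run σ).bit 0 (σ.reg 14) (σ.reg 7) = !σ.bit 5 (σ.reg 29) (σ.reg 8) ∧
    (∀ p, 2 ≤ p → p < σ.reg 7 → (readSecondProg.run σ).bit 0 (σ.reg 14) (σ.reg 7 - 1 + p) =
      σ.bit 5 (σ.reg 29) (σ.reg 8 + p)) ∧
    ∀ q, q < σ.reg 7 ∨ 2 * σ.reg 7 - 1 ≤ q →
      (readSecondProg.run σ).bit 0 (σ.reg 14) q = σ.bit 0 (σ.reg 14) q := by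
  set σ₁ := (Prog.copy 16 8 ;; .copy 17 7 ;; .store 0 14 7 (.not (.cell 5 29 8)) ;;
    .pred 17).run σ with hσ₁
  have e : ∀ r, r ≠ 16 → r ≠ 17 → σ₁.reg r = σ.reg r := fun r h h' => by simp [hσ₁, h, h']
  have key := Prog.loop_invariant (x := 22) (y := 7) (σ := σ₁)
    (c := .ite (.lt 5 22) (.store 0 14 17 (.cell 5 29 16)) .skip ;; .succ 16 ;; .succ 17)
    (fun k (τ : Store) => τ.reg 16 = σ.reg 8 + k ∧ τ.reg 17 = σ.reg 7 - 1 + k ∧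
      (∀ i, i ≠ σ.reg 14 → ∀ q, τ.bit 0 i q = σ.bit 0 i q) ∧
      ∀ q, τ.bit 0 (σ.reg 14) q = if q = σ.reg 7 then !σ.bit 5 (σ.reg 29) (σ.reg 8) else
        if σ.reg 7 < q ∧ q < σ.reg 7 - 1 + k then
          σ.bit 5 (σ.reg 29) (σ.reg 8 + (q - (σ.reg 7 - 1))) else σ.bit 0 (σ.reg 14) q)
    (by
      refine ⟨by simp [hσ₁], by simp [hσ₁], fun i hi q => by simp [hσ₁, hi], fun q => ?_⟩
      have : ¬(σ.reg 7 < q ∧ q < σ.reg 7 - 1) := by omega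
      simp [hσ₁, this])
    (by
      rintro k - τ hreg hbit ⟨h16, h17, hI, hI'⟩
      have e5 : τ.reg 5 = 1 := by rw [hreg 5 (by decide), e 5 (by decide) (by decide), h5]
      have e14 : τ.reg 14 = σ.reg 14 := by rw [hreg 14 (by decide), e 14 (by decide) (by decide)]
      have e29 : τ.reg 29 = σ.reg 29 := by rw [hreg 29 (by decide), e 29 (by decide) (by decide)]
      have b5 : ∀ i q, τ.bit 5 i q = σ.bit 5 i q := fun i q => by
        rw [hbit 5 (by decide)]; simp [hσ₁]
      by_cases hk : 1 < k
      · simp only [Prog.run_seq, Prog.run_ite, Prog.run_succ, Prog.run_store, BitExp.eval,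
          Store.setReg_reg, Store.setReg_bit, Store.setBit_reg, Store.setBit_bit, Nat.reduceEqDiff,
          if_true, if_false, e5, decide_eq_true_eq, hk, h16, h17, e14, e29, b5, true_and]
        refine ⟨by omega, by omega, fun i hi q => ?_, fun q => ?_⟩
        · rw [if_neg (by simp [hi]), hI i hi]
        · by_cases hq : q = σ.reg 7 - 1 + k
          · rw [if_pos hq, if_neg (by omega), if_pos (by omega)]
            congr 2
            omega
          · rw [if_neg hq, hI']
            exact if_congr Iff.rfl rfl (if_congr (by omega) rfl rfl)
      · simp only [Prog.run_seq, Prog.run_ite, Prog.run_succ, Prog.run_skip, BitExp.eval,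
          Store.setReg_reg, Store.setReg_bit, Nat.reduceEqDiff,
          if_true, if_false, e5, decide_eq_true_eq, hk, h16, h17]
        refine ⟨by omega, by omega, hI, fun q => ?_⟩
        rw [hI']
        refine if_congr Iff.rfl rfl (if_congr (by omega) rfl rfl))
  rw [e 7 (by decide) (by decide)] at key
  obtain ⟨-, -, key, key'⟩ := key
  have hrun : readSecondProg.run σ = (Prog.loop 22 7 (.ite (.lt 5 22)
    (.store 0 14 17 (.cell 5 29 16)) .skip ;; .succ 16 ;; .succ 17)).run σ₁ := rfl
  rw [hrun]
  refine ⟨key, ?_, fun p hp hp' => ?_, fun q hq => ?_⟩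
  · rw [key', if_pos rfl]
  · rw [key', if_neg (by omega), if_pos (by omega), Nat.add_sub_cancel_left]
  · rw [key', if_neg (by omega), if_neg (by omega)]

/-- Copies the rows `0` and `1` of array `1` to the lowest `2n` bits of row `0` of array `0`. -/
def writeBitsProg : Prog :=
  .copy 12 0 ;;
  .loop 10 0 (.store 0 4 10 (.cell 1 4 10) ;; .store 0 4 12 (.cell 1 5 10) ;; .succ 12)

theorem writeBitsProg_run {σ : Store} {n : ℕ} (h : SizeRegs σ n) (i q : ℕ) :
    (writeBitsProg.run σ).bit 0 i q =
      if i = 0 ∧ q < n then σ.bit 1 0 q else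
      if i = 0 ∧ n ≤ q ∧ q < 2 * n then σ.bit 1 1 (q - n) else σ.bit 0 i q := by
  have key := Prog.loop_invariant (x := 10) (y := 0) (σ := (Prog.copy 12 0).run σ)
    (c := .store 0 4 10 (.cell 1 4 10) ;; .store 0 4 12 (.cell 1 5 10) ;; .succ 12)
    (fun k (τ : Store) => τ.reg 12 = n + k ∧ ∀ i q, τ.bit 0 i q =
      if i = 0 ∧ q < k then σ.bit 1 0 q else
      if i = 0 ∧ n ≤ q ∧ q < n + k then σ.bit 1 1 (q - n) else σ.bit 0 i q)
    (by
      refine ⟨by simp [h.reg0], fun i q => ?_⟩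
      rw [if_neg (by omega), if_neg (by omega)]
      rfl)
    (by
      rintro k hk τ hreg hbit ⟨h12, hI⟩
      have e4 : τ.reg 4 = 0 := by rw [hreg 4 (by decide)]; simp [h.reg4]
      have e5 : τ.reg 5 = 1 := by rw [hreg 5 (by decide)]; simp [h.reg5]
      have b1 : ∀ i q, τ.bit 1 i q = σ.bit 1 i q := fun i q => hbit 1 (by decide) i q
      have hk' : k < n := by simpa [h.reg0] using hk
      simp only [Prog.run_seq, Prog.run_succ, Prog.run_store, BitExp.eval,
          Store.setReg_reg, Store.setReg_bit, Store.setBit_reg, Store.setBit_bit, Nat.reduceEqDiff,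
          if_true, if_false, e4, e5, h12, b1, true_and, false_and, one_ne_zero]
      refine ⟨by omega, fun i q => ?_⟩
      by_cases hq : i = 0 ∧ q = n + k
      · rw [if_pos hq, if_neg (by omega), if_pos (by omega), hq.2, Nat.add_sub_cancel_left]
      · rw [if_neg hq]
        by_cases hq' : i = 0 ∧ q = k
        · rw [if_pos hq', if_pos (by omega), hq'.2]
        · rw [if_neg hq', hI]
          exact if_congr (by omega) rfl (if_congr (by omega) rfl rfl))
  have e0 : ((Prog.copy 12 0).run σ).reg 0 = n := by simp [h.reg0]
  rw [e0, ← two_mul] at key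
  exact key.2 i q

/-- Array `5` receives the transpose of array `2`. -/
def transposeProg : Prog := .loop 10 2 (.loop 11 2 (.store 5 10 11 (.cell 2 11 10)))

theorem transposeProg_run {σ : Store} {i q : ℕ} (hi : i < σ.reg 2) (hq : q < σ.reg 2) :
    (transposeProg.run σ).bit 5 i q = σ.bit 2 q i := by
  have key := Prog.loop_invariant (x := 10) (y := 2) (σ := σ)
    (c := .loop 11 2 (.store 5 10 11 (.cell 2 11 10)))
    (fun k (τ : Store) => ∀ i < k, ∀ q < σ.reg 2, τ.bit 5 i q = σ.bit 2 q i) (by omega)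
    (by
      rintro k - τ hreg hbit hI i hi q hq
      have e2 : (τ.setReg 10 k).reg 2 = σ.reg 2 := by simp [hreg 2 (by decide)]
      have key := Prog.loop_invariant (x := 11) (y := 2) (σ := τ.setReg 10 k)
        (c := .store 5 10 11 (.cell 2 11 10))
        (fun l (τ' : Store) => (∀ q < l, τ'.bit 5 k q = σ.bit 2 q k) ∧
          ∀ i, i ≠ k → ∀ q, τ'.bit 5 i q = τ.bit 5 i q) ⟨by omega, fun _ _ _ => rfl⟩
        (by
          rintro l - τ' hreg' hbit' ⟨hI, hI'⟩
          have e10 : τ'.reg 10 = k := by rw [hreg' 10 (by decide)]; simp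
          have b2 : ∀ i q, τ'.bit 2 i q = σ.bit 2 i q := fun i q => by
            rw [hbit' 2 (by decide), Store.setReg_bit, hbit 2 (by decide)]
          refine ⟨fun q hq => ?_, fun i hi q => by simp [e10, hi, hI' i hi]⟩
          by_cases hql : q = l
          · subst hql
            simp [e10, b2]
          · simp [hql, e10, hI q (by omega)])
      rw [e2] at key
      by_cases hik : i = k
      · subst hik
        exact key.1 q hq
      · rw [key.2 i hik, hI i (by omega) q hq])
  exact key i hi q hq

/-- Reads off the bits of all levels from the transposed matrix in array `5`. -/
def readLevelBody : Prog :=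
  .copy 14 20 ;; .succ 14 ;; readFirstProg ;; vectorsProg ;;
  .copy 30 25 ;; applyProg 5 4 3 ;; .copy 30 26 ;; applyProg 5 4 3 ;;
  readSecondProg ;; vectorsProg ;;
  .copy 30 27 ;; applyProg 5 4 3 ;; .copy 30 28 ;; applyProg 5 4 3 ;; levelNextProg

/-- The product of the transvections from level `j` on. -/
def levelTail (n x j : ℕ) : Matrix (Fin n ⊕ Fin n) (Fin n ⊕ Fin n) (ZMod 2) :=
  (((spVecs n x).drop (4 * j)).map transvection).prod

theorem levelTail_eq {n x j : ℕ} (hj : j < n) : levelTail n x j =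
    transvection (levelVec n j (levelBits n x j) 0) *
      (transvection (levelVec n j (levelBits n x j) 1) *
        (transvection (levelVec n j (levelBits n x j) 2) *
          (transvection (levelVec n j (levelBits n x j) 3) * levelTail n x (j + 1)))) := by
  have h : ∀ t < 4, ((spVecs n x).drop (4 * j + t)) =
      levelVec n j (levelBits n x j) t :: (spVecs n x).drop (4 * j + t + 1) := by
    intro t ht
    have hl : 4 * j + t < (spVecs n x).length := by
      simp only [spVecs, List.length_map, List.length_range]; omega
    rw [List.drop_eq_getElem_cons hl, ← spVec_four_mul_add ht]
    congr 1
    change ((List.range (4 * n)).map (spVec n x))[4 * j + t]'(by simp; omega) = _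
    rw [List.getElem_map, List.getElem_range]
  rw [levelTail, levelTail, ← Nat.add_zero (4 * j), h 0 (by omega), h 1 (by omega),
    h 2 (by omega), h 3 (by omega)]
  simp [mul_add]

/-- The vectors of the levels from `j` on vanish on the first `2j` positions, so anything orthogonal
to all such vectors is untouched. -/
theorem levelTail_fixes {n x j : ℕ} {v : Vec n}
    (hv : ∀ w : Vec n, (∀ P, pos P < 2 * j → w P = 0) → symp v w = 0) :
    levelTail n x j *ᵥ v = v := by
  refine transvection_prod_fixes fun w hw => hv w fun P hP => ?_
  obtain ⟨k, hk, rfl⟩ := List.mem_iff_getElem.1 hw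
  rw [List.getElem_drop]
  have hk' : 4 * j + k < 4 * n := by
    have := hk
    simp only [spVecs, List.length_drop, List.length_map, List.length_range] at this
    omega
  change (((List.range (4 * n)).map (spVec n x))[4 * j + k]'(by simpa using hk')) P = 0
  rw [List.getElem_map, List.getElem_range, spVec, levelVec, vecAt, if_pos]
  omega

theorem levelVec_congr_of_lt_two {n j : ℕ} {b c : ℕ → Bool} (hj : j < n)
    (h : ∀ p < 2 * (n - j), b p = c p) {t : ℕ} (ht : t < 2) :
    levelVec n j b t = levelVec n j c t := by
  rw [levelVec, levelVec, partner_congr (by omega) h]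
  exact vecAt_congr fun p hp => levelBit_congr_of_lt_two (by omega) h ht hp

/-- The state at the beginning of level `j` of the computation of the level bits; `f` is row `0` of
array `0`. -/
structure ReadInv (n x : ℕ) (f : ℕ → Bool) (j : ℕ) (τ : Store) : Prop where
  regs : LevelRegs τ n j
  mat : ∀ P Q, toF2 (τ.bit 5 (pos P) (pos Q)) = levelTail n x j Q P
  first : ∀ q, τ.bit 0 0 q = f q
  rows : ∀ k < j, ∀ q, τ.bit 0 (k + 1) q = (decide (q < 4 * (n - k) - 1) && levelBits n x k q)
  free : ∀ i, j < i → ∀ q, τ.bit 0 i q = false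
  free' : ∀ l, 4 * j ≤ l → ∀ q, τ.bit 3 l q = false

/-- Later levels fix the hyperbolic pair `j`, so the two columns of the tail belonging to it come
from the four transvections of level `j` alone. The second identity describes the column that is
visible once the first two transvections have been undone. -/
theorem levelTail_column {n x : ℕ} (j : Fin n) :
    levelTail n x j *ᵥ unitX j = vecAt j (levelBits n x j) ∧
    transvection (levelVec n j (levelBits n x j) 2) *ᵥ
      (transvection (levelVec n j (levelBits n x j) 3) *ᵥ (levelTail n x (j + 1) *ᵥ unitZ j)) =
      unitZ j + (1 + toF2 (levelBits n x j (2 * (n - j)))) • unitX j +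
        tailVec n j (levelBits n x j) := by
  have hX : levelTail n x (j + 1) *ᵥ unitX j = unitX j := levelTail_fixes fun w hw => by
    rw [symp_unitX]
    exact hw _ (by simp only [pos]; omega)
  have hZ : levelTail n x (j + 1) *ᵥ unitZ j = unitZ j := levelTail_fixes fun w hw => by
    rw [symp_unitZ]
    exact hw _ (by simp only [pos]; omega)
  rw [hZ, level_lower_unitZ]
  refine ⟨?_, rfl⟩
  rw [levelTail_eq j.2, ← Matrix.mulVec_mulVec, ← Matrix.mulVec_mulVec, ← Matrix.mulVec_mulVec,
    ← Matrix.mulVec_mulVec, hX, level_lower_unitX, level_upper_unitX]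
  exact exists_bit_levelNum (by omega) _

/-- One multiplication by a transvection inside `readLevelBody`. -/
theorem applyRow_run {n j t c : ℕ} {σ : Store} {h : Vec n}
    {M N : Matrix (Fin n ⊕ Fin n) (Fin n ⊕ Fin n) (ZMod 2)} (hσ : LevelRegs σ n j)
    (hc : σ.reg c = 4 * j + t) (hh : HoldsRow σ (4 * j + t) h)
    (hM : ∀ P Q, toF2 (σ.bit 5 (pos P) (pos Q)) = M Q P) (hN : transvection h * M = N) :
    LevelRegs ((Prog.copy 30 c ;; applyProg 5 4 3).run σ) n j ∧
    (∀ P Q, toF2 (((Prog.copy 30 c ;; applyProg 5 4 3).run σ).bit 5 (pos P) (pos Q)) = N Q P) ∧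
    (∀ i q, ((Prog.copy 30 c ;; applyProg 5 4 3).run σ).bit 0 i q = σ.bit 0 i q) ∧
    (∀ i q, ((Prog.copy 30 c ;; applyProg 5 4 3).run σ).bit 3 i q = σ.bit 3 i q) ∧
    ((Prog.copy 30 c ;; applyProg 5 4 3).run σ).reg 14 = σ.reg 14 := by
  refine ⟨hσ.run _ (by simp [Prog.regs]), fun P Q => ?_,
    Prog.run_bit_of_notMem _ _ (by simp [Prog.arrays]),
    Prog.run_bit_of_notMem _ _ (by simp [Prog.arrays]),
    Prog.run_reg_of_notMem _ _ (by simp [Prog.regs])⟩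
  rw [← hN, Prog.run_seq, applyProg_run_left (n := n) (h := h) (M := M)]
  · simp [hσ.reg0]
  · simp [hσ.reg2]
  · simp [hσ.reg4]
  · have e : ((Prog.copy 30 c).run σ).reg 30 = 4 * j + t := by simp [hc]
    rw [e]
    exact hh
  · exact hM

/-- The vectors are computed twice. The first computation uses the first column and only its first
two rows are meaningful, which is enough to uncover the second column; the second computation then
has all bits of the level. -/
theorem ReadInv.step {n x j : ℕ} {f : ℕ → Bool} {τ : Store} (h : ReadInv n x f j τ)
    (hj : j < n) : ReadInv n x f (j + 1) (readLevelBody.run (τ.setReg 20 j)) := by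
  obtain ⟨hcolX, hcolZ⟩ := levelTail_column (x := x) (⟨j, hj⟩ : Fin n)
  simp only at hcolX hcolZ
  have htail := levelTail_eq (x := x) hj
  have hnew : ∀ k, k = j → levelBits n x k = levelBits n x j := by rintro _ rfl; rfl
  set b := levelBits n x j with hb
  set T : ℕ → Matrix (Fin n ⊕ Fin n) (Fin n ⊕ Fin n) (ZMod 2) :=
    fun t => transvection (levelVec n j b t) with hT
  have hTT : ∀ t M, T t * (T t * M) = M := fun t M => by
    rw [← Matrix.mul_assoc, transvection_mul_self, Matrix.one_mul]
  set M := levelTail n x (j + 1) with hM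
  replace htail : levelTail n x j = T 0 * (T 1 * (T 2 * (T 3 * M))) := htail
  clear_value b M
  -- the registers
  set τ₀ := (Prog.copy 14 20 ;; .succ 14).run (τ.setReg 20 j) with hτ₀
  have e14 : τ₀.reg 14 = j + 1 := by simp [hτ₀]
  have b0 : τ₀.bit = τ.bit := rfl
  have r0 : LevelRegs τ₀ n j := h.regs.congr fun r hr => by
    fin_cases hr <;> simp [hτ₀]
  clear_value τ₀
  -- the first column
  obtain ⟨f1, f2⟩ := readFirstProg_run τ₀
  set τ₁ := readFirstProg.run τ₀ with hτ₁
  clear_value τ₁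
  have r1 : LevelRegs τ₁ n j := hτ₁ ▸ r0.run readFirstProg (by decide)
  have e14₁ : τ₁.reg 14 = j + 1 := by rw [hτ₁, Prog.run_reg_of_notMem _ _ (by decide), e14]
  have b₁ : ∀ a, a ≠ 0 → ∀ i q, τ₁.bit a i q = τ.bit a i q := fun a ha i q =>
    b0 ▸ hτ₁ ▸ Prog.run_bit_of_notMem readFirstProg _
      (by simpa [readFirstProg, Prog.arrays] using ha) i q
  have hlow : ∀ q < 2 * (n - j), τ₁.bit 0 (j + 1) q = b q := by
    intro q hq
    rw [← e14, f2, r0.reg7, if_pos hq, r0.reg8, b0]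
    obtain ⟨Q, hQ⟩ := exists_pos (n := n) (k := 2 * j + q) (by omega)
    apply toF2_injective
    rw [← hQ, ← vecAt_apply (c := b) hQ, ← hcolX]
    have := h.mat (Sum.inl ⟨j, hj⟩) Q
    rw [unitX, Matrix.mulVec_single_one]
    exact this
  have hhigh : ∀ q, 2 * (n - j) ≤ q → τ₁.bit 0 (j + 1) q = false := by
    intro q hq
    rw [← e14, f2, r0.reg7, if_neg (by omega), e14, b0, h.free _ (by omega)]
  obtain ⟨v1, v2, v3⟩ := vectorsProg_run r1 hj (b := τ₁.bit 0 (j + 1))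
    (fun q => by rw [e14₁])
    (fun t _ q _ => by rw [b₁ 3 (by decide)]; exact h.free' _ (by omega) q)
  set τ₂ := vectorsProg.run τ₁ with hτ₂
  clear_value τ₂
  have r2 : LevelRegs τ₂ n j := hτ₂ ▸ r1.run vectorsProg (by decide)
  have e14₂ : τ₂.reg 14 = j + 1 := by rw [hτ₂, Prog.run_reg_of_notMem _ _ (by decide), e14₁]
  have b0₂ : ∀ i q, τ₂.bit 0 i q = τ₁.bit 0 i q :=
    hτ₂ ▸ Prog.run_bit_of_notMem _ _ (by decide)
  have b5₂ : ∀ i q, τ₂.bit 5 i q = τ.bit 5 i q := fun i q => by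
    rw [hτ₂, Prog.run_bit_of_notMem _ _ (by decide), b₁ 5 (by decide)]
  -- Only the first two vectors are claimed here, since they ignore the bits that have not yet been
  -- read.
  have hvec : ∀ t < 2, HoldsRow τ₂ (4 * j + t) (levelVec n j b t) := fun t ht => by
    rw [← levelVec_congr_of_lt_two hj hlow ht]
    exact v1 t (by omega)
  -- the first two transvections
  obtain ⟨r3, m3, z3, a3, e14₃⟩ := applyRow_run (t := 0) (c := 25) r2 r2.reg25 (hvec 0 (by omega))
    (M := levelTail n x j) (N := T 1 * (T 2 * (T 3 * M)))
    (fun P Q => by rw [b5₂]; exact h.mat P Q) (by rw [htail]; exact hTT 0 _)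
  set τ₃ := (Prog.copy 30 25 ;; applyProg 5 4 3).run τ₂ with hτ₃
  clear_value τ₃
  obtain ⟨r4, m4, z4, a4, e14₄⟩ := applyRow_run (t := 1) (c := 26) r3 r3.reg26
    (h := levelVec n j b 1) (fun P => by rw [a3]; exact hvec 1 (by omega) P)
    (N := T 2 * (T 3 * M)) m3 (hTT 1 _)
  set τ₄ := (Prog.copy 30 26 ;; applyProg 5 4 3).run τ₃ with hτ₄
  clear_value τ₄
  -- the second column
  obtain ⟨s1, s2, s3, s4⟩ := readSecondProg_run r4.reg5 (by rw [r4.reg7]; omega)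
  set τ₅ := readSecondProg.run τ₄ with hτ₅
  clear_value τ₅
  have r5 : LevelRegs τ₅ n j := hτ₅ ▸ r4.run readSecondProg (by decide)
  have e14₄' : τ₄.reg 14 = j + 1 := by rw [e14₄, e14₃, e14₂]
  have e14₅ : τ₅.reg 14 = j + 1 := by rw [hτ₅, Prog.run_reg_of_notMem _ _ (by decide), e14₄']
  have b₅ : ∀ a, a ≠ 0 → ∀ i q, τ₅.bit a i q = τ₄.bit a i q := fun a ha i q =>
    hτ₅ ▸ Prog.run_bit_of_notMem readSecondProg _
      (by simpa [readSecondProg, Prog.arrays] using ha) i q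
  rw [e14₄'] at s1 s2 s3 s4
  rw [r4.reg7, r4.reg29, r4.reg8] at s2 s3
  rw [r4.reg7] at s4
  have hz : ∀ q, τ₄.bit 0 (j + 1) q = τ₁.bit 0 (j + 1) q := fun q => by rw [z4, z3, b0₂]
  have hcol : ∀ Q, toF2 (τ₄.bit 5 (2 * j + 1) (pos Q)) =
      (unitZ ⟨j, hj⟩ + (1 + toF2 (b (2 * (n - j)))) • unitX ⟨j, hj⟩ +
        tailVec n j b : Vec n) Q := by
    intro Q
    rw [← hcolZ, Matrix.mulVec_mulVec, Matrix.mulVec_mulVec, Matrix.mul_assoc, unitZ,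
      Matrix.mulVec_single_one]
    exact m4 (Sum.inr ⟨j, hj⟩) Q
  have hrow : ∀ q, τ₅.bit 0 (j + 1) q = (decide (q < 4 * (n - j) - 1) && b q) := by
    intro q
    by_cases hq1 : q < 2 * (n - j)
    · rw [s4 q (Or.inl hq1), hz, hlow q hq1, decide_eq_true (by omega), Bool.true_and]
    by_cases hq2 : q = 2 * (n - j)
    · rw [hq2, s2, decide_eq_true (by omega), Bool.true_and]
      apply toF2_injective
      have h1 := hcol (Sum.inl ⟨j, hj⟩)
      have h2 : (tailVec n j b : Vec n) (Sum.inl ⟨j, hj⟩) = 0 := by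
        rw [tailVec, vecAt_apply (p := 0) (by simp [pos])]
        simp
      simp only [Pi.add_apply, Pi.smul_apply, h2, unitZ, unitX, Pi.single_eq_same, smul_eq_mul,
        mul_one, add_zero] at h1
      rw [Pi.single_eq_of_ne (by simp), zero_add] at h1
      rw [toF2_not]
      change 1 + toF2 (τ₄.bit 5 (2 * j + 1) (pos (Sum.inl (⟨j, hj⟩ : Fin n)))) = _
      rw [h1, ← add_assoc, CharTwo.add_self_eq_zero, zero_add]
    by_cases hq3 : q < 4 * (n - j) - 1
    · obtain ⟨p, rfl⟩ := Nat.exists_eq_add_of_le (show 2 * (n - j) - 1 ≤ q by omega)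
      rw [s3 p (by omega) (by omega), decide_eq_true (by omega), Bool.true_and]
      obtain ⟨Q, hQ⟩ := exists_pos (n := n) (k := 2 * j + p) (by omega)
      apply toF2_injective
      rw [← hQ, hcol Q]
      have hX : (unitX ⟨j, hj⟩ : Vec n) Q = 0 := Pi.single_eq_of_ne (by
        rintro rfl
        simp only [pos] at hQ
        omega) _
      have hZ : (unitZ ⟨j, hj⟩ : Vec n) Q = 0 := Pi.single_eq_of_ne (by
        rintro rfl
        simp only [pos] at hQ
        omega) _
      simp only [Pi.add_apply, Pi.smul_apply, hX, hZ, smul_zero, zero_add, tailVec]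
      rw [vecAt_apply hQ, decide_eq_false (by omega), Bool.not_false, Bool.true_and]
    · rw [s4 q (Or.inr (by omega)), hz, hhigh q (by omega), decide_eq_false (by omega),
        Bool.false_and]
  have b3₅ : ∀ i q, τ₅.bit 3 i q = τ₂.bit 3 i q := fun i q => by
    rw [b₅ 3 (by decide), a4, a3]
  obtain ⟨w1, -, w3⟩ := vectorsProg_run r5 hj (b := τ₅.bit 0 (j + 1))
    (fun q => by rw [e14₅])
    (fun t ht q hq => by rw [b3₅]; exact v2 t ht q hq)
  set τ₆ := vectorsProg.run τ₅ with hτ₆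
  clear_value τ₆
  have r6 : LevelRegs τ₆ n j := hτ₆ ▸ r5.run vectorsProg (by decide)
  -- The row is cut off at the `4m - 1` bits of the level, and the vectors depend on no other bits.
  have hvec' : ∀ t < 4, HoldsRow τ₆ (4 * j + t) (levelVec n j b t) := fun t ht => by
    have := w1 t ht
    rwa [levelVec_congr hj (c := b)] at this
    intro p hp
    rw [hrow, decide_eq_true hp, Bool.true_and]
  have b0₆ : ∀ i q, τ₆.bit 0 i q = τ₅.bit 0 i q :=
    hτ₆ ▸ Prog.run_bit_of_notMem _ _ (by decide)
  have b5₆ : ∀ i q, τ₆.bit 5 i q = τ₄.bit 5 i q := fun i q => by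
    rw [hτ₆, Prog.run_bit_of_notMem _ _ (by decide), b₅ 5 (by decide)]
  -- the other two transvections
  obtain ⟨r7, m7, z7, a7, -⟩ := applyRow_run (t := 2) (c := 27) r6 r6.reg27 (hvec' 2 (by omega))
    (M := T 2 * (T 3 * M)) (N := T 3 * M) (fun P Q => by rw [b5₆]; exact m4 P Q) (hTT 2 _)
  set τ₇ := (Prog.copy 30 27 ;; applyProg 5 4 3).run τ₆ with hτ₇
  clear_value τ₇
  obtain ⟨r8, m8, z8, a8, -⟩ := applyRow_run (t := 3) (c := 28) r7 r7.reg28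
    (h := levelVec n j b 3) (fun P => by rw [a7]; exact hvec' 3 (by omega) P) (N := M) m7 (hTT 3 _)
  set τ₈ := (Prog.copy 30 28 ;; applyProg 5 4 3).run τ₇ with hτ₈
  clear_value τ₈
  have hrun : readLevelBody.run (τ.setReg 20 j) = levelNextProg.run τ₈ := by
    simp only [hτ₈, hτ₇, hτ₆, hτ₅, hτ₄, hτ₃, hτ₂, hτ₁, hτ₀, readLevelBody, Prog.run_seq]
  rw [hrun]
  have b₉ : ∀ a i q, (levelNextProg.run τ₈).bit a i q = τ₈.bit a i q := fun a i q =>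
    Prog.run_bit_of_notMem _ _ List.not_mem_nil i q
  have hz9 : ∀ i q, (levelNextProg.run τ₈).bit 0 i q = τ₅.bit 0 i q := fun i q => by
    rw [b₉, z8, z7, b0₆]
  have hz5 : ∀ i, i ≠ j + 1 → ∀ q, τ₅.bit 0 i q = τ.bit 0 i q := fun i hi q => by
    rw [s1 i hi, z4, z3, b0₂, f1 i (by omega), b0]
  refine ⟨levelNextProg_run r8 hj, fun P Q => ?_, fun q => ?_, fun k hk q => ?_,
    fun i hi q => ?_, fun l hl q => ?_⟩
  · rw [b₉, m8, hM]
  · rw [hz9, hz5 _ (by omega), h.first]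
  · rw [hz9]
    by_cases hkj : k = j
    · rw [hnew k hkj, hkj, hrow]
    · rw [hz5 _ (by omega), h.rows k (by omega)]
  · rw [hz9, hz5 _ (by omega), h.free _ (by omega)]
  · rw [b₉, a8, a7, w3 _ (by omega), b3₅, v3 _ (by omega), b₁ 3 (by decide), h.free' _ (by omega)]

/-- The computation of the bits of all levels. -/
def readLevelsProg : Prog := .loop 20 0 readLevelBody

theorem readLevelsProg_run {n x : ℕ} {f : ℕ → Bool} {σ : Store} (h : ReadInv n x f 0 σ) :
    ReadInv n x f n (readLevelsProg.run σ) := by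
  have key := Prog.loop_invariant (x := 20) (y := 0) (σ := σ) (c := readLevelBody)
    (ReadInv n x f) h (fun k hk τ _ _ hI => hI.step (by rwa [h.regs.reg0] at hk))
  rwa [h.regs.reg0] at key

/-! ### From the level bits to the index -/

/-- One round of `solveProg`. -/
def solveBody : Prog :=
  .store 0 13 16 (.xor (.xor (.cell 0 14 21) (.cell 0 14 17)) (.cell 7 4 4)) ;;
  .store 7 4 4 (majExp (.cell 0 14 17) (.cell 0 13 16) (.cell 7 4 4)) ;; .succ 16 ;; .succ 17

/-- Row `reg 13` of array `0` receives, from position `reg 6` on, the number `x` for which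
`levelNum m x` is in row `reg 14`; here `reg 11 = 2m`. -/
def solveProg : Prog :=
  .copy 16 6 ;; .copy 17 11 ;; .store 7 4 4 (.const true) ;; .loop 21 3 solveBody

@[simp] theorem solveProg_regs : solveProg.regs = [16, 17, 21, 16, 17] := rfl

theorem solveBody_run {τ : Store} (h4 : τ.reg 4 = 0) (hne : τ.reg 14 ≠ τ.reg 13) :
    (solveBody.run τ).reg 16 = τ.reg 16 + 1 ∧
    (solveBody.run τ).reg 17 = τ.reg 17 + 1 ∧
    (solveBody.run τ).bit 7 0 0 = majority (τ.bit 0 (τ.reg 14) (τ.reg 17))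
      (τ.bit 0 (τ.reg 14) (τ.reg 21) ^^ τ.bit 0 (τ.reg 14) (τ.reg 17) ^^ τ.bit 7 0 0)
      (τ.bit 7 0 0) ∧
    ∀ i q, (solveBody.run τ).bit 0 i q = if i = τ.reg 13 ∧ q = τ.reg 16 then
      (τ.bit 0 (τ.reg 14) (τ.reg 21) ^^ τ.bit 0 (τ.reg 14) (τ.reg 17) ^^ τ.bit 7 0 0)
      else τ.bit 0 i q := by
  simp [solveBody, h4, hne]

/-- The relation `y + x + 1 = z` is now solved for `x`: both summand `y` and sum `z` are visible in
one row, as bits `2m + k` and `k`, so each bit of `x` is their exclusive or with the carry. -/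
theorem solveProg_run {σ : Store} {m x : ℕ} (h4 : σ.reg 4 = 0) (h11 : σ.reg 11 = 2 * m)
    (hm : 0 < m) (hL : x < 2 ^ σ.reg 3) (hne : σ.reg 14 ≠ σ.reg 13)
    (hz : ∀ q, σ.bit 0 (σ.reg 14) q = (levelNum m x).testBit q)
    (h0 : ∀ q, σ.reg 6 ≤ q → σ.bit 0 (σ.reg 13) q = false) :
    (∀ i, i ≠ σ.reg 13 → ∀ q, (solveProg.run σ).bit 0 i q = σ.bit 0 i q) ∧
    (∀ q < σ.reg 6, (solveProg.run σ).bit 0 (σ.reg 13) q = σ.bit 0 (σ.reg 13) q) ∧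
    ∀ t, (solveProg.run σ).bit 0 (σ.reg 13) (σ.reg 6 + t) = x.testBit t := by
  set σ₁ := (Prog.copy 16 6 ;; .copy 17 11 ;; .store 7 4 4 (.const true)).run σ with hσ₁
  have hrun : solveProg.run σ = (Prog.loop 21 3 solveBody).run σ₁ := rfl
  have hr : ∀ r, r ≠ 16 → r ≠ 17 → σ₁.reg r = σ.reg r := by
    intro r h15 h16
    simp [hσ₁, h15, h16]
  have hb0 : ∀ i q, σ₁.bit 0 i q = σ.bit 0 i q := by simp [hσ₁]
  have hq : levelNum m x / 2 ^ (2 * m) = x / (4 ^ m - 1) := levelNum_div hm x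
  have hzeq : levelNum m x = x / (4 ^ m - 1) + x + 1 := levelNum_eq hm x
  set z := levelNum m x
  set y := x / (4 ^ m - 1)
  have key := Prog.loop_invariant (x := 21) (y := 3) (c := solveBody) (σ := σ₁)
    (fun k (τ : Store) => τ.reg 16 = σ.reg 6 + k ∧ τ.reg 17 = 2 * m + k ∧
      y / 2 ^ k + x / 2 ^ k + (τ.bit 7 0 0).toNat = z / 2 ^ k ∧
      (∀ i, i ≠ σ.reg 13 → ∀ q, τ.bit 0 i q = σ.bit 0 i q) ∧
      ∀ q, τ.bit 0 (σ.reg 13) q = if σ.reg 6 ≤ q ∧ q < σ.reg 6 + k then x.testBit (q - σ.reg 6)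
        else σ.bit 0 (σ.reg 13) q)
    (by
      refine ⟨by simp [hσ₁], by simp [hσ₁, h11], ?_, fun i _ q => hb0 i q, fun q => ?_⟩
      · have : σ₁.bit 7 0 0 = true := by simp [hσ₁, h4]
        rw [this, pow_zero, Nat.div_one, Nat.div_one, Nat.div_one, hzeq]
        rfl
      · rw [hb0, if_neg (by omega)])
    (by
      rintro k hk τ hreg hbit ⟨h16, h17, hc, hI, hI'⟩
      have e : ∀ r, r ∉ [16, 17, 21] → τ.reg r = σ.reg r := by
        intro r hr'
        simp only [List.mem_cons, List.not_mem_nil, or_false, not_or] at hr'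
        rw [hreg r (by simp [Prog.regs, solveBody, hr']), hr r hr'.1 hr'.2.1]
      obtain ⟨f16, f17, f7, f0⟩ := solveBody_run (τ := τ.setReg 21 k)
        (by simp [e 4 (by decide), h4])
        (by simpa [e 14 (by decide), e 13 (by decide)] using hne)
      have hrow : ∀ q, τ.bit 0 (σ.reg 14) q = z.testBit q := fun q => by rw [hI _ hne, hz]
      have hyk : z.testBit (2 * m + k) = y.testBit k := by
        rw [← hq, Nat.testBit_div_two_pow, add_comm]
      simp only [Store.setReg_reg, Store.setReg_bit, Nat.reduceEqDiff, if_false, if_true,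
        e 14 (by decide), e 13 (by decide), h16, h17, hrow, hyk] at f16 f17 f7 f0
      obtain ⟨g1, g2⟩ := carry_step hc
      have hnew : (z.testBit k ^^ y.testBit k ^^ τ.bit 7 0 0) = x.testBit k := by
        rw [← g1]
        cases y.testBit k <;> cases x.testBit k <;> cases τ.bit 7 0 0 <;> rfl
      rw [hnew] at f7
      simp only [hnew] at f0
      refine ⟨f16, f17, by rw [f7]; exact g2, fun i hi q => ?_, fun q => ?_⟩
      · rw [f0, if_neg (by simp [hi]), hI i hi]
      · rw [f0]
        by_cases hqk : q = σ.reg 6 + k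
        · rw [if_pos ⟨rfl, hqk⟩, if_pos (by omega), hqk, Nat.add_sub_cancel_left]
        · rw [if_neg (by simp [hqk]), hI']
          exact if_congr (by omega) rfl rfl)
  rw [hr 3 (by decide) (by decide), ← hrun] at key
  obtain ⟨-, -, -, k1, k2⟩ := key
  refine ⟨k1, fun q hq => ?_, fun t => ?_⟩
  · rw [k2, if_neg (by omega)]
  · rw [k2]
    split_ifs with ht
    · rw [Nat.add_sub_cancel_left]
    · rw [h0 _ (by omega), Nat.testBit_lt_two_pow
        (hL.trans_le (Nat.pow_le_pow_right (by omega) (by omega)))]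

/-- One round of `solveLevelsProg`. -/
def solveLevelBody : Prog :=
  .copy 14 13 ;; .pred 13 ;; .succ 11 ;; .succ 11 ;; .succ 9 ;; .succ 9 ;; .succ 9 ;; .succ 9 ;;
  .copy 6 9 ;; .ite (.lt 4 13) .skip (.copy 6 2) ;; solveProg

/-- Computes the index from the bits of all levels. -/
def solveLevelsProg : Prog :=
  .copy 13 0 ;; .zero 11 ;; .zero 9 ;; .succ 9 ;; .succ 9 ;; .succ 9 ;; .loop 20 0 solveLevelBody

/-- The state of `solveLevelsProg` after `k` rounds. -/
structure SolveInv (σ : Store) (n x k : ℕ) (τ : Store) : Prop where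
  reg13 : τ.reg 13 = n - k
  reg11 : τ.reg 11 = 2 * k
  reg9 : τ.reg 9 = 4 * k + 3
  low : ∀ i q, i ≤ n - k → q < levelOffset n i ∨ i < n - k → τ.bit 0 i q = σ.bit 0 i q
  index : ∀ t, τ.bit 0 (n - k) (levelOffset n (n - k) + t) = (levelIndex n x (n - k)).testBit t

/-- Row `j + 1` holds the level bits followed by the index of the next level, which together are the
complete code of the index of level `j`. Solving it writes that index into row `j` behind the bits
already there. -/
theorem SolveInv.step {σ τ : Store} {n x k : ℕ} {f : ℕ → Bool} (hσ : ReadInv n x f n σ)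
    (hf : ∀ q, 2 * n ≤ q → f q = false) (hx : x < 2 ^ (2 * n ^ 2 + n)) (hk : k < n)
    (hτ : ∀ r < 6, τ.reg r = σ.reg r) (h : SolveInv σ n x k τ) :
    SolveInv σ n x (k + 1) (solveLevelBody.run (τ.setReg 20 k)) := by
  obtain ⟨j, rfl⟩ : ∃ j, n = j + (k + 1) := ⟨n - (k + 1), by omega⟩
  set n := j + (k + 1) with hn
  have hnk : n - k = j + 1 := by omega
  have hnk' : n - (k + 1) = j := by omega
  have hnj : n - j = k + 1 := by omega
  set τ₀ := (Prog.copy 14 13 ;; .pred 13 ;; .succ 11 ;; .succ 11 ;; .succ 9 ;; .succ 9 ;; .succ 9 ;;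
    .succ 9 ;; .copy 6 9 ;; .ite (.lt 4 13) .skip (.copy 6 2)).run (τ.setReg 20 k) with hτ₀
  have e4 : τ.reg 4 = 0 := by rw [hτ 4 (by omega), hσ.regs.reg4]
  have e2 : τ.reg 2 = 2 * n := by rw [hτ 2 (by omega), hσ.regs.reg2]
  have e14 : τ₀.reg 14 = j + 1 := by
    rw [hτ₀]; by_cases h0 : 0 < j <;> simp [e4, h.reg13, hnk, h0]
  have e13 : τ₀.reg 13 = j := by
    rw [hτ₀]; by_cases h0 : 0 < j <;> simp [e4, h.reg13, hnk, h0]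
  have e11 : τ₀.reg 11 = 2 * (k + 1) := by
    rw [hτ₀]; by_cases h0 : 0 < j <;> simp [e4, h.reg13, hnk, h0, h.reg11] <;> ring
  have e9 : τ₀.reg 9 = 4 * (k + 1) + 3 := by
    rw [hτ₀]; by_cases h0 : 0 < j <;> simp [e4, h.reg13, hnk, h0, h.reg9] <;> ring
  have e6 : τ₀.reg 6 = levelOffset n j := by
    rw [hτ₀, levelOffset, hnj]
    by_cases h0 : 0 < j
    · simp [e4, h.reg13, hnk, h0, h.reg9, h0.ne']; ring
    · simp [e4, h.reg13, hnk, h0, h.reg9, e2]; omega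
  have e4' : τ₀.reg 4 = 0 := by
    rw [hτ₀]; by_cases h0 : 0 < j <;> simp [e4, h.reg13, hnk, h0]
  have e3' : τ₀.reg 3 = 6 * n * n := by
    rw [← hσ.regs.reg3, ← hτ 3 (by omega), hτ₀]
    by_cases h0 : 0 < j <;> simp [e4, h.reg13, hnk, h0]
  have b0 : ∀ i q, τ₀.bit 0 i q = τ.bit 0 i q := by
    intro i q
    rw [hτ₀, Prog.run_bit_of_notMem _ _ (by decide)]
    rfl
  have hrun : solveLevelBody.run (τ.setReg 20 k) = solveProg.run τ₀ := by
    rw [hτ₀]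
    simp only [solveLevelBody, Prog.run_seq]
  rw [hrun]
  clear_value τ₀
  have hlow := h.low
  have hindex := h.index
  rw [hnk] at hlow hindex
  have hL : 2 * n ^ 2 + n ≤ 6 * n * n := by
    have : n * 1 ≤ n * n := Nat.mul_le_mul_left n (by omega)
    rw [pow_two, Nat.mul_assoc 6]
    omega
  have hoff : levelOffset n (j + 1) = 4 * (k + 1) - 1 := by
    rw [levelOffset_succ (by omega), hnj]
  obtain ⟨f1, f2, f3⟩ := solveProg_run (σ := τ₀) (m := k + 1) (x := levelIndex n x j) e4' e11
    (by omega) (by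
      rw [e3']
      exact ((levelIndex_le n x j).trans_lt hx).trans_le (Nat.pow_le_pow_right (by omega) hL))
    (by omega)
    (fun q => by
      rw [e14, b0]
      by_cases hq : q < 4 * (k + 1) - 1
      · rw [hlow _ q le_rfl (Or.inl (by rw [hoff]; exact hq)), hσ.rows j (by omega), hnj,
          decide_eq_true hq, Bool.true_and, levelBits, hnj]
      · obtain ⟨t, rfl⟩ := Nat.exists_eq_add_of_le (not_lt.1 hq)
        rw [levelNum_testBit_next (by omega), ← hoff, hindex, levelIndex, hnj])
    (fun q hq => by
      rw [e6] at hq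
      rw [e13, b0, hlow j q (by omega) (Or.inr (by omega))]
      rcases Nat.eq_zero_or_pos j with h0 | h0
      · rw [h0, levelOffset, if_pos rfl] at hq
        rw [h0, hσ.first, hf q hq]
      · obtain ⟨j', rfl⟩ : ∃ j', j = j' + 1 := ⟨j - 1, by omega⟩
        rw [levelOffset_succ (by omega)] at hq
        rw [hσ.rows j' (by omega), decide_eq_false (by omega), Bool.false_and])
  rw [e13, e6] at f2 f3
  rw [e13] at f1
  have e : ∀ r, r ∉ [16, 17, 21] → (solveProg.run τ₀).reg r = τ₀.reg r := fun r hr =>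
    Prog.run_reg_of_notMem _ _ (by
      simp only [List.mem_cons, List.not_mem_nil, or_false, not_or] at hr
      simp [hr])
  refine ⟨by rw [e 13 (by decide), e13, hnk'], by rw [e 11 (by decide), e11],
    by rw [e 9 (by decide), e9], fun i q hi hq => ?_, fun t => by rw [hnk', f3]⟩
  rw [hnk'] at hi hq
  by_cases hij : i = j
  · subst hij
    rw [f2 q (by omega), b0, hlow _ q (by omega) (Or.inr (by omega))]
  · rw [f1 i hij, b0, hlow _ q (by omega) (Or.inr (by omega))]

/-- Successive division by the level sizes exhausts an index below their product; hence the backward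
computation may start from zero cells. -/
theorem levelIndex_eq_zero {n x : ℕ} (hx : x < spOrder n) : levelIndex n x n = 0 := by
  induction n generalizing x with
  | zero =>
    rw [levelIndex]
    simp [spOrder] at hx
    exact hx
  | succ n ih =>
    rw [levelIndex_succ_succ]
    exact ih (Nat.div_lt_of_lt_mul (by rwa [← spOrder_succ]))

theorem solveLevelsProg_run {σ : Store} {n x : ℕ} {f : ℕ → Bool} (hn : 0 < n)
    (hσ : ReadInv n x f n σ) (hf : ∀ q, 2 * n ≤ q → f q = false) (hx : x < spOrder n) (q : ℕ) :
    (solveLevelsProg.run σ).bit 0 0 q = if q < 2 * n then f q else x.testBit (q - 2 * n) := by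
  set σ₁ := (Prog.copy 13 0 ;; .zero 11 ;; .zero 9 ;; .succ 9 ;; .succ 9 ;; .succ 9).run σ with hσ₁
  have b₁ : ∀ i q, σ₁.bit 0 i q = σ.bit 0 i q := by simp [hσ₁]
  have e : ∀ r < 6, σ₁.reg r = σ.reg r := by
    intro r hr
    simp [hσ₁, show r ≠ 9 by omega, show r ≠ 11 by omega, show r ≠ 13 by omega]
  have key := Prog.loop_invariant (x := 20) (y := 0) (σ := σ₁) (c := solveLevelBody)
    (SolveInv σ n x)
    (by
      refine ⟨by simp [hσ₁, hσ.regs.reg0], by simp [hσ₁], by simp [hσ₁],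
        fun i q _ _ => b₁ i q, fun t => ?_⟩
      obtain ⟨n, rfl⟩ : ∃ n', n = n' + 1 := ⟨n - 1, by omega⟩
      rw [Nat.sub_zero, levelIndex_eq_zero hx, Nat.zero_testBit, b₁, levelOffset_succ (by omega),
        hσ.rows n (by omega), decide_eq_false (by omega), Bool.false_and])
    (by
      intro k hk τ hreg _ hI
      refine hI.step hσ hf (hx.trans_le (spOrder_le n)) ?_ fun r hr => ?_
      · rwa [e 0 (by omega), hσ.regs.reg0] at hk
      · rw [← e r hr, hreg]
        simp [solveLevelBody, Prog.regs]
        omega)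
  rw [e 0 (by omega), hσ.regs.reg0] at key
  have hrun : solveLevelsProg.run σ = (Prog.loop 20 0 solveLevelBody).run σ₁ := by
    rw [hσ₁]
    simp only [solveLevelsProg, Prog.run_seq]
  rw [hrun]
  have hlow := key.low
  have hindex := key.index
  rw [Nat.sub_self, levelOffset, if_pos rfl] at hindex
  split_ifs with hq
  · rw [hlow 0 q (by omega) (Or.inl (by rwa [levelOffset, if_pos rfl])), hσ.first]
  · obtain ⟨t, rfl⟩ := Nat.exists_eq_add_of_le (not_lt.1 hq)
    rw [hindex, levelIndex, Nat.add_sub_cancel_left]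

/-- Everything in `toIndexProg` after the computation of the sizes. -/
def toIndexMain : Prog :=
  writeBitsProg ;; transposeProg ;; levelInitProg ;; readLevelsProg ;; solveLevelsProg

/-- The program that computes the index of the element with given parameters. -/
def toIndexProg : Prog := sizesProg ;; toIndexMain

theorem toIndexProg_run {n i : ℕ} (hn : 0 < n) (hi : i < cliffordOrder n) :
    HoldsIndex (toIndexProg.run (paramInput (fun j : Fin n => toF2 (i.testBit j))
      (fun j => toF2 (i.testBit (n + j))) (spElem n (i / 4 ^ n)))) i := by
  set r : Fin n → ZMod 2 := fun j => toF2 (i.testBit j) with hr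
  set s : Fin n → ZMod 2 := fun j => toF2 (i.testBit (n + j)) with hs
  set x := i / 4 ^ n with hxdef
  have hx : x < spOrder n := Nat.div_lt_of_lt_mul (by rwa [← cliffordOrder_eq])
  have hreg : ∀ r', (paramInput r s (spElem n x)).reg r' = if r' = 0 then n else 0 := fun _ => rfl
  have hin0 : ∀ j q, (paramInput r s (spElem n x)).bit 0 j q = false := by simp [paramInput]
  have hin3 : ∀ j q, (paramInput r s (spElem n x)).bit 3 j q = false := by simp [paramInput]
  have hin1 : ∀ q < n, (paramInput r s (spElem n x)).bit 1 0 q = i.testBit q ∧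
      (paramInput r s (spElem n x)).bit 1 1 q = i.testBit (n + q) := by
    intro q hq
    have h1 : (∃ j : Fin n, j.val = q ∧ r j = 1) ↔ i.testBit q = true := by
      constructor
      · rintro ⟨j, rfl, h⟩
        exact toF2_eq_one.1 h
      · exact fun h => ⟨⟨q, hq⟩, rfl, toF2_eq_one.2 h⟩
    have h2 : (∃ j : Fin n, j.val = q ∧ s j = 1) ↔ i.testBit (n + q) = true := by
      constructor
      · rintro ⟨j, rfl, h⟩
        exact toF2_eq_one.1 h
      · exact fun h => ⟨⟨q, hq⟩, rfl, toF2_eq_one.2 h⟩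
    simp [paramInput, h1, h2]
  have hin2 : ∀ P Q, toF2 ((paramInput r s (spElem n x)).bit 2 (pos P) (pos Q)) =
      (spElem n x).1 P Q := by
    intro P Q
    rw [← toF2_decide_eq_one ((spElem n x).1 P Q)]
    congr 1
    simp only [paramInput, decide_eq_decide]
    constructor
    · rintro (⟨h, -⟩ | ⟨h, -⟩ | ⟨-, p, q, hp, hq, h⟩)
      · omega
      · omega
      · rwa [← pos_injective hp, ← pos_injective hq]
    · exact fun h => Or.inr (Or.inr ⟨trivial, P, Q, rfl, rfl, h⟩)
  generalize paramInput r s (spElem n x) = σ at *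
  obtain ⟨σ₁, hσ₁⟩ : ∃ σ', σ' = sizesProg.run σ := ⟨_, rfl⟩
  obtain ⟨σ₂, hσ₂⟩ : ∃ σ', σ' = writeBitsProg.run σ₁ := ⟨_, rfl⟩
  obtain ⟨σ₃, hσ₃⟩ : ∃ σ', σ' = transposeProg.run σ₂ := ⟨_, rfl⟩
  obtain ⟨σ₄, hσ₄⟩ : ∃ σ', σ' = levelInitProg.run σ₃ := ⟨_, rfl⟩
  have hrun : toIndexProg.run σ = solveLevelsProg.run (readLevelsProg.run σ₄) := by
    simp only [toIndexProg, toIndexMain, Prog.run_seq, hσ₄, hσ₃, hσ₂, hσ₁]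
  have r1 : SizeRegs σ₁ n := hσ₁ ▸ sizesProg_run hreg
  have r2 : SizeRegs σ₂ n := hσ₂ ▸ r1.run writeBitsProg (by decide)
  have r3 : SizeRegs σ₃ n := hσ₃ ▸ r2.run transposeProg (by decide)
  have r4 : LevelRegs σ₄ n 0 := hσ₄ ▸ levelInitProg_run r3
  have b1 : ∀ a i q, σ₁.bit a i q = σ.bit a i q := fun a i q =>
    hσ₁ ▸ Prog.run_bit_of_notMem sizesProg _ List.not_mem_nil i q
  have b2 : ∀ a, a ≠ 0 → ∀ i q, σ₂.bit a i q = σ₁.bit a i q := fun a ha i q =>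
    hσ₂ ▸ Prog.run_bit_of_notMem writeBitsProg _ (by simp [writeBitsProg, Prog.arrays, ha]) i q
  have b3 : ∀ a, a ≠ 5 → ∀ i q, σ₃.bit a i q = σ₂.bit a i q := fun a ha i q =>
    hσ₃ ▸ Prog.run_bit_of_notMem transposeProg _ (by simp [transposeProg, Prog.arrays, ha]) i q
  have b4 : ∀ a i q, σ₄.bit a i q = σ₃.bit a i q := fun a i q =>
    hσ₄ ▸ Prog.run_bit_of_notMem levelInitProg _ List.not_mem_nil i q
  have hrow : ∀ j q, σ₄.bit 0 j q = (decide (j = 0 ∧ q < 2 * n) && i.testBit q) := by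
    intro j q
    rw [b4, b3 0 (by decide), hσ₂, writeBitsProg_run r1]
    split_ifs with h1 h2
    · rw [b1, (hin1 q h1.2).1, decide_eq_true (by omega), Bool.true_and]
    · rw [b1, (hin1 _ (by omega)).2, decide_eq_true (by omega), Bool.true_and]
      congr 1
      omega
    · rw [b1, hin0, decide_eq_false (by omega), Bool.false_and]
  have inv := readLevelsProg_run (n := n) (x := x) (f := fun q => decide (q < 2 * n) && i.testBit q)
    (σ := σ₄) ⟨r4, fun P Q => by
        rw [b4, hσ₃, transposeProg_run (by rw [r2.reg2]; exact pos_lt P)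
          (by rw [r2.reg2]; exact pos_lt Q), b2 2 (by decide), b1, hin2]
        rfl,
      fun q => by rw [hrow]; simp,
      fun k hk => by omega,
      fun j hj q => by rw [hrow, decide_eq_false (by omega), Bool.false_and],
      fun l _ q => by rw [b4, b3 3 (by decide), b2 3 (by decide), b1, hin3]⟩
  intro q
  rw [hrun, solveLevelsProg_run hn inv (fun q hq => by rw [decide_eq_false (by omega),
    Bool.false_and]) hx]
  split_ifs with hq
  · rw [decide_eq_true hq, Bool.true_and]
  · rw [hxdef, four_pow_eq, Nat.testBit_div_two_pow]
    congr 1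
    omega

/-! ### Step counts -/

/-- The classes of the registers that bound loops. -/
def loopClass (r : ℕ) : ℕ :=
  if r = 0 ∨ r = 23 then 1 else if r = 2 ∨ r = 7 then 2 else if r = 1 then 3 else
    if r = 3 then 4 else 0

/-- The bounds of the classes. -/
def loopBound (n k : ℕ) : ℕ :=
  if k = 1 then n else if k = 2 then 2 * n else if k = 3 then 4 * n else 6 * n * n

/-- Two classifications are needed: `sizesProg` increments the registers that bound later loops, so
its own loops are measured by register `0` alone. Afterwards these registers have their final
values, and `7` and `23` are still zero. -/
theorem sizesProg_seq_time {σ : Store} {n : ℕ} (hσ : ∀ r, σ.reg r = if r = 0 then n else 0)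
    {c : Prog} (hc : c.Tame loopClass) : (sizesProg ;; c).time σ ≤
      sizesProg.cost (fun r => if r = 0 then 1 else 0) (fun _ => n) +
        c.cost loopClass (loopBound n) := by
  refine Nat.add_le_add (Prog.time_le_cost _ (fun r _ => ?_) ?_).1 (Prog.time_le_cost _ ?_ hc).1
  · rw [hσ]
    split_ifs <;> omega
  · simp only [sizesProg, Prog.Tame]
    decide
  · have h := sizesProg_run hσ
    have e : ∀ r ∈ [7, 23], (sizesProg.run σ).reg r = 0 := by
      intro r hr
      rw [Prog.run_reg_of_notMem, hσ, if_neg] <;> fin_cases hr <;> decide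
    intro r hr
    simp only [loopClass] at hr ⊢
    split_ifs at hr ⊢ with h1 h2 h3 h4
    · rcases h1 with rfl | rfl
      · rw [h.reg0]; rfl
      · rw [e _ (by decide)]; exact Nat.zero_le _
    · rcases h2 with rfl | rfl
      · rw [h.reg2]; rfl
      · rw [e _ (by decide)]; exact Nat.zero_le _
    · rw [h3, h.reg1]; rfl
    · rw [h4, h.reg3]; rfl
    · exact absurd rfl hr

/-- The dominant costs are `n` levels with carry passes of length `6n²`, and `4n` rank-one updates
of a `2n × 2n` matrix. Since `n ≥ 1`, lower powers of `n` are absorbed into `n³`; the constant is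
generous. -/
theorem toElementProg_time {n i : ℕ} (hn : 0 < n) :
    toElementProg.time (indexInput n i) ≤ 100000 * n ^ 3 := by
  refine (sizesProg_seq_time (n := n) (fun _ => rfl) ?_).trans ?_
  · simp only [toElementMain, readBitsProg, levelInitProg, levelsProg, productProg, remProg,
      remBody, quotProg, quotBody, vectorsProg, partnerProg, partnerBody, levelProg, levelBody,
      levelNextProg, applyProg, swapProg, swapBody, rankOneProg, Prog.Tame]
    simp [loopClass]
  · have h1 : 1 ≤ n ^ 3 := Nat.one_le_pow _ _ hn
    have h2 : n ≤ n ^ 3 := Nat.le_self_pow (by omega) n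
    have h3 : n ^ 2 ≤ n ^ 3 := Nat.pow_le_pow_right hn (by omega)
    simp only [sizesProg, toElementMain, readBitsProg, levelInitProg, levelsProg, productProg,
      remProg, remBody, quotProg, quotBody, vectorsProg, partnerProg, partnerBody, levelProg,
      levelBody, levelNextProg, applyProg, swapProg, swapBody, rankOneProg, Prog.cost,
      BitExp.size, majExp, auxExp]
    simp [loopClass, loopBound]
    ring_nf
    linarith

theorem toIndexProg_time {n : ℕ} (hn : 0 < n) (r s : Fin n → ZMod 2) (S : Sp n) :
    toIndexProg.time (paramInput r s S) ≤ 100000 * n ^ 3 := by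
  refine (sizesProg_seq_time (n := n) (fun _ => rfl) ?_).trans ?_
  · simp only [toIndexMain, writeBitsProg, transposeProg, levelInitProg, readLevelsProg,
      readLevelBody, readFirstProg, readSecondProg, solveLevelsProg, solveLevelBody, solveProg,
      solveBody, vectorsProg, partnerProg, partnerBody, levelProg, levelBody,
      levelNextProg, applyProg, swapProg, swapBody, rankOneProg, Prog.Tame]
    simp [loopClass]
  · have h1 : 1 ≤ n ^ 3 := Nat.one_le_pow _ _ hn
    have h2 : n ≤ n ^ 3 := Nat.le_self_pow (by omega) n
    have h3 : n ^ 2 ≤ n ^ 3 := Nat.pow_le_pow_right hn (by omega)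
    simp only [sizesProg, toIndexMain, writeBitsProg, transposeProg, levelInitProg, readLevelsProg,
      readLevelBody, readFirstProg, readSecondProg, solveLevelsProg, solveLevelBody, solveProg,
      solveBody, vectorsProg, partnerProg, partnerBody, levelProg, levelBody,
      levelNextProg, applyProg, swapProg, swapBody, rankOneProg, Prog.cost,
      BitExp.size, majExp, auxExp]
    simp [loopClass, loopBound]
    ring_nf
    linarith

/-! ### Order and indexing of the Clifford group -/

theorem card_CliffordGroup (n : ℕ) : Nat.card (CliffordGroup n) = cliffordOrder n := by
  obtain ⟨Φ, -⟩ := clifford_structure (n := n) exists_transvection_prod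
  rw [Nat.card_congr Φ, Nat.card_prod, Nat.card_prod, card_Sp, cliffordOrder_eq]
  congr 1
  rw [Nat.card_eq_fintype_card, Fintype.card_fun, ZMod.card, Fintype.card_fin, ← mul_pow]
  norm_num

/-- The parameters of the Clifford element with index `i`. -/
def indexParams (n i : ℕ) : ((Fin n → ZMod 2) × (Fin n → ZMod 2)) × Sp n :=
  ((fun j => toF2 (i.testBit j), fun j => toF2 (i.testBit (n + j))), spElem n (i / 4 ^ n))

/-- An index splits into its lowest `2n` binary digits, which are the arbitrary sign bits `r` and
`s`, and the quotient by `4^n`, which runs through the indices of the symplectic group. -/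
theorem indexParams_bijOn (n : ℕ) :
    Set.BijOn (indexParams n) (Set.Iio (cliffordOrder n)) Set.univ := by
  have hdiv : ∀ {i}, i < cliffordOrder n → i / 4 ^ n < spOrder n := fun h =>
    Nat.div_lt_of_lt_mul (by rwa [← cliffordOrder_eq])
  refine ⟨Set.mapsTo_univ _ _, fun i hi i' hi' h => ?_, ?_⟩
  · simp only [indexParams, Prod.mk.injEq] at h
    obtain ⟨⟨hr, hs⟩, hS⟩ := h
    have h1 := (spElem_bijOn n).injOn (hdiv hi) (hdiv hi') hS
    have h2 : i % 4 ^ n = i' % 4 ^ n := by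
      apply Nat.eq_of_testBit_eq
      intro q
      rw [four_pow_eq, Nat.testBit_mod_two_pow, Nat.testBit_mod_two_pow]
      by_cases hq : q < n
      · rw [toF2_injective (congrFun hr ⟨q, hq⟩)]
      · by_cases hq' : q < 2 * n
        · have := toF2_injective (congrFun hs ⟨q - n, by omega⟩)
          simp only [Nat.add_sub_cancel' (not_lt.1 hq)] at this
          rw [this]
        · simp [hq']
    rw [← Nat.div_add_mod i (4 ^ n), ← Nat.div_add_mod i' (4 ^ n), h1, h2]
  · refine fun p _ => ?_
    obtain ⟨⟨r, s⟩, S⟩ := p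
    obtain ⟨x, hx, rfl⟩ := (spElem_bijOn n).surjOn (Set.mem_univ S)
    let b : Fin (2 * n) → Bool := fun q =>
      if h : q.val < n then decide (r ⟨q, h⟩ = 1) else decide (s ⟨q - n, by omega⟩ = 1)
    have hb : Nat.ofBits b < 4 ^ n := by
      rw [four_pow_eq]
      exact Nat.ofBits_lt_two_pow _
    have hbit : ∀ q (hq : q < 2 * n),
        (4 ^ n * x + Nat.ofBits b).testBit q = b ⟨q, hq⟩ := by
      intro q hq
      rw [four_pow_eq, Nat.testBit_two_pow_mul_add _ (by rwa [← four_pow_eq]), if_pos hq,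
        Nat.testBit_ofBits_lt _ _ hq]
    refine ⟨4 ^ n * x + Nat.ofBits b, ?_, ?_⟩
    · rw [Set.mem_Iio, cliffordOrder_eq]
      calc 4 ^ n * x + Nat.ofBits b < 4 ^ n * x + 4 ^ n := by omega
        _ = 4 ^ n * (x + 1) := by ring
        _ ≤ _ := Nat.mul_le_mul_left _ hx
    · refine Prod.ext (Prod.ext (funext fun j => ?_) (funext fun j => ?_)) ?_
      · change toF2 _ = r j
        rw [hbit j (by omega), ← toF2_decide_eq_one (r j)]
        simp [b]
      · change toF2 _ = s j
        rw [hbit (n + j) (by omega), ← toF2_decide_eq_one (s j)]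
        simp [b]
      · change spElem n _ = spElem n x
        rw [Nat.mul_add_div (by positivity), Nat.div_eq_of_lt hb, add_zero]

end Clif

end

open Clif
theorem mainTheorem3 :
    -- a Clifford element is a Pauli element `(r, s)` together with a symplectic matrix
    (∀ n : ℕ,
      ∃ (Φ : CliffordGroup n ≃ ((Fin n → ZMod 2) × (Fin n → ZMod 2)) × Sp n)
        (φ : (CliffordGroup n ⧸ pauliClasses n) ≃* Sp n),
        (∀ (U : pauliNormalizer n) (r s : Fin n → ZMod 2) (S : Sp n),
          ActsAs U.1 r s S ↔ Φ (toClifford U) = ((r, s), S)) ∧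
        (∀ c : CliffordGroup n, φ (QuotientGroup.mk c) = (Φ c).2) ∧
        Function.Bijective (fun p : pauliClasses n => (Φ p.1).1) ∧
        (∀ c : CliffordGroup n, ∀ p ∈ pauliClasses n,
          Φ (c * p) = ((Φ c).1 + (Φ p).1, (Φ c).2))) ∧
    -- the order of the Clifford group
    (∀ n : ℕ, Nat.card (CliffordGroup n) = cliffordOrder n) ∧
    -- the canonical indexing of the symplectic and of the Clifford group, computable in both
    -- directions in time `O(n³)`
    (∃ (sp : (n : ℕ) → ℕ → Sp n) (g : (n : ℕ) → ℕ → CliffordGroup n)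
        (toElement toIndex : Prog) (K : ℕ),
      (∀ n : ℕ, Set.BijOn (sp n) (Set.Iio (spOrder n)) Set.univ) ∧
      (∀ n : ℕ, ∃ rep : ℕ → Sp (n + 1),
        ∀ c < 2 ^ (2 * n + 1) * (4 ^ (n + 1) - 1),
          (∀ p, (rep c).1 p (Sum.inl 0) =
            toF2 ((c % (4 ^ (n + 1) - 1) + 1).testBit (pos p))) ∧
          ∀ q < spOrder n,
            (sp (n + 1) (c + 2 ^ (2 * n + 1) * (4 ^ (n + 1) - 1) * q)).1 =
              (rep c).1 * oneTwoSum (sp n q).1) ∧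
      (∀ n : ℕ, Set.BijOn (g n) (Set.Iio (cliffordOrder n)) Set.univ) ∧
      (∀ n : ℕ, 1 ≤ n → ∀ i < cliffordOrder n,
        ∃ (r s : Fin n → ZMod 2) (S : Sp n),
          (∀ j : Fin n, r j = toF2 (i.testBit j) ∧ s j = toF2 (i.testBit (n + j))) ∧
          S = sp n (i / 4 ^ n) ∧
          (∀ U : pauliNormalizer n, toClifford U = g n i ↔ ActsAs U.1 r s S) ∧
          HoldsParams (toElement.run (indexInput n i)) r s S ∧
          (∃ hs : List (Vec n), hs.length ≤ 4 * n ∧ (hs.map transvection).prod = S.1 ∧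
            HoldsVectors (toElement.run (indexInput n i)) hs) ∧
          toElement.time (indexInput n i) ≤ K * n ^ 3 ∧
          HoldsIndex (toIndex.run (paramInput r s S)) i ∧
          toIndex.time (paramInput r s S) ≤ K * n ^ 3)) := by
  have hΦ := fun n => clifford_structure (n := n) exists_transvection_prod
  refine ⟨hΦ, card_CliffordGroup, ?_⟩
  choose Φ φ h1 _ _ _ using hΦ
  refine ⟨spElem, fun n i => (Φ n).symm (indexParams n i), toElementProg, toIndexProg, 100000,
    spElem_bijOn, fun n => ⟨fun c => levelElem (n + 1) (levelNum (n + 1) c).testBit,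
      fun c hc => ⟨fun p => ?_, fun q _ => ?_⟩⟩, fun n => ?_, fun n hn i hi => ?_⟩
  -- The smaller symplectic factor fixes the first coordinate pair, so the first column is settled
  -- by the level representative.
  · have h := levelElem_mulVec_unitX (exists_bit_levelNum (Nat.succ_pos n) c)
    rw [unitX, Matrix.mulVec_single_one] at h
    rw [← levelNum_testBit_low (Nat.succ_pos n) c (pos_lt p), ← vecAt_apply (j := 0) (P := p) (by omega),
      ← h]
    rfl
  · exact spElem_succ_add hc q
  · exact (Set.bijOn_univ.2 (Φ n).symm.bijective).comp (indexParams_bijOn n)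
  · refine ⟨_, _, _, fun j => ⟨rfl, rfl⟩, rfl, fun U => ?_, ?_, ⟨spVecs n (i / 4 ^ n), ?_, rfl, ?_⟩,
      toElementProg_time hn, toIndexProg_run hn hi, toIndexProg_time hn _ _ _⟩
    · rw [h1, Equiv.eq_symm_apply]
      rfl
    · obtain ⟨h1, h2, -⟩ := toElementProg_run hi
      exact ⟨fun j => by rw [(h1 j j.2).1, (h1 j j.2).2]; exact ⟨rfl, rfl⟩, h2⟩
    · simp [spVecs]
    · exact (toElementProg_run hi).2.2
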